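/- Let the scalar field be $\mathbb{R}$ or $\mathbb{C}$. For $1\le p\le\infty$, a Banach space $X$ is called an $\mathcal{L}_p$-space if there is a constant $C<\infty$ such that every finite-dimensional subspace $E\subseteq X$ is contained in a finite-dimensional subspace $F\subseteq X$ for which there is, with $n=\dim F$, a linear isomorphism $T:F\to\ell_p^n$ with $\|T\|\,\|T^{-1}\|\le C$. Write $B(X,Y)$ for the Banach space of bounded linear operators from $X$ to $Y$ with the operator norm, $B(X)=B(X,X)$, and $A\approx B$ if the Banach spaces $A$ and $B$ are linearly homeomorphic. **Theorem 2.1.** Let $1<p\le q<\infty$, let $X$ be a separable infinite-dimensional $\mathcal{L}_p$-space and let $Y$ be a separable infinite-dimensional $\mathcal{L}_q$-space. Then $$B(X,Y)\approx B(\ell_p,\ell_q)\approx\Bigl(\sum_{n=1}^\infty\oplus B(\ell_p^n,\ell_q^n)\Bigr)_\infty ,$$ where the last space consists of all sequences $(T_n)_{n\ge1}$ with $T_n\in B(\ell_p^n,\ell_q^n)$ and $\sup_n\|T_n\|<\infty$, normed by this supremum. In particular, $B(\ell_p)\approx B(L_p[0,1])$ for every $1<p<\infty$. -/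

import Mathlib

open scoped ENNReal

/-- The `n`-dimensional space `ℓ_p^n` over `𝕜`, with the `ℓ_p` norm. -/
abbrev EllFin (𝕜 : Type*) (p : ℝ≥0∞) (n : ℕ) : Type _ := PiLp p (fun _ : Fin n => 𝕜)

/-- The sequence space `ℓ_p` over `𝕜`, with the `ℓ_p` norm. -/
abbrev Ell (𝕜 : Type*) [RCLike 𝕜] (p : ℝ≥0∞) : Type _ := lp (fun _ : ℕ => 𝕜) p

/-- `X` is an `ℒ_{p,C}`-space (Lindenstrauss and Pełczyński): every finite-dimensional subspace `E`
is contained in a finite-dimensional subspace `F` whose Banach-Mazur distance to some `ℓ_p^n`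
(necessarily `n = dim F`) is at most `C`. -/
def IsScriptLpWith (𝕜 : Type*) [RCLike 𝕜] (p : ℝ≥0∞) [Fact (1 ≤ p)] (C : ℝ)
    (X : Type*) [NormedAddCommGroup X] [NormedSpace 𝕜 X] : Prop :=
  ∀ E : Submodule 𝕜 X, FiniteDimensional 𝕜 E →
    ∃ F : Submodule 𝕜 X, E ≤ F ∧ ∃ (n : ℕ) (T : F ≃L[𝕜] EllFin 𝕜 p n),
      ‖(T : F →L[𝕜] EllFin 𝕜 p n)‖ * ‖(T.symm : EllFin 𝕜 p n →L[𝕜] F)‖ ≤ C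

/-- `X` is an `ℒ_p`-space: it is an `ℒ_{p,C}`-space for some finite constant `C ≥ 1`. -/
def IsScriptLp (𝕜 : Type*) [RCLike 𝕜] (p : ℝ≥0∞) [Fact (1 ≤ p)]
    (X : Type*) [NormedAddCommGroup X] [NormedSpace 𝕜 X] : Prop :=
  ∃ C : ℝ, 1 ≤ C ∧ IsScriptLpWith 𝕜 p C X

/-- The `ℓ_∞`-direct sum of the operator spaces `B(ℓ_p^n, ℓ_q^n)` over `n ≥ 1`; the index `n : ℕ`
stands for dimension `n + 1`. -/
abbrev SumOps (𝕜 : Type*) [RCLike 𝕜] (p q : ℝ≥0∞) [Fact (1 ≤ p)] [Fact (1 ≤ q)] : Type _ :=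
  lp (fun n : ℕ => EllFin 𝕜 p (n + 1) →L[𝕜] EllFin 𝕜 q (n + 1)) ∞

/-- The Lebesgue space `L_p[0,1]` of `𝕜`-valued functions. -/
abbrev LpUnit (𝕜 : Type*) [RCLike 𝕜] (p : ℝ≥0∞) : Type _ :=
  MeasureTheory.Lp 𝕜 p (MeasureTheory.volume.restrict (Set.Icc (0 : ℝ) 1))

/-!
The three operator spaces are compared with `V = SumOps 𝕜 p q`, the space of bounded sequences of
operators `ℓ_p^n → ℓ_q^n`, by Pełczyński's decomposition method (`Factors.nonempty_equiv`): `V` is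
isomorphic to a space `A` as soon as each of the two is complemented in the other, because `V`
contains its own `ℓ_∞`-sum as a complemented subspace (`factors_lInfty_sumOps`).

Since `p ≤ q`, a bounded sequence in `V` acts as a bounded block-diagonal operator `ℓ_p → ℓ_q`, and
so `V` is complemented in `B(ℓ_p, ℓ_q)` (`factors_sumOps_operators`). If `X` and `Y` contain
complemented copies of `ℓ_p` and `ℓ_q`, then `B(ℓ_p, ℓ_q)` is complemented in `B(X, Y)`. Conversely,
suppose that the identities of `X` and `Y` are strong limits of uniformly bounded products
`Q n ∘ J n` through `ℓ_p^n` and `ℓ_q^n` (`LpApprox`). Then `T ↦ (J n ∘ T ∘ Q n)` embeds `B(X, Y)`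
into `V`, and a projection is obtained from the limits of `Q n ∘ T n ∘ J n` in the weak operator
topology along an ultrafilter (`LpApprox.factors_operators_sumOps`). The limits exist because `Y`
inherits from `ℓ_q^n` an equivalent uniformly convex norm (`IsUniformlyConvexGauge.hasWeakLimits`).

Two facts about a separable infinite-dimensional `ℒ_p`-space `X` with `1 < p < ∞` remain. Both are
proved without the representation of `X` as a subspace of `L_p(μ)`.

* `IsScriptLp.nonempty_lpApprox`: the approximations `Q n ∘ J n` exist. The definition gives
  isomorphisms onto `ℓ_p^k` on finite-dimensional subspaces, not operators on `X`. Finitely many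
  vectors of `ℓ_p^k` are compressed, up to a small error, into `ℓ_p^m` with `m` independent of `k`
  (`EllFin.exists_compression`), and an ultrafilter limit over the subspaces then defines an operator
  from `X` to `ℓ_p^m`.
* `IsScriptLp.factors_ell`: `X` contains a complemented copy of `ℓ_p`. For `p > 2` this is the
  argument of Kadec and Pełczyński: either the norm is equivalent to a weighted `ℓ_2` norm, which is
  impossible for an `ℒ_p`-space, or there is a sequence of almost disjoint vectors
  (`exists_almost_disjoint`), which spans a complemented copy of `ℓ_p`. For `p < 2` the same argument
  is applied to the dual of `X`, and for `p = 2` an orthonormal sequence is used.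

For `L_p[0,1]` the approximations are the averaging operators of partitions into intervals, and
disjointly supported functions span a complemented copy of `ℓ_p`.
-/

open Filter Topology

/-! ### Complemented embeddings and the decomposition method -/

/-- `Factors 𝕜 A B`: the identity of `A` factors through `B`, i.e. `A` is isomorphic to a
complemented subspace of `B`. -/
def Factors (𝕜 : Type*) [RCLike 𝕜] (A B : Type*) [NormedAddCommGroup A] [NormedSpace 𝕜 A]
    [NormedAddCommGroup B] [NormedSpace 𝕜 B] : Prop :=
  ∃ (i : A →L[𝕜] B) (s : B →L[𝕜] A), ∀ x, s (i x) = x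

section Factors

variable {𝕜 : Type*} [RCLike 𝕜]
variable {A B D : Type*} [NormedAddCommGroup A] [NormedSpace 𝕜 A]
  [NormedAddCommGroup B] [NormedSpace 𝕜 B] [NormedAddCommGroup D] [NormedSpace 𝕜 D]

theorem Factors.refl : Factors 𝕜 A A := ⟨.id 𝕜 A, .id 𝕜 A, fun _ => rfl⟩

theorem Factors.trans (h₁ : Factors 𝕜 A B) (h₂ : Factors 𝕜 B D) : Factors 𝕜 A D := by
  obtain ⟨i, s, h⟩ := h₁
  obtain ⟨i', s', h'⟩ := h₂
  exact ⟨i' ∘L i, s ∘L s', fun x => by simp [h, h']⟩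

theorem Factors.operators {X Y : Type*} [NormedAddCommGroup X] [NormedSpace 𝕜 X]
    [NormedAddCommGroup Y] [NormedSpace 𝕜 Y] (hX : Factors 𝕜 A X) (hY : Factors 𝕜 B Y) :
    Factors 𝕜 (A →L[𝕜] B) (X →L[𝕜] Y) := by
  obtain ⟨i, s, h⟩ := hX
  obtain ⟨j, t, h'⟩ := hY
  refine ⟨(ContinuousLinearMap.compL 𝕜 X B Y j) ∘L ((ContinuousLinearMap.compL 𝕜 X A B).flip s),
    (ContinuousLinearMap.compL 𝕜 A Y B t) ∘L ((ContinuousLinearMap.compL 𝕜 A X Y).flip i), ?_⟩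
  intro T
  ext x
  simp [h, h']

theorem Factors.exists_prod (h : Factors 𝕜 A B) :
    ∃ W : Submodule 𝕜 B, Nonempty (B ≃L[𝕜] A × W) := by
  obtain ⟨i, s, h⟩ := h
  exact ⟨s.ker, ⟨ContinuousLinearEquiv.equivOfRightInverse s i h⟩⟩

/-- A uniformly bounded sequence of operators into the spaces `G n`, as one operator into their
`ℓ_∞`-sum. -/
noncomputable def lpInftyMk {G : ℕ → Type*} [∀ n, NormedAddCommGroup (G n)]
    [∀ n, NormedSpace 𝕜 (G n)] (f : ∀ n, A →L[𝕜] G n) (C : ℝ) (hC : ∀ n x, ‖f n x‖ ≤ C * ‖x‖) :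
    A →L[𝕜] lp G ∞ :=
  LinearMap.mkContinuous
    { toFun := fun x => ⟨fun n => f n x, memℓp_infty ⟨C * ‖x‖, by
        rintro _ ⟨n, rfl⟩; exact hC n x⟩⟩
      map_add' := fun x y => by ext n; exact (f n).map_add x y
      map_smul' := fun c x => by ext n; exact (f n).map_smul c x }
    C (fun x => by
      have h0 : 0 ≤ C * ‖x‖ := (norm_nonneg _).trans (hC 0 x)
      exact lp.norm_le_of_forall_le h0 fun n => hC n x)

@[simp] theorem lpInftyMk_apply {G : ℕ → Type*} [∀ n, NormedAddCommGroup (G n)]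
    [∀ n, NormedSpace 𝕜 (G n)] (f : ∀ n, A →L[𝕜] G n) (C : ℝ) (hC : ∀ n x, ‖f n x‖ ≤ C * ‖x‖)
    (x : A) (n : ℕ) : lpInftyMk f C hC x n = f n x := rfl

/-- The `ℓ_∞`-sum of countably many copies of `B`. -/
abbrev LInfty (B : Type*) [NormedAddCommGroup B] : Type _ := lp (fun _ : ℕ => B) ∞

theorem norm_lp_infty_apply_le {G : ℕ → Type*} [∀ n, NormedAddCommGroup (G n)] (x : lp G ∞)
    (n : ℕ) : ‖x n‖ ≤ ‖x‖ := lp.norm_apply_le_norm (by simp) x n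

/-- If `A` is complemented in `B`, then `ℓ_∞(B)` absorbs `A`: the `A`-components of a sequence in
`B` are shifted by one place to make room for one more. -/
theorem Factors.nonempty_lInfty_equiv_prod (h : Factors 𝕜 A B) :
    Nonempty (LInfty B ≃L[𝕜] A × LInfty B) := by
  obtain ⟨i, s, h⟩ := h
  let π : B →L[𝕜] B := i ∘L s
  have hπ : ∀ x, π (π x) = π x := fun x => by simp [π, h]
  have hπi : ∀ x, π (i x) = i x := fun x => by simp [π, h]
  let e : ∀ n, LInfty B →L[𝕜] B := fun n => lp.evalCLM 𝕜 (fun _ : ℕ => B) ∞ n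
  have he : ∀ n x, e n x = x n := fun _ _ => rfl
  -- `F` shifts the components in the range of `π` one place down and leaves the complementary
  -- components in place; `G` shifts them up again and inserts the new component at place `0`
  let F : LInfty B →L[𝕜] LInfty B := lpInftyMk (fun n => π ∘L e (n + 1) + (e n - π ∘L e n))
    (‖π‖ + (1 + ‖π‖)) (fun n x => by
      simp only [add_apply, sub_apply,
        ContinuousLinearMap.comp_apply, he]
      have h1 := (π.le_opNorm (x (n + 1))).trans
        (mul_le_mul_of_nonneg_left (norm_lp_infty_apply_le x (n + 1)) (norm_nonneg _))
      have h2 := (π.le_opNorm (x n)).trans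
        (mul_le_mul_of_nonneg_left (norm_lp_infty_apply_le x n) (norm_nonneg _))
      have h3 := norm_lp_infty_apply_le x n
      have h4 := norm_add_le (π (x (n + 1))) (x n - π (x n))
      have h5 := norm_sub_le (x n) (π (x n))
      linarith)
  let G : A × LInfty B →L[𝕜] LInfty B := lpInftyMk (fun n =>
      (e n - π ∘L e n) ∘L ContinuousLinearMap.snd 𝕜 A (LInfty B) +
        (match n with
          | 0 => i ∘L ContinuousLinearMap.fst 𝕜 A (LInfty B)
          | m + 1 => π ∘L e m ∘L ContinuousLinearMap.snd 𝕜 A (LInfty B)))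
    ((1 + ‖π‖) + (‖i‖ + ‖π‖)) (fun n x => by
      have h1 : ‖x.2 n - π (x.2 n)‖ ≤ (1 + ‖π‖) * ‖x‖ := by
        have h3 := (norm_lp_infty_apply_le x.2 n).trans (norm_snd_le x)
        have h2 := (π.le_opNorm (x.2 n)).trans
          (mul_le_mul_of_nonneg_left h3 (norm_nonneg _))
        have h5 := norm_sub_le (x.2 n) (π (x.2 n))
        linarith
      cases n with
      | zero =>
        have h2 := (i.le_opNorm x.1).trans
          (mul_le_mul_of_nonneg_left (norm_fst_le x) (norm_nonneg _))
        refine (norm_add_le _ _).trans (?_ : ‖x.2 0 - π (x.2 0)‖ + ‖i x.1‖ ≤ _)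
        have h3 : 0 ≤ ‖π‖ * ‖x‖ := by positivity
        linarith
      | succ m =>
        have h2 := (π.le_opNorm (x.2 m)).trans (mul_le_mul_of_nonneg_left
          ((norm_lp_infty_apply_le x.2 m).trans (norm_snd_le x)) (norm_nonneg _))
        refine (norm_add_le _ _).trans
          (?_ : ‖x.2 (m + 1) - π (x.2 (m + 1))‖ + ‖π (x.2 m)‖ ≤ _)
        have h3 : 0 ≤ ‖i‖ * ‖x‖ := by positivity
        linarith)
  refine ⟨ContinuousLinearEquiv.equivOfInverse ((s ∘L e 0).prod F) G ?_ ?_⟩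
  · intro v
    ext n
    cases n with
    | zero => simp [G, F, he, π, h]
    | succ m => simp [G, F, he, hπ]
  · rintro ⟨a, u⟩
    refine Prod.ext ?_ ?_
    · simp [G, he, h, π]
    · ext n
      cases n with
      | zero => simp [G, F, he, hπ, hπi]
      | succ m => simp [G, F, he, hπ]

/-- Pełczyński's decomposition method: two spaces that are complemented in each other are
isomorphic, provided that one of them contains its own `ℓ_∞`-sum as a complemented subspace. -/
theorem Factors.nonempty_equiv (hAB : Factors 𝕜 A B) (hBA : Factors 𝕜 B A)
    (hB : Factors 𝕜 (LInfty B) B) : Nonempty (A ≃L[𝕜] B) := by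
  have absorb : ∀ {D : Type _} [NormedAddCommGroup D] [NormedSpace 𝕜 D], Factors 𝕜 D B →
      Nonempty (B ≃L[𝕜] D × B) := by
    intro D _ _ hD
    obtain ⟨R, ⟨e⟩⟩ := hB.exists_prod
    obtain ⟨f⟩ := hD.nonempty_lInfty_equiv_prod
    exact ⟨(e.trans (f.prodCongr (.refl 𝕜 R))).trans
      ((ContinuousLinearEquiv.prodAssoc 𝕜 D (LInfty B) R).trans
        ((ContinuousLinearEquiv.refl 𝕜 D).prodCongr e.symm))⟩
  obtain ⟨e₁⟩ := absorb hAB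
  obtain ⟨R, ⟨e⟩⟩ := hB.exists_prod
  obtain ⟨f⟩ := (Factors.refl (𝕜 := 𝕜) (A := B)).nonempty_lInfty_equiv_prod
  let e₂ : B ≃L[𝕜] B × B := (e.trans (f.prodCongr (.refl 𝕜 R))).trans
      ((ContinuousLinearEquiv.prodAssoc 𝕜 B (LInfty B) R).trans
        ((ContinuousLinearEquiv.refl 𝕜 B).prodCongr e.symm))
  obtain ⟨Z, ⟨g⟩⟩ := hBA.exists_prod
  -- `A ≃ B × Z ≃ (B × B) × Z ≃ B × A ≃ A × B ≃ B`
  exact ⟨((((g.trans (e₂.prodCongr (.refl 𝕜 Z))).trans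
    (ContinuousLinearEquiv.prodAssoc 𝕜 B B Z)).trans
      ((ContinuousLinearEquiv.refl 𝕜 B).prodCongr g.symm)).trans
        (ContinuousLinearEquiv.prodComm 𝕜 B A)).trans e₁.symm⟩

end Factors

/-! ### Operators into and out of `ℓ_p^n` and `ℓ_p` -/

section Coordinates

variable {𝕜 : Type*} [RCLike 𝕜] {p q : ℝ≥0∞} [hp1 : Fact (1 ≤ p)] [hq1 : Fact (1 ≤ q)]

theorem one_le_toReal_of_fact (p : ℝ≥0∞) [hp1 : Fact (1 ≤ p)] (hp : p ≠ ∞) : 1 ≤ p.toReal := by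
  have := (ENNReal.toReal_le_toReal (by simp) hp).2 hp1.out
  simpa using this

theorem toReal_pos_of_fact (p : ℝ≥0∞) [hp1 : Fact (1 ≤ p)] (hp : p ≠ ∞) : 0 < p.toReal :=
  zero_lt_one.trans_le (one_le_toReal_of_fact p hp)

theorem EllFin.norm_rpow (hp : p ≠ ∞) {n : ℕ} (x : EllFin 𝕜 p n) :
    ‖x‖ ^ p.toReal = ∑ j, ‖x j‖ ^ p.toReal := by
  have h := toReal_pos_of_fact p hp
  rw [PiLp.norm_eq_sum h, ← Real.rpow_mul (Finset.sum_nonneg fun _ _ => by positivity)]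
  simp [h.ne']

theorem EllFin.norm_le_of_sum_le (hp : p ≠ ∞) {n : ℕ} {x : EllFin 𝕜 p n} {C : ℝ} (hC : 0 ≤ C)
    (h : ∑ j, ‖x j‖ ^ p.toReal ≤ C ^ p.toReal) : ‖x‖ ≤ C := by
  rw [← EllFin.norm_rpow hp] at h
  exact (Real.rpow_le_rpow_iff (norm_nonneg _) hC (toReal_pos_of_fact p hp)).1 h

theorem EllFin.norm_le_of_forall_le (hp : p ≠ ∞) {n : ℕ} {x : EllFin 𝕜 p n} {C : ℝ} (hC : 0 ≤ C)
    {w : Fin n → ℝ} (hx : ∀ j, ‖x j‖ ≤ w j) (h : ∑ j, w j ^ p.toReal ≤ C ^ p.toReal) : ‖x‖ ≤ C :=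
  EllFin.norm_le_of_sum_le hp hC ((Finset.sum_le_sum fun j _ => Real.rpow_le_rpow (norm_nonneg _)
    (hx j) (toReal_pos_of_fact p hp).le).trans h)

variable {E : Type*} [NormedAddCommGroup E] [NormedSpace 𝕜 E]

/-- A bounded operator into `ℓ_p^n`, given by its coordinates. -/
noncomputable def EllFin.mkCLM (hp : p ≠ ∞) {n : ℕ} (f : E →ₗ[𝕜] (Fin n → 𝕜)) (C : ℝ) (hC : 0 ≤ C)
    (h : ∀ x, ∑ j, ‖f x j‖ ^ p.toReal ≤ (C * ‖x‖) ^ p.toReal) : E →L[𝕜] EllFin 𝕜 p n :=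
  LinearMap.mkContinuous ((WithLp.linearEquiv p 𝕜 (Fin n → 𝕜)).symm.toLinearMap ∘ₗ f) C
    fun x => EllFin.norm_le_of_sum_le hp (by positivity) (h x)

section
variable (hp : p ≠ ∞) {n : ℕ} (f : E →ₗ[𝕜] (Fin n → 𝕜)) (C : ℝ) (hC : 0 ≤ C)
    (h : ∀ x, ∑ j, ‖f x j‖ ^ p.toReal ≤ (C * ‖x‖) ^ p.toReal)

@[simp] theorem EllFin.mkCLM_apply (x : E) (j : Fin n) : EllFin.mkCLM hp f C hC h x j = f x j := rfl

theorem EllFin.norm_mkCLM_le : ‖EllFin.mkCLM hp f C hC h‖ ≤ C :=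
  LinearMap.mkContinuous_norm_le _ hC _
end

/-- A bounded operator into `ℓ_p`, given by its coordinates. -/
noncomputable def Ell.mkCLM (hp : p ≠ ∞) (f : E →ₗ[𝕜] (ℕ → 𝕜)) (C : ℝ) (hC : 0 ≤ C)
    (h : ∀ x (s : Finset ℕ), ∑ j ∈ s, ‖f x j‖ ^ p.toReal ≤ (C * ‖x‖) ^ p.toReal) :
    E →L[𝕜] Ell 𝕜 p :=
  LinearMap.mkContinuous
    { toFun := fun x => ⟨f x, memℓp_gen' (h x)⟩
      map_add' := fun x y => by ext n; simp only [map_add]; rfl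
      map_smul' := fun c x => by ext n; simp only [map_smul]; rfl } C
    fun x => lp.norm_le_of_forall_sum_le (toReal_pos_of_fact p hp) (by positivity) (h x)

section
variable (hp : p ≠ ∞) (f : E →ₗ[𝕜] (ℕ → 𝕜)) (C : ℝ) (hC : 0 ≤ C)
    (h : ∀ x (s : Finset ℕ), ∑ j ∈ s, ‖f x j‖ ^ p.toReal ≤ (C * ‖x‖) ^ p.toReal)

@[simp] theorem Ell.mkCLM_apply (x : E) (j : ℕ) : Ell.mkCLM hp f C hC h x j = f x j := rfl

theorem Ell.norm_mkCLM_le : ‖Ell.mkCLM hp f C hC h‖ ≤ C :=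
  LinearMap.mkContinuous_norm_le _ hC _
end

variable (𝕜) in
/-- The operator `ℓ_p^a → ℓ_p^b` that truncates a vector or pads it with zeros. -/
noncomputable def EllFin.pad (p : ℝ≥0∞) [Fact (1 ≤ p)] (hp : p ≠ ∞) (a b : ℕ) :
    EllFin 𝕜 p a →L[𝕜] EllFin 𝕜 p b :=
  EllFin.mkCLM hp
    { toFun := fun x j => if h : j.1 < a then x ⟨j, h⟩ else 0
      map_add' := fun x y => by ext j; by_cases h : j.1 < a <;> simp [h]
      map_smul' := fun c x => by ext j; by_cases h : j.1 < a <;> simp [h] } 1 zero_le_one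
    fun x => by
      have hP := toReal_pos_of_fact p hp
      rw [one_mul, EllFin.norm_rpow hp]
      simp only [LinearMap.coe_mk, AddHom.coe_mk]
      let F : ℕ → ℝ := fun j => if h : j < a then ‖x ⟨j, h⟩‖ ^ p.toReal else 0
      have hF0 : ∀ j, 0 ≤ F j := fun j => by
        by_cases h : j < a <;> simp only [F, h, dite_true, dite_false, le_refl]; positivity
      have h1 : ∀ j : Fin b, ‖if h : j.1 < a then x ⟨j, h⟩ else 0‖ ^ p.toReal = F j := fun j => by
        by_cases h : j.1 < a <;> simp [F, h, hP.ne']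
      have h2 : ∀ j : Fin a, ‖x j‖ ^ p.toReal = F j := fun j => by simp [F]
      simp only [h1, h2]
      rw [Fin.sum_univ_eq_sum_range F, Fin.sum_univ_eq_sum_range F]
      rcases le_total b a with hab | hab
      · exact Finset.sum_le_sum_of_subset_of_nonneg (Finset.range_mono hab) fun j _ _ => hF0 j
      · refine (Finset.sum_subset (Finset.range_mono hab) fun j _ hj => ?_).ge
        simp only [Finset.mem_range] at hj
        simp [F, hj]

theorem EllFin.pad_apply (hp : p ≠ ∞) {a b : ℕ} (x : EllFin 𝕜 p a) (j : Fin b) :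
    EllFin.pad 𝕜 p hp a b x j = if h : j.1 < a then x ⟨j, h⟩ else 0 := rfl

theorem EllFin.norm_pad_le (hp : p ≠ ∞) (a b : ℕ) : ‖EllFin.pad 𝕜 p hp a b‖ ≤ 1 :=
  EllFin.norm_mkCLM_le _ _ _ _ _

theorem EllFin.norm_pad_apply_le (hp : p ≠ ∞) {a : ℕ} (b : ℕ) (x : EllFin 𝕜 p a) :
    ‖EllFin.pad 𝕜 p hp a b x‖ ≤ ‖x‖ := by
  simpa using (EllFin.pad 𝕜 p hp a b).le_of_opNorm_le (EllFin.norm_pad_le hp a b) x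

theorem EllFin.pad_pad (hp : p ≠ ∞) {a b : ℕ} (hab : a ≤ b) (x : EllFin 𝕜 p a) :
    EllFin.pad 𝕜 p hp b a (EllFin.pad 𝕜 p hp a b x) = x := by
  ext j
  rw [EllFin.pad_apply, dif_pos (j.2.trans_le hab), EllFin.pad_apply, dif_pos j.2]

/-! ### The space of block-diagonal operators -/

/-- The `ℓ_∞`-sum of countably many copies of `SumOps` is complemented in `SumOps`: the entry `n` of
the copy `m` is stored, after padding, in the block number `Nat.pair m n ≥ n`. -/
theorem factors_lInfty_sumOps (hp : p ≠ ∞) (hq : q ≠ ∞) :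
    Factors 𝕜 (LInfty (SumOps 𝕜 p q)) (SumOps 𝕜 p q) := by
  let conj : ∀ a b, (EllFin 𝕜 p a →L[𝕜] EllFin 𝕜 q a) →L[𝕜] (EllFin 𝕜 p b →L[𝕜] EllFin 𝕜 q b) :=
    fun a b => (ContinuousLinearMap.compL 𝕜 _ _ _ (EllFin.pad 𝕜 q hq a b)) ∘L
      ((ContinuousLinearMap.compL 𝕜 _ _ _).flip (EllFin.pad 𝕜 p hp b a))
  have hconj : ∀ a b T x, conj a b T x = EllFin.pad 𝕜 q hq a b (T (EllFin.pad 𝕜 p hp b a x)) :=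
    fun a b T x => rfl
  have hnorm : ∀ a b T, ‖conj a b T‖ ≤ ‖T‖ := fun a b T => by
    refine ContinuousLinearMap.opNorm_le_bound _ (norm_nonneg _) fun x => ?_
    rw [hconj]
    refine (EllFin.norm_pad_apply_le hq _ _).trans ((T.le_opNorm _).trans ?_)
    exact mul_le_mul_of_nonneg_left (EllFin.norm_pad_apply_le hp _ _) (norm_nonneg _)
  have hinv : ∀ a b T, a ≤ b → conj b a (conj a b T) = T := fun a b T hab => by
    ext1 x
    rw [hconj, hconj, EllFin.pad_pad hp hab, EllFin.pad_pad hq hab]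
  let ev : ∀ n, SumOps 𝕜 p q →L[𝕜] (EllFin 𝕜 p (n + 1) →L[𝕜] EllFin 𝕜 q (n + 1)) := fun n =>
    lp.evalCLM 𝕜 _ ∞ n
  let ev' : ∀ _ : ℕ, LInfty (SumOps 𝕜 p q) →L[𝕜] SumOps 𝕜 p q := fun n => lp.evalCLM 𝕜 _ ∞ n
  refine ⟨lpInftyMk (fun t => conj (t.unpair.2 + 1) (t + 1) ∘L ev t.unpair.2 ∘L ev' t.unpair.1) 1
    (fun t x => ?_), lpInftyMk (fun m => lpInftyMk
      (fun n => conj (Nat.pair m n + 1) (n + 1) ∘L ev (Nat.pair m n)) 1 (fun n x => ?_)) 1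
      (fun m x => ?_), fun x => ?_⟩
  · rw [one_mul]
    exact (hnorm _ _ _).trans ((norm_lp_infty_apply_le _ _).trans (norm_lp_infty_apply_le _ _))
  · rw [one_mul]
    exact (hnorm _ _ _).trans (norm_lp_infty_apply_le _ _)
  · rw [one_mul]
    refine lp.norm_le_of_forall_le (norm_nonneg _) fun n => ?_
    exact (hnorm _ _ _).trans (norm_lp_infty_apply_le _ _)
  · ext m n : 4
    have key : ∀ u : ℕ × ℕ, u = (m, n) → conj (Nat.pair m n + 1) (n + 1)
        (conj (u.2 + 1) (Nat.pair m n + 1) (x u.1 u.2)) = x m n := by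
      rintro _ rfl
      exact hinv _ _ _ (by simpa using Nat.right_le_pair m n)
    exact key _ (Nat.unpair_pair m n)

/-- Placing a vector on the coordinates given by `g`, and zeros elsewhere, does not increase its
`ℓ_p` norm. -/
theorem sum_norm_extend_le {k : ℕ} {P : ℝ} (hP : 0 < P) (g : Fin k → ℕ)
    (hg : Function.Injective g) (y : Fin k → 𝕜) (s : Finset ℕ) :
    ∑ t ∈ s, ‖Function.extend g y 0 t‖ ^ P ≤ ∑ j, ‖y j‖ ^ P := by
  classical
  calc ∑ t ∈ s, ‖Function.extend g y 0 t‖ ^ P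
      = ∑ t ∈ s with t ∈ Finset.univ.image g, ‖Function.extend g y 0 t‖ ^ P := by
        refine (Finset.sum_filter_of_ne fun t _ ht => ?_).symm
        by_contra hcon
        refine ht ?_
        rw [Function.extend_apply' _ _ _ (by simpa using hcon)]
        simp [hP.ne']
    _ ≤ ∑ t ∈ Finset.univ.image g, ‖Function.extend g y 0 t‖ ^ P := by
        refine Finset.sum_le_sum_of_subset_of_nonneg ?_ fun _ _ _ => by positivity
        intro t ht
        exact (Finset.mem_filter.1 ht).2
    _ = ∑ j, ‖y j‖ ^ P := by
        rw [Finset.sum_image fun a _ b _ h => hg h]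
        simp [hg.extend_apply]

section Blocks

variable (e : (Σ n : ℕ, Fin (n + 1)) ≃ ℕ)

theorem block_injective (n : ℕ) : Function.Injective fun j : Fin (n + 1) => e ⟨n, j⟩ :=
  fun a b h => by simpa using e.injective h

variable (𝕜) in
/-- The restriction of a sequence to the `n`-th block of a partition of `ℕ` into blocks of sizes
`1, 2, 3, …`. -/
noncomputable def Ell.blockRestrict (p : ℝ≥0∞) [Fact (1 ≤ p)] (hp : p ≠ ∞) (n : ℕ) :
    Ell 𝕜 p →L[𝕜] EllFin 𝕜 p (n + 1) :=
  EllFin.mkCLM hp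
    { toFun := fun x j => x (e ⟨n, j⟩)
      map_add' := fun x y => by ext j; simp
      map_smul' := fun c x => by ext j; simp } 1 zero_le_one fun x => by
      classical
      rw [one_mul]
      refine le_trans (le_of_eq ?_) (lp.sum_rpow_le_norm_rpow (toReal_pos_of_fact p hp) x
        (Finset.univ.image fun j : Fin (n + 1) => e ⟨n, j⟩))
      rw [Finset.sum_image fun a _ b _ h => block_injective e n h]
      rfl

theorem Ell.blockRestrict_apply (hp : p ≠ ∞) (n : ℕ) (x : Ell 𝕜 p) (j : Fin (n + 1)) :
    Ell.blockRestrict 𝕜 e p hp n x j = x (e ⟨n, j⟩) := rfl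

theorem Ell.norm_blockRestrict_apply_le (hp : p ≠ ∞) (n : ℕ) (x : Ell 𝕜 p) :
    ‖Ell.blockRestrict 𝕜 e p hp n x‖ ≤ ‖x‖ := by
  simpa using (Ell.blockRestrict 𝕜 e p hp n).le_of_opNorm_le (EllFin.norm_mkCLM_le _ _ _ _ _) x

theorem Ell.sum_norm_blockRestrict_le (hp : p ≠ ∞) (x : Ell 𝕜 p) (N : ℕ) :
    ∑ n ∈ Finset.range N, ‖Ell.blockRestrict 𝕜 e p hp n x‖ ^ p.toReal ≤ ‖x‖ ^ p.toReal := by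
  have h := lp.sum_rpow_le_norm_rpow (toReal_pos_of_fact p hp) x
    (((Finset.range N).sigma fun n => (Finset.univ : Finset (Fin (n + 1)))).map e.toEmbedding)
  rw [Finset.sum_map, Finset.sum_sigma] at h
  refine le_trans (le_of_eq (Finset.sum_congr rfl fun n _ => ?_)) h
  rw [EllFin.norm_rpow hp]
  rfl

variable (𝕜) in
/-- The embedding of `ℓ_p^{n+1}` into `ℓ_p` as the `n`-th block. -/
noncomputable def Ell.blockEmbed (p : ℝ≥0∞) [Fact (1 ≤ p)] (hp : p ≠ ∞) (n : ℕ) :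
    EllFin 𝕜 p (n + 1) →L[𝕜] Ell 𝕜 p :=
  Ell.mkCLM hp
    { toFun := fun y => Function.extend (fun j : Fin (n + 1) => e ⟨n, j⟩) (fun j => y j) 0
      map_add' := fun x y => by
        rw [← Function.extend_add]; simp; rfl
      map_smul' := fun c x => by
        ext t
        by_cases ht : ∃ j : Fin (n + 1), e ⟨n, j⟩ = t
        · obtain ⟨j, rfl⟩ := ht
          simp [(block_injective e n).extend_apply _ _ j]
        · simp [Function.extend_apply' _ _ _ ht] } 1 zero_le_one fun x s => by
      rw [one_mul, EllFin.norm_rpow hp]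
      exact sum_norm_extend_le (toReal_pos_of_fact p hp) _ (block_injective e n) _ s

theorem Ell.blockEmbed_apply (hp : p ≠ ∞) (n : ℕ) (y : EllFin 𝕜 p (n + 1)) (j : Fin (n + 1)) :
    Ell.blockEmbed 𝕜 e p hp n y (e ⟨n, j⟩) = y j :=
  (block_injective e n).extend_apply _ _ j

theorem Ell.norm_blockEmbed_apply_le (hp : p ≠ ∞) (n : ℕ) (y : EllFin 𝕜 p (n + 1)) :
    ‖Ell.blockEmbed 𝕜 e p hp n y‖ ≤ ‖y‖ := by
  simpa using (Ell.blockEmbed 𝕜 e p hp n).le_of_opNorm_le (Ell.norm_mkCLM_le _ _ _ _ _) y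

theorem Ell.blockRestrict_blockEmbed (hp : p ≠ ∞) (n : ℕ) (y : EllFin 𝕜 p (n + 1)) :
    Ell.blockRestrict 𝕜 e p hp n (Ell.blockEmbed 𝕜 e p hp n y) = y := by
  ext j
  rw [Ell.blockRestrict_apply, Ell.blockEmbed_apply]

/-- Every bounded sequence of blocks acts boundedly from `ℓ_p` to `ℓ_q`. The hypothesis `p ≤ q` is
indispensable here. -/
theorem sum_blockDiagonal_le (hp : p ≠ ∞) (hq : q ≠ ∞) (hpq : p ≤ q) (T : SumOps 𝕜 p q)
    (x : Ell 𝕜 p) (N : ℕ) :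
    ∑ n ∈ Finset.range N, ‖T n (Ell.blockRestrict 𝕜 e p hp n x)‖ ^ q.toReal ≤
      (‖T‖ * ‖x‖) ^ q.toReal := by
  have hP := toReal_pos_of_fact p hp
  have hQ := toReal_pos_of_fact q hq
  have hPQ : p.toReal ≤ q.toReal := (ENNReal.toReal_le_toReal hp hq).2 hpq
  calc ∑ n ∈ Finset.range N, ‖T n (Ell.blockRestrict 𝕜 e p hp n x)‖ ^ q.toReal
      ≤ ∑ n ∈ Finset.range N, (‖T‖ ^ q.toReal * ‖x‖ ^ (q.toReal - p.toReal)) *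
          ‖Ell.blockRestrict 𝕜 e p hp n x‖ ^ p.toReal := by
        refine Finset.sum_le_sum fun n _ => ?_
        have h0 := Ell.norm_blockRestrict_apply_le e hp n x
        generalize Ell.blockRestrict 𝕜 e p hp n x = y at h0 ⊢
        have h1 : ‖T n y‖ ≤ ‖T‖ * ‖y‖ := (T n).le_of_opNorm_le (norm_lp_infty_apply_le T n) _
        refine (Real.rpow_le_rpow (norm_nonneg _) h1 hQ.le).trans ?_
        rw [Real.mul_rpow (norm_nonneg _) (norm_nonneg _), mul_assoc]
        refine mul_le_mul_of_nonneg_left ?_ (by positivity)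
        calc ‖y‖ ^ q.toReal = ‖y‖ ^ (q.toReal - p.toReal) * ‖y‖ ^ p.toReal := by
              rw [← Real.rpow_add_of_nonneg (norm_nonneg _) (by linarith) hP.le, sub_add_cancel]
          _ ≤ _ := by
              refine mul_le_mul_of_nonneg_right ?_ (by positivity)
              exact Real.rpow_le_rpow (norm_nonneg _) h0 (by linarith)
    _ = (‖T‖ ^ q.toReal * ‖x‖ ^ (q.toReal - p.toReal)) *
          ∑ n ∈ Finset.range N, ‖Ell.blockRestrict 𝕜 e p hp n x‖ ^ p.toReal := by
        rw [Finset.mul_sum]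
    _ ≤ (‖T‖ ^ q.toReal * ‖x‖ ^ (q.toReal - p.toReal)) * ‖x‖ ^ p.toReal :=
        mul_le_mul_of_nonneg_left (Ell.sum_norm_blockRestrict_le e hp x N) (by positivity)
    _ = (‖T‖ * ‖x‖) ^ q.toReal := by
        rw [Real.mul_rpow (norm_nonneg _) (norm_nonneg _), mul_assoc,
          ← Real.rpow_add_of_nonneg (norm_nonneg _) (by linarith) hP.le, sub_add_cancel]

/-- The block-diagonal operator `ℓ_p → ℓ_q` with the blocks `T n`. -/
noncomputable def blockDiagonal (hp : p ≠ ∞) (hq : q ≠ ∞) (hpq : p ≤ q) (T : SumOps 𝕜 p q) :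
    Ell 𝕜 p →L[𝕜] Ell 𝕜 q :=
  Ell.mkCLM hq
    { toFun := fun x t => T (e.symm t).1 (Ell.blockRestrict 𝕜 e p hp (e.symm t).1 x) (e.symm t).2
      map_add' := fun x y => by ext t; simp
      map_smul' := fun c x => by ext t; simp } ‖T‖ (norm_nonneg _) fun x s => by
      simp only [LinearMap.coe_mk, AddHom.coe_mk]
      let G : (Σ n : ℕ, Fin (n + 1)) → ℝ := fun u =>
        ‖T u.1 (Ell.blockRestrict 𝕜 e p hp u.1 x) u.2‖ ^ q.toReal
      have hG : ∀ u, 0 ≤ G u := fun u => by positivity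
      let N := (s.image fun t => (e.symm t).1).sup id + 1
      calc ∑ t ∈ s, G (e.symm t) = ∑ u ∈ s.map e.symm.toEmbedding, G u := by
            rw [Finset.sum_map]; rfl
        _ ≤ ∑ u ∈ (Finset.range N).sigma fun n => Finset.univ, G u := by
            refine Finset.sum_le_sum_of_subset_of_nonneg ?_ fun u _ _ => hG u
            intro u hu
            simp only [Finset.mem_map_equiv, Equiv.symm_symm] at hu
            simp only [Finset.mem_sigma, Finset.mem_range, Finset.mem_univ, and_true]
            refine Nat.lt_succ_of_le (Finset.le_sup (f := id) ?_)
            exact Finset.mem_image.2 ⟨e u, hu, by simp⟩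
        _ = ∑ n ∈ Finset.range N, ‖T n (Ell.blockRestrict 𝕜 e p hp n x)‖ ^ q.toReal := by
            rw [Finset.sum_sigma]
            refine Finset.sum_congr rfl fun n _ => ?_
            rw [EllFin.norm_rpow hq]
        _ ≤ _ := sum_blockDiagonal_le e hp hq hpq T x N

theorem norm_blockDiagonal_le (hp : p ≠ ∞) (hq : q ≠ ∞) (hpq : p ≤ q) (T : SumOps 𝕜 p q) :
    ‖blockDiagonal e hp hq hpq T‖ ≤ ‖T‖ := by
  unfold blockDiagonal
  apply Ell.norm_mkCLM_le

theorem blockDiagonal_apply' (hp : p ≠ ∞) (hq : q ≠ ∞) (hpq : p ≤ q) (T : SumOps 𝕜 p q)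
    (x : Ell 𝕜 p) (t : ℕ) : blockDiagonal e hp hq hpq T x t =
      T (e.symm t).1 (Ell.blockRestrict 𝕜 e p hp (e.symm t).1 x) (e.symm t).2 := rfl

theorem blockDiagonal_apply (hp : p ≠ ∞) (hq : q ≠ ∞) (hpq : p ≤ q) (T : SumOps 𝕜 p q)
    (x : Ell 𝕜 p) (n : ℕ) (j : Fin (n + 1)) : blockDiagonal e hp hq hpq T x (e ⟨n, j⟩) =
      T n (Ell.blockRestrict 𝕜 e p hp n x) j := by
  have key : ∀ u : (Σ n : ℕ, Fin (n + 1)), u = ⟨n, j⟩ →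
      T u.1 (Ell.blockRestrict 𝕜 e p hp u.1 x) u.2 =
        T n (Ell.blockRestrict 𝕜 e p hp n x) j := by rintro _ rfl; rfl
  exact key _ (e.symm_apply_apply _)

/-- For `p ≤ q` the block-diagonal operators form a complemented subspace of `B(ℓ_p, ℓ_q)`. -/
theorem factors_sumOps_operators (hpq : p ≤ q) (hq : q ≠ ∞) :
    Factors 𝕜 (SumOps 𝕜 p q) (Ell 𝕜 p →L[𝕜] Ell 𝕜 q) := by
  have hp : p ≠ ∞ := ne_top_of_le_ne_top hq hpq
  obtain ⟨e⟩ : Nonempty ((Σ n : ℕ, Fin (n + 1)) ≃ ℕ) := by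
    have : Infinite (Σ n : ℕ, Fin (n + 1)) :=
      Infinite.of_injective (fun n => ⟨n, 0⟩) fun a b h => (Sigma.mk.inj h).1
    obtain ⟨d⟩ := nonempty_denumerable (Σ n : ℕ, Fin (n + 1))
    exact ⟨Denumerable.eqv _⟩
  let D : SumOps 𝕜 p q →L[𝕜] (Ell 𝕜 p →L[𝕜] Ell 𝕜 q) := LinearMap.mkContinuous
    { toFun := blockDiagonal e hp hq hpq
      map_add' := fun S T => by
        ext x t
        simp only [blockDiagonal_apply', add_apply, lp.coeFn_add, Pi.add_apply, PiLp.add_apply]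
      map_smul' := fun c T => by
        ext x t
        simp only [blockDiagonal_apply', smul_apply, lp.coeFn_smul, Pi.smul_apply,
          PiLp.smul_apply, RingHom.id_apply] } 1
    fun T => by
      rw [one_mul]
      exact norm_blockDiagonal_le e hp hq hpq T
  let s : (Ell 𝕜 p →L[𝕜] Ell 𝕜 q) →L[𝕜] SumOps 𝕜 p q := lpInftyMk
    (fun n => (ContinuousLinearMap.compL 𝕜 (EllFin 𝕜 p (n + 1)) (Ell 𝕜 q)
        (EllFin 𝕜 q (n + 1)) (Ell.blockRestrict 𝕜 e q hq n)) ∘L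
      ((ContinuousLinearMap.compL 𝕜 (EllFin 𝕜 p (n + 1)) (Ell 𝕜 p) (Ell 𝕜 q)).flip
        (Ell.blockEmbed 𝕜 e p hp n))) 1 fun n T => by
        rw [one_mul]
        refine ContinuousLinearMap.opNorm_le_bound _ (norm_nonneg _) fun x => ?_
        change ‖Ell.blockRestrict 𝕜 e q hq n (T (Ell.blockEmbed 𝕜 e p hp n x))‖ ≤ _
        exact (Ell.norm_blockRestrict_apply_le e hq n _).trans ((T.le_opNorm _).trans
          (mul_le_mul_of_nonneg_left (Ell.norm_blockEmbed_apply_le e hp n x) (norm_nonneg _)))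
  refine ⟨D, s, fun T => ?_⟩
  ext n x j
  change blockDiagonal e hp hq hpq T (Ell.blockEmbed 𝕜 e p hp n x) (e ⟨n, j⟩) = _
  rw [blockDiagonal_apply, Ell.blockRestrict_blockEmbed]

end Blocks

end Coordinates

/-! ### Limits along ultrafilters -/

section Ultralimits

/-- The limit of a bounded family along an ultrafilter (in a proper space; a junk value for
unbounded families). -/
noncomputable def ulim {ι E : Type*} [NormedAddCommGroup E] (U : Ultrafilter ι) (f : ι → E) : E :=
  limUnder (U : Filter ι) f

theorem tendsto_ulim {ι E : Type*} [NormedAddCommGroup E] [ProperSpace E] {U : Ultrafilter ι}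
    {f : ι → E} {C : ℝ} (hf : ∀ᶠ i in (U : Filter ι), ‖f i‖ ≤ C) :
    Tendsto f U (𝓝 (ulim U f)) := by
  have h := (isCompact_closedBall (0 : E) C).ultrafilter_le_nhds (U.map f) (by
    rw [le_principal_iff]
    refine Ultrafilter.mem_map.2 ?_
    filter_upwards [hf] with i hi
    simpa using hi)
  obtain ⟨x, -, hx⟩ := h
  exact tendsto_nhds_limUnder ⟨x, hx⟩

theorem ulim_eq_of_tendsto {ι E : Type*} [NormedAddCommGroup E] {U : Ultrafilter ι}
    {f : ι → E} {x : E} (h : Tendsto f U (𝓝 x)) : ulim U f = x := h.limUnder_eq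

/-- Every bounded family indexed by `ι` converges weakly along the ultrafilter `U`. -/
def HasWeakLimits (𝕜 : Type*) [RCLike 𝕜] {ι : Type*} (U : Ultrafilter ι) (Y : Type*)
    [NormedAddCommGroup Y] [NormedSpace 𝕜 Y] : Prop :=
  ∀ (y : ι → Y) (M : ℝ), (∀ i, ‖y i‖ ≤ M) →
    ∃ z, ∀ f : Y →L[𝕜] 𝕜, Tendsto (fun i => f (y i)) U (𝓝 (f z))

variable {𝕜 : Type*} [RCLike 𝕜] {ι : Type*} {U : Ultrafilter ι} {Y : Type*}
  [NormedAddCommGroup Y] [NormedSpace 𝕜 Y]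

theorem eq_of_weak_tendsto {y : ι → Y} {z z' : Y}
    (h : ∀ f : Y →L[𝕜] 𝕜, Tendsto (fun i => f (y i)) U (𝓝 (f z)))
    (h' : ∀ f : Y →L[𝕜] 𝕜, Tendsto (fun i => f (y i)) U (𝓝 (f z'))) : z = z' :=
  (SeparatingDual.eq_iff_forall_dual_eq (R := 𝕜)).2 fun f => tendsto_nhds_unique (h f) (h' f)

theorem norm_le_of_weak_tendsto {y : ι → Y} {z : Y} {M : ℝ} (hM : ∀ᶠ i in (U : Filter ι), ‖y i‖ ≤ M)
    (h : ∀ f : Y →L[𝕜] 𝕜, Tendsto (fun i => f (y i)) U (𝓝 (f z))) : ‖z‖ ≤ M := by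
  obtain ⟨f, hf, hfz⟩ := exists_dual_vector'' 𝕜 z
  have h1 := (h f).norm
  rw [hfz] at h1
  simp only [RCLike.norm_ofReal, abs_norm] at h1
  refine le_of_tendsto h1 ?_
  filter_upwards [hM] with i hi
  exact (f.le_of_opNorm_le hf _).trans (by simpa using hi)

/-- A uniformly bounded family of operators has a limit in the weak operator topology. -/
theorem HasWeakLimits.exists_clm (hY : HasWeakLimits 𝕜 U Y) {A : Type*} [NormedAddCommGroup A]
    [NormedSpace 𝕜 A] (S : ι → A →L[𝕜] Y) {M : ℝ} (hM0 : 0 ≤ M) (hM : ∀ i, ‖S i‖ ≤ M) :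
    ∃ T : A →L[𝕜] Y, ‖T‖ ≤ M ∧
      ∀ x, ∀ f : Y →L[𝕜] 𝕜, Tendsto (fun i => f (S i x)) U (𝓝 (f (T x))) := by
  have hb : ∀ x i, ‖S i x‖ ≤ M * ‖x‖ := fun x i => (S i).le_of_opNorm_le (hM i) x
  choose T hT using fun x => hY (fun i => S i x) (M * ‖x‖) (hb x)
  refine ⟨LinearMap.mkContinuous
    { toFun := T
      map_add' := fun x y => eq_of_weak_tendsto (hT (x + y)) fun f => ?_
      map_smul' := fun c x => eq_of_weak_tendsto (hT (c • x)) fun f => ?_ } M fun x =>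
        norm_le_of_weak_tendsto (Eventually.of_forall (hb x)) (hT x),
    LinearMap.mkContinuous_norm_le _ hM0 _, fun x f => hT x f⟩
  · simpa using (hT x f).add (hT y f)
  · simpa using (hT x f).const_smul c

end Ultralimits

/-! ### Uniform convexity and weak compactness -/

section Convexity

variable {𝕜 : Type*} [RCLike 𝕜]

theorem norm_half_add_rpow_lt {q : ℝ} (hq : 1 < q) {a b : 𝕜} (hab : a ≠ b) :
    ‖(1 / 2 : 𝕜) * (a + b)‖ ^ q < (‖a‖ ^ q + ‖b‖ ^ q) / 2 := by
  have hn : ‖(1 / 2 : 𝕜) * (a + b)‖ = ‖a + b‖ / 2 := by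
    rw [norm_mul]; simp; ring
  rw [hn]
  have hsc := (strictConvexOn_rpow hq)
  have hadd := norm_add_le a b
  have hq0 : 0 < q := by linarith
  by_cases h : ‖a‖ = ‖b‖
  · have hlt : ‖a + b‖ / 2 < ‖a‖ := by
      have hpar := parallelogram_law_with_norm 𝕜 a b
      have hpos : 0 < ‖a - b‖ := norm_pos_iff.2 (sub_ne_zero.2 hab)
      rw [← h] at hpar
      by_contra hcon
      push Not at hcon
      nlinarith [norm_nonneg a, norm_nonneg (a + b)]
    have := Real.rpow_lt_rpow (by positivity) hlt hq0
    rw [← h]; linarith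
  · have h2 := hsc.2 (Set.mem_Ici.2 (norm_nonneg a)) (Set.mem_Ici.2 (norm_nonneg b)) h
      (show (0 : ℝ) < 1 / 2 by norm_num) (show (0 : ℝ) < 1 / 2 by norm_num) (by norm_num)
    simp only [smul_eq_mul] at h2
    have h3 : (‖a + b‖ / 2) ^ q ≤ (1 / 2 * ‖a‖ + 1 / 2 * ‖b‖) ^ q :=
      Real.rpow_le_rpow (by positivity) (by linarith) hq0.le
    linarith

variable (𝕜) in
/-- Uniform convexity of `t ↦ ‖t‖ ^ q` on the scalar field, in a homogeneous form that can be summed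
over coordinates. It follows from strict convexity by compactness. -/
theorem exists_norm_sub_rpow_le {q : ℝ} (hq : 1 < q) {ε : ℝ} (hε : 0 < ε) :
    ∃ c : ℝ, 0 ≤ c ∧ ∀ a b : 𝕜, ‖a - b‖ ^ q ≤ ε * (‖a‖ ^ q + ‖b‖ ^ q) +
      c * ((‖a‖ ^ q + ‖b‖ ^ q) / 2 - ‖(1 / 2 : 𝕜) * (a + b)‖ ^ q) := by
  have hq0 : 0 < q := by linarith
  have hcr : Continuous fun t : ℝ => t ^ q := Real.continuous_rpow_const hq0.le
  have hgap : ∀ a b : 𝕜, 0 ≤ (‖a‖ ^ q + ‖b‖ ^ q) / 2 - ‖(1 / 2 : 𝕜) * (a + b)‖ ^ q := by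
    intro a b
    by_cases hab : a = b
    · subst hab
      have : (1 / 2 : 𝕜) * (a + a) = a := by ring
      rw [this]; linarith
    · linarith [norm_half_add_rpow_lt hq hab]
  -- the normalized pairs that are far apart
  let K : Set (𝕜 × 𝕜) := {x | ‖x.1‖ ^ q + ‖x.2‖ ^ q = 1 ∧ ε ≤ ‖x.1 - x.2‖ ^ q}
  have hK : IsCompact K := by
    have hKc : IsClosed K := by
      have h1 : Continuous fun x : 𝕜 × 𝕜 => ‖x.1‖ ^ q + ‖x.2‖ ^ q :=
        (hcr.comp continuous_fst.norm).add (hcr.comp continuous_snd.norm)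
      have h2 : Continuous fun x : 𝕜 × 𝕜 => ‖x.1 - x.2‖ ^ q :=
        hcr.comp (continuous_fst.sub continuous_snd).norm
      exact (isClosed_eq h1 continuous_const).inter (isClosed_le continuous_const h2)
    refine (isCompact_closedBall (0 : 𝕜 × 𝕜) 1).of_isClosed_subset hKc ?_
    rintro ⟨a, b⟩ ⟨h1, -⟩
    have ha : 0 ≤ ‖a‖ ^ q := by positivity
    have hb : 0 ≤ ‖b‖ ^ q := by positivity
    simp only at h1
    rw [mem_closedBall_zero_iff, Prod.norm_def, max_le_iff]
    constructor
    · exact (Real.rpow_le_rpow_iff (norm_nonneg a) zero_le_one hq0).1 (by rw [Real.one_rpow]; linarith)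
    · exact (Real.rpow_le_rpow_iff (norm_nonneg b) zero_le_one hq0).1 (by rw [Real.one_rpow]; linarith)
  have hfc : Continuous fun x : 𝕜 × 𝕜 =>
      (‖x.1‖ ^ q + ‖x.2‖ ^ q) / 2 - ‖(1 / 2 : 𝕜) * (x.1 + x.2)‖ ^ q :=
    (((hcr.comp continuous_fst.norm).add (hcr.comp continuous_snd.norm)).div_const 2).sub
      (hcr.comp (continuous_const.mul (continuous_fst.add continuous_snd)).norm)
  obtain ⟨m, hm, hmK⟩ : ∃ m > 0, ∀ x ∈ K,
      m ≤ (‖x.1‖ ^ q + ‖x.2‖ ^ q) / 2 - ‖(1 / 2 : 𝕜) * (x.1 + x.2)‖ ^ q := by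
    rcases K.eq_empty_or_nonempty with hKe | hKne
    · exact ⟨1, one_pos, by simp [hKe]⟩
    · obtain ⟨x, hx, hmin⟩ := hK.exists_isMinOn hKne hfc.continuousOn
      refine ⟨_, ?_, fun y hy => hmin hy⟩
      have hne : x.1 ≠ x.2 := by
        intro h
        have := hx.2
        rw [h, sub_self, norm_zero, Real.zero_rpow hq0.ne'] at this
        linarith
      simpa using norm_half_add_rpow_lt hq hne
  refine ⟨2 ^ q / m, by positivity, fun a b => ?_⟩
  have hg := hgap a b
  by_cases hnear : ‖a - b‖ ^ q ≤ ε * (‖a‖ ^ q + ‖b‖ ^ q)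
  · have : 0 ≤ 2 ^ q / m * ((‖a‖ ^ q + ‖b‖ ^ q) / 2 - ‖(1 / 2 : 𝕜) * (a + b)‖ ^ q) := by
      positivity
    linarith
  push Not at hnear
  -- rescale to `K`
  set s : ℝ := ‖a‖ ^ q + ‖b‖ ^ q with hs
  have hs0 : 0 ≤ s := by positivity
  have hspos : 0 < s := by
    refine lt_of_le_of_ne hs0 fun h0 => ?_
    have ha : ‖a‖ ^ q = 0 := by
      have h1 : 0 ≤ ‖a‖ ^ q := by positivity
      have h2 : 0 ≤ ‖b‖ ^ q := by positivity
      linarith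
    have hb : ‖b‖ ^ q = 0 := by
      have h2 : 0 ≤ ‖b‖ ^ q := by positivity
      linarith
    rw [Real.rpow_eq_zero (norm_nonneg _) hq0.ne', norm_eq_zero] at ha hb
    rw [← h0, ha, hb] at hnear
    simp [hq0.ne'] at hnear
  let t : ℝ := s ^ (-1 / q)
  have ht : 0 < t := by positivity
  have htq : t ^ q = s⁻¹ := by
    rw [← Real.rpow_mul hs0]
    rw [div_mul_cancel₀ _ hq0.ne', Real.rpow_neg_one]
  have hsc : ∀ x : 𝕜, ‖(t : 𝕜) * x‖ ^ q = s⁻¹ * ‖x‖ ^ q := fun x => by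
    rw [norm_mul, RCLike.norm_ofReal, abs_of_pos ht, Real.mul_rpow ht.le (norm_nonneg _), htq]
  have hmem : ((t : 𝕜) * a, (t : 𝕜) * b) ∈ K := by
    refine ⟨?_, ?_⟩
    · simp only [hsc]
      rw [← mul_add, ← hs, inv_mul_cancel₀ hspos.ne']
    · simp only [← mul_sub, hsc]
      rw [inv_mul_eq_div, le_div_iff₀ hspos]
      exact hnear.le
  have h1 := hmK _ hmem
  have h2 : (1 / 2 : 𝕜) * ((t : 𝕜) * a + (t : 𝕜) * b) = (t : 𝕜) * ((1 / 2 : 𝕜) * (a + b)) := by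
    ring
  simp only [h2, hsc] at h1
  have h3 : m * s ≤ s / 2 - ‖(1 / 2 : 𝕜) * (a + b)‖ ^ q := by
    have h4 := mul_le_mul_of_nonneg_left h1 hs0
    have h5 : s * ((s⁻¹ * ‖a‖ ^ q + s⁻¹ * ‖b‖ ^ q) / 2 - s⁻¹ * ‖(1 / 2 : 𝕜) * (a + b)‖ ^ q)
        = s / 2 - ‖(1 / 2 : 𝕜) * (a + b)‖ ^ q := by
      rw [← mul_add, ← hs]; field_simp
    linarith
  have h6 : ‖a - b‖ ^ q ≤ 2 ^ q * s := by
    have h7 : ‖a - b‖ ≤ 2 * max ‖a‖ ‖b‖ := by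
      linarith [norm_sub_le a b, le_max_left ‖a‖ ‖b‖, le_max_right ‖a‖ ‖b‖]
    refine (Real.rpow_le_rpow (norm_nonneg _) h7 hq0.le).trans ?_
    rw [Real.mul_rpow (by norm_num) (by positivity)]
    refine mul_le_mul_of_nonneg_left ?_ (by positivity)
    have h1 : 0 ≤ ‖a‖ ^ q := by positivity
    have h2 : 0 ≤ ‖b‖ ^ q := by positivity
    rcases max_cases ‖a‖ ‖b‖ with h | h <;> rw [h.1] <;> linarith
  have h8 : 2 ^ q * s ≤ 2 ^ q / m * (s / 2 - ‖(1 / 2 : 𝕜) * (a + b)‖ ^ q) := by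
    rw [div_mul_eq_mul_div, le_div_iff₀ hm]
    have := mul_le_mul_of_nonneg_left h3 (show (0 : ℝ) ≤ 2 ^ q by positivity)
    linarith
  have h9 : 0 ≤ ε * s := by positivity
  linarith

/-- The function `Φ` is uniformly convex, in a form satisfied by the `q`-th power of the norm of
`ℓ_q^n`, with constants independent of `n`, for `1 < q`. It passes to pointwise limits of `Φ`. -/
def IsUniformlyConvexGauge (𝕜 : Type*) [RCLike 𝕜] {Y : Type*} [NormedAddCommGroup Y]
    [NormedSpace 𝕜 Y] (Φ : Y → ℝ) : Prop :=
  ∀ ε > 0, ∃ c : ℝ, 0 ≤ c ∧ ∀ x y, Φ (x - y) ≤ ε * (Φ x + Φ y) +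
    c * ((Φ x + Φ y) / 2 - Φ ((1 / 2 : 𝕜) • (x + y)))

theorem EllFin.isUniformlyConvexGauge_aux {p : ℝ≥0∞} [Fact (1 ≤ p)] (hp : p ≠ ∞)
    {ε c : ℝ} (h : ∀ a b : 𝕜, ‖a - b‖ ^ p.toReal ≤ ε * (‖a‖ ^ p.toReal + ‖b‖ ^ p.toReal) +
      c * ((‖a‖ ^ p.toReal + ‖b‖ ^ p.toReal) / 2 - ‖(1 / 2 : 𝕜) * (a + b)‖ ^ p.toReal)) {n : ℕ}
    (x y : EllFin 𝕜 p n) : ‖x - y‖ ^ p.toReal ≤ ε * (‖x‖ ^ p.toReal + ‖y‖ ^ p.toReal) +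
      c * ((‖x‖ ^ p.toReal + ‖y‖ ^ p.toReal) / 2 - ‖(1 / 2 : 𝕜) • (x + y)‖ ^ p.toReal) := by
  simp only [EllFin.norm_rpow hp]
  rw [← Finset.sum_add_distrib, Finset.mul_sum, Finset.sum_div, ← Finset.sum_sub_distrib,
    Finset.mul_sum, ← Finset.sum_add_distrib]
  exact Finset.sum_le_sum fun j _ => h (x j) (y j)

/-- A uniformly convex space has weak limits of bounded families. The near-minimizers of `Φ` in the
weakly closed convex sets spanned by tails of the family form a Cauchy filter, whose limit lies in
all of these sets. -/
theorem IsUniformlyConvexGauge.hasWeakLimits {Y : Type*} [NormedAddCommGroup Y] [NormedSpace 𝕜 Y]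
    [CompleteSpace Y] {Φ : Y → ℝ} (hΦ : IsUniformlyConvexGauge 𝕜 Φ) {q a b : ℝ} (hq : 0 < q)
    (ha : 0 < a) (hlow : ∀ y, a * ‖y‖ ^ q ≤ Φ y) (hup : ∀ y, Φ y ≤ b * ‖y‖ ^ q)
    {ι : Type*} (U : Ultrafilter ι) : HasWeakLimits 𝕜 U Y := by
  intro y M hM
  have hΦ0 : ∀ z, 0 ≤ Φ z := fun z => le_trans (by positivity) (hlow z)
  -- `C A` is the intersection of the weakly closed slabs that contain all `y i` with `i ∈ A`
  let C : Set ι → Set Y := fun A => {z | ∀ (f : Y →L[𝕜] 𝕜) (c : 𝕜) (ρ : ℝ),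
    (∀ i ∈ A, ‖f (y i) - c‖ ≤ ρ) → ‖f z - c‖ ≤ ρ}
  have hCy : ∀ A, ∀ i ∈ A, y i ∈ C A := fun A i hi f c ρ h => h i hi
  have hCne : ∀ A ∈ U, ∃ i, y i ∈ C A := fun A hA => by
    obtain ⟨i, hi⟩ := U.nonempty_of_mem hA
    exact ⟨i, hCy A i hi⟩
  have hCanti : ∀ {A B : Set ι}, A ⊆ B → C A ⊆ C B := fun hAB z hz f c ρ h =>
    hz f c ρ fun i hi => h i (hAB hi)
  have hCmid : ∀ A, ∀ z ∈ C A, ∀ z' ∈ C A, (1 / 2 : 𝕜) • (z + z') ∈ C A := by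
    intro A z hz z' hz' f c ρ h
    have h1 : f ((1 / 2 : 𝕜) • (z + z')) - c = (1 / 2 : 𝕜) * ((f z - c) + (f z' - c)) := by
      simp only [map_smul, map_add, smul_eq_mul]; ring
    have h2 := norm_add_le (f z - c) (f z' - c)
    have h3 := hz f c ρ h
    have h4 := hz' f c ρ h
    rw [h1, norm_mul]
    simp
    linarith
  have hCclosed : ∀ A, IsClosed (C A) := by
    intro A
    simp only [C, Set.ofPred_forall]
    refine isClosed_iInter fun f => isClosed_iInter fun c => isClosed_iInter fun ρ =>
      isClosed_iInter fun _ => ?_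
    exact isClosed_le (f.continuous.sub continuous_const).norm continuous_const
  have hΦy : ∀ i, Φ (y i) ≤ |b| * M ^ q := fun i => (hup _).trans <|
    (mul_le_mul_of_nonneg_right (le_abs_self b) (by positivity)).trans <|
      mul_le_mul_of_nonneg_left (Real.rpow_le_rpow (norm_nonneg _) (hM i) hq.le) (abs_nonneg b)
  -- `m` is the limit of the infima of `Φ` over the sets `C A`
  let L : Set ℝ := {t | ∃ A ∈ U, ∀ z ∈ C A, t ≤ Φ z}
  have hLne : L.Nonempty := ⟨0, Set.univ, univ_mem, fun z _ => hΦ0 z⟩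
  have hLbdd : BddAbove L := ⟨|b| * M ^ q, by
    rintro t ⟨A, hA, ht⟩
    obtain ⟨i, hi⟩ := hCne A hA
    exact (ht _ hi).trans (hΦy i)⟩
  let m := sSup L
  have hm0 : 0 ≤ m := le_csSup hLbdd ⟨Set.univ, univ_mem, fun z _ => hΦ0 z⟩
  have hm1 : ∀ δ > 0, ∃ A ∈ U, ∀ z ∈ C A, m - δ ≤ Φ z := by
    intro δ hδ
    obtain ⟨t, ⟨A, hA, ht⟩, hlt⟩ := exists_lt_of_lt_csSup hLne (show m - δ < m by linarith)
    exact ⟨A, hA, fun z hz => hlt.le.trans (ht z hz)⟩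
  have hm2 : ∀ B ∈ U, ∀ δ > 0, ∃ z ∈ C B, Φ z ≤ m + δ := by
    intro B hB δ hδ
    by_contra! hcon
    have : m + δ ≤ m := le_csSup hLbdd ⟨B, hB, fun z hz => (hcon z hz).le⟩
    linarith
  -- near-minimizers are close to each other, since their midpoint stays in `C A`
  let D : {A : Set ι // A ∈ U} × {δ : ℝ // 0 < δ} → Set Y := fun x =>
    {z | z ∈ C x.1.1 ∧ Φ z ≤ m + x.2.1}
  let F : Filter Y := ⨅ x, 𝓟 (D x)
  have hDmem : ∀ x, D x ∈ F := fun x => mem_iInf_of_mem x (mem_principal_self _)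
  have hF : F.NeBot := by
    have : Nonempty ({A : Set ι // A ∈ U} × {δ : ℝ // 0 < δ}) :=
      ⟨⟨Set.univ, univ_mem⟩, ⟨1, one_pos⟩⟩
    refine iInf_neBot_of_directed' ?_ fun x => ?_
    · intro x x'
      refine ⟨⟨⟨x.1.1 ∩ x'.1.1, inter_mem x.1.2 x'.1.2⟩, ⟨min x.2.1 x'.2.1,
        lt_min x.2.2 x'.2.2⟩⟩, ?_, ?_⟩
      · refine principal_mono.2 fun z hz => ⟨hCanti Set.inter_subset_left hz.1, hz.2.trans ?_⟩
        simp
      · refine principal_mono.2 fun z hz => ⟨hCanti Set.inter_subset_right hz.1, hz.2.trans ?_⟩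
        simp
    · obtain ⟨z, hz⟩ := hm2 x.1.1 x.1.2 x.2.1 x.2.2
      exact principal_neBot_iff.2 ⟨z, hz⟩
  have hFc : Cauchy F := by
    rw [Metric.cauchy_iff]
    refine ⟨hF, fun ε hε => ?_⟩
    -- the target is `Φ (z - z') < a * ε ^ q`
    have hη : 0 < a * ε ^ q := by positivity
    obtain ⟨c, hc0, hc⟩ := hΦ (a * ε ^ q / (8 * (m + 1))) (by positivity)
    let δ : ℝ := min 1 (a * ε ^ q / (8 * (c + 1)))
    have hδ : 0 < δ := lt_min one_pos (by positivity)
    obtain ⟨A, hA, hAm⟩ := hm1 δ hδ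
    refine ⟨D ⟨⟨A, hA⟩, ⟨δ, hδ⟩⟩, hDmem _, fun z hz z' hz' => ?_⟩
    have h1 := hc z z'
    have h2 := hAm _ (hCmid A z hz.1 z' hz'.1)
    have h3 : Φ z ≤ m + δ := hz.2
    have h4 : Φ z' ≤ m + δ := hz'.2
    have h5 : δ ≤ 1 := min_le_left _ _
    have h6 : (c + 1) * δ ≤ a * ε ^ q / 8 := by
      have : δ ≤ a * ε ^ q / (8 * (c + 1)) := min_le_right _ _
      rw [le_div_iff₀ (by positivity)] at this
      linarith
    have h7 : a * ε ^ q / (8 * (m + 1)) * (Φ z + Φ z') ≤ a * ε ^ q / 4 := by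
      have : Φ z + Φ z' ≤ 2 * (m + 1) := by linarith
      refine (mul_le_mul_of_nonneg_left this (by positivity)).trans (le_of_eq ?_)
      field_simp
      norm_num
    have h8 : c * ((Φ z + Φ z') / 2 - Φ ((1 / 2 : 𝕜) • (z + z'))) ≤ c * (2 * δ) :=
      mul_le_mul_of_nonneg_left (by linarith) hc0
    have h9 : a * ‖z - z'‖ ^ q < a * ε ^ q := by
      have := hlow (z - z')
      nlinarith
    rw [dist_eq_norm]
    exact (Real.rpow_lt_rpow_iff (norm_nonneg _) hε.le hq).1 (lt_of_mul_lt_mul_left h9 ha.le)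
  obtain ⟨z, hz⟩ := CompleteSpace.complete hFc
  have hzC : ∀ A ∈ U, z ∈ C A := fun A hA => (hCclosed A).mem_of_tendsto (f := id) (b := F) hz (by
    filter_upwards [hDmem ⟨⟨A, hA⟩, ⟨1, one_pos⟩⟩] with w hw using hw.1)
  refine ⟨z, fun f => ?_⟩
  have hbd : ∀ᶠ i in (U : Filter ι), ‖f (y i)‖ ≤ ‖f‖ * M := Eventually.of_forall fun i =>
    (f.le_opNorm _).trans (mul_le_mul_of_nonneg_left (hM i) (norm_nonneg _))
  have hlim := tendsto_ulim hbd
  have heq : f z = ulim U (fun i => f (y i)) := by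
    refine eq_of_forall_dist_le fun ρ hρ => ?_
    rw [dist_eq_norm]
    -- membership in the slab around the limit of `f (y i)` identifies `f z`
    refine hzC {i | ‖f (y i) - ulim U (fun i => f (y i))‖ ≤ ρ} ?_ f _ ρ fun i hi => hi
    have := Metric.tendsto_nhds.1 hlim ρ hρ
    filter_upwards [this] with i hi
    rw [dist_eq_norm] at hi
    exact hi.le
  rw [heq]
  exact hlim

end Convexity

/-! ### Approximation of the identity through `ℓ_p^n` -/

/-- The identity of `X` is the strong limit of operators that factor through `ℓ_p^{n+1}` with
uniform bounds: `Q n ∘ J n → id`. -/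
structure LpApprox (𝕜 : Type*) [RCLike 𝕜] (p : ℝ≥0∞) [Fact (1 ≤ p)] (X : Type*)
    [NormedAddCommGroup X] [NormedSpace 𝕜 X] where
  /-- a common bound for the norms of the operators -/
  K : ℝ
  /-- the operators into `ℓ_p^{n+1}` -/
  J : ∀ n : ℕ, X →L[𝕜] EllFin 𝕜 p (n + 1)
  /-- the operators back into `X` -/
  Q : ∀ n : ℕ, EllFin 𝕜 p (n + 1) →L[𝕜] X
  one_le_K : 1 ≤ K
  norm_J_le : ∀ n, ‖J n‖ ≤ K
  norm_Q_le : ∀ n, ‖Q n‖ ≤ K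
  tendsto_Q_J : ∀ x, Tendsto (fun n => Q n (J n x)) atTop (𝓝 x)

namespace LpApprox

variable {𝕜 : Type*} [RCLike 𝕜] {p : ℝ≥0∞} [Fact (1 ≤ p)] {X : Type*}
  [NormedAddCommGroup X] [NormedSpace 𝕜 X] (S : LpApprox 𝕜 p X)

theorem K_pos : 0 < S.K := zero_lt_one.trans_le S.one_le_K

theorem norm_J_apply_le (n : ℕ) (x : X) : ‖S.J n x‖ ≤ S.K * ‖x‖ :=
  (S.J n).le_of_opNorm_le (S.norm_J_le n) x

theorem norm_Q_apply_le (n : ℕ) (x : EllFin 𝕜 p (n + 1)) : ‖S.Q n x‖ ≤ S.K * ‖x‖ :=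
  (S.Q n).le_of_opNorm_le (S.norm_Q_le n) x

theorem tendsto_hyperfilter (x : X) :
    Tendsto (fun n => S.Q n (S.J n x)) (hyperfilter ℕ : Filter ℕ) (𝓝 x) :=
  (S.tendsto_Q_J x).mono_left Nat.hyperfilter_le_atTop

/-- The limit of `‖J n x‖ ^ p`; its `p`-th root is an equivalent norm that inherits the convexity
of the norms of `ℓ_p^n`. -/
noncomputable def gauge (x : X) : ℝ :=
  ulim (hyperfilter ℕ) fun n => ‖S.J n x‖ ^ p.toReal

theorem tendsto_gauge (x : X) :
    Tendsto (fun n => ‖S.J n x‖ ^ p.toReal) (hyperfilter ℕ : Filter ℕ) (𝓝 (S.gauge x)) := by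
  refine tendsto_ulim (C := (S.K * ‖x‖) ^ p.toReal) (Eventually.of_forall fun n => ?_)
  rw [Real.norm_of_nonneg (by positivity)]
  exact Real.rpow_le_rpow (norm_nonneg _) (S.norm_J_apply_le n x) ENNReal.toReal_nonneg

theorem gauge_le (x : X) : S.gauge x ≤ S.K ^ p.toReal * ‖x‖ ^ p.toReal := by
  refine le_of_tendsto (S.tendsto_gauge x) (Eventually.of_forall fun n => ?_)
  rw [← Real.mul_rpow S.K_pos.le (norm_nonneg _)]
  exact Real.rpow_le_rpow (norm_nonneg _) (S.norm_J_apply_le n x) ENNReal.toReal_nonneg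

theorem norm_rpow_le_gauge (x : X) : ‖x‖ ^ p.toReal ≤ S.K ^ p.toReal * S.gauge x := by
  have hc : Continuous fun t : ℝ => t ^ p.toReal := Real.continuous_rpow_const ENNReal.toReal_nonneg
  have h1 := (hc.tendsto _).comp (S.tendsto_hyperfilter x).norm
  refine le_of_tendsto_of_tendsto' h1 ((S.tendsto_gauge x).const_mul (S.K ^ p.toReal)) fun n => ?_
  rw [← Real.mul_rpow S.K_pos.le (norm_nonneg _)]
  exact Real.rpow_le_rpow (norm_nonneg _) (S.norm_Q_apply_le n _) ENNReal.toReal_nonneg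

theorem isUniformlyConvexGauge (hp : 1 < p) (hp' : p ≠ ∞) :
    IsUniformlyConvexGauge 𝕜 S.gauge := by
  intro ε hε
  have hP : 1 < p.toReal := by
    have := (ENNReal.toReal_lt_toReal (by simp) hp').2 hp
    simpa using this
  obtain ⟨c, hc, h⟩ := exists_norm_sub_rpow_le 𝕜 hP hε
  refine ⟨c, hc, fun x y => ?_⟩
  refine le_of_tendsto_of_tendsto' (S.tendsto_gauge (x - y))
    ((((S.tendsto_gauge x).add (S.tendsto_gauge y)).const_mul ε).add
      (((((S.tendsto_gauge x).add (S.tendsto_gauge y)).div_const 2).sub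
        (S.tendsto_gauge ((1 / 2 : 𝕜) • (x + y)))).const_mul c)) fun n => ?_
  rw [map_sub, map_smul, map_add]
  exact EllFin.isUniformlyConvexGauge_aux hp' h _ _

theorem hasWeakLimits [CompleteSpace X] (S : LpApprox 𝕜 p X) (hp : 1 < p) (hp' : p ≠ ∞) {ι : Type*}
    (U : Ultrafilter ι) : HasWeakLimits 𝕜 U X := by
  have hK : 0 < S.K ^ p.toReal := Real.rpow_pos_of_pos S.K_pos _
  refine (S.isUniformlyConvexGauge hp hp').hasWeakLimits (toReal_pos_of_fact p hp')
    (a := (S.K ^ p.toReal)⁻¹) (by positivity) (fun y => ?_) S.gauge_le U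
  rw [inv_mul_le_iff₀ hK]
  exact S.norm_rpow_le_gauge y

end LpApprox

section Operators

variable {𝕜 : Type*} [RCLike 𝕜] {p q : ℝ≥0∞} [Fact (1 ≤ p)] [Fact (1 ≤ q)]
  {X Y : Type*} [NormedAddCommGroup X] [NormedSpace 𝕜 X]
  [NormedAddCommGroup Y] [NormedSpace 𝕜 Y]

/-- `B(X, Y)` is complemented in the space of bounded sequences of operators `ℓ_p^n → ℓ_q^n`: an
operator is recovered from its compressions as a limit in the weak operator topology. -/
theorem LpApprox.factors_operators_sumOps [CompleteSpace Y] (S : LpApprox 𝕜 p X)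
    (R : LpApprox 𝕜 q Y) (hq : 1 < q) (hq' : q ≠ ∞) : Factors 𝕜 (X →L[𝕜] Y) (SumOps 𝕜 p q) := by
  let i : (X →L[𝕜] Y) →L[𝕜] SumOps 𝕜 p q := lpInftyMk
    (fun n => (ContinuousLinearMap.compL 𝕜 (EllFin 𝕜 p (n + 1)) Y (EllFin 𝕜 q (n + 1)) (R.J n)) ∘L
      ((ContinuousLinearMap.compL 𝕜 (EllFin 𝕜 p (n + 1)) X Y).flip (S.Q n))) (R.K * S.K)
    fun n T => by
      have h0 : 0 ≤ R.K * S.K := mul_nonneg R.K_pos.le S.K_pos.le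
      refine ContinuousLinearMap.opNorm_le_bound _ (by positivity) fun x => ?_
      change ‖R.J n (T (S.Q n x))‖ ≤ _
      refine (R.norm_J_apply_le n _).trans ?_
      have h1 := (T.le_opNorm (S.Q n x)).trans
        (mul_le_mul_of_nonneg_left (S.norm_Q_apply_le n x) (norm_nonneg T))
      refine (mul_le_mul_of_nonneg_left h1 R.K_pos.le).trans (le_of_eq (by ring))
  have hi : ∀ T n x, i T n x = R.J n (T (S.Q n x)) := fun T n x => rfl
  have hbound : ∀ (T : SumOps 𝕜 p q) (n : ℕ), ‖R.Q n ∘L T n ∘L S.J n‖ ≤ R.K * S.K * ‖T‖ := by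
    intro T n
    have h0 : 0 ≤ R.K * S.K := mul_nonneg R.K_pos.le S.K_pos.le
    refine ContinuousLinearMap.opNorm_le_bound _ (by positivity) fun x => ?_
    refine (R.norm_Q_apply_le n _).trans ?_
    have h1 : ‖T n (S.J n x)‖ ≤ ‖T‖ * (S.K * ‖x‖) :=
      ((T n).le_of_opNorm_le (norm_lp_infty_apply_le T n) _).trans
        (mul_le_mul_of_nonneg_left (S.norm_J_apply_le n x) (norm_nonneg T))
    refine (mul_le_mul_of_nonneg_left h1 R.K_pos.le).trans (le_of_eq (by ring))
  choose L hLn hL using fun T : SumOps 𝕜 p q =>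
    (R.hasWeakLimits hq hq' (hyperfilter ℕ)).exists_clm (fun n => R.Q n ∘L T n ∘L S.J n)
      (mul_nonneg (mul_nonneg R.K_pos.le S.K_pos.le) (norm_nonneg T)) (hbound T)
  let s : SumOps 𝕜 p q →L[𝕜] (X →L[𝕜] Y) := LinearMap.mkContinuous
    { toFun := L
      map_add' := fun T T' => by
        ext x
        refine eq_of_weak_tendsto (hL (T + T') x) fun f => ?_
        simpa using (hL T x f).add (hL T' x f)
      map_smul' := fun c T => by
        ext x
        refine eq_of_weak_tendsto (hL (c • T) x) fun f => ?_
        simpa using (hL T x f).const_smul c } (R.K * S.K) hLn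
  refine ⟨i, s, fun T => ?_⟩
  ext x
  refine eq_of_weak_tendsto (hL (i T) x) fun f => (f.continuous.tendsto _).comp ?_
  simp only [ContinuousLinearMap.comp_apply, hi]
  -- `Q (J (T u))` tends to `T x` in norm, as `u = Q (J x)` tends to `x`
  have h1 : Tendsto (fun n => T (S.Q n (S.J n x))) (hyperfilter ℕ : Filter ℕ) (𝓝 (T x)) :=
    (T.continuous.tendsto x).comp (S.tendsto_hyperfilter x)
  have h2 : Tendsto (fun n => R.Q n (R.J n (T (S.Q n (S.J n x)) - T x)))
      (hyperfilter ℕ : Filter ℕ) (𝓝 0) := by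
    have h3 : Tendsto (fun n => R.K * (R.K * ‖T (S.Q n (S.J n x)) - T x‖))
        (hyperfilter ℕ : Filter ℕ) (𝓝 0) := by
      have := ((tendsto_iff_norm_sub_tendsto_zero.1 h1).const_mul R.K).const_mul R.K
      simpa using this
    refine squeeze_zero_norm (fun n => ?_) h3
    exact (R.norm_Q_apply_le n _).trans
      (mul_le_mul_of_nonneg_left (R.norm_J_apply_le n _) R.K_pos.le)
  have h4 := h2.add (R.tendsto_hyperfilter (T x))
  simpa [← map_add] using h4

/-- If `X` and `Y` have approximations of the identity through `ℓ_p^n` and `ℓ_q^n`, and contain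
complemented copies of `ℓ_p` and `ℓ_q`, then `B(X, Y)` is isomorphic to the space of bounded
sequences of operators `ℓ_p^n → ℓ_q^n`. -/
theorem LpApprox.nonempty_equiv_sumOps [CompleteSpace Y] (S : LpApprox 𝕜 p X)
    (R : LpApprox 𝕜 q Y) (hpq : p ≤ q) (hq : 1 < q) (hq' : q ≠ ∞)
    (hX : Factors 𝕜 (Ell 𝕜 p) X) (hY : Factors 𝕜 (Ell 𝕜 q) Y) :
    Nonempty ((X →L[𝕜] Y) ≃L[𝕜] SumOps 𝕜 p q) :=
  (S.factors_operators_sumOps R hq hq').nonempty_equiv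
    ((factors_sumOps_operators hpq hq').trans (hX.operators hY))
    (factors_lInfty_sumOps (ne_top_of_le_ne_top hq' hpq) hq')

variable (𝕜) in
/-- Truncation to the first coordinates in `ℓ_p`. -/
noncomputable def Ell.lpApprox (p : ℝ≥0∞) [Fact (1 ≤ p)] (hp : p ≠ ∞) :
    LpApprox 𝕜 p (Ell 𝕜 p) where
  K := 1
  J n := EllFin.mkCLM hp
    { toFun := fun x j => x j.1
      map_add' := fun x y => by ext j; simp
      map_smul' := fun c x => by ext j; simp } 1 zero_le_one fun x => by
      rw [one_mul]
      refine le_trans (le_of_eq ?_) (lp.sum_rpow_le_norm_rpow (toReal_pos_of_fact p hp) x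
        (Finset.range (n + 1)))
      exact Fin.sum_univ_eq_sum_range (fun j => ‖x j‖ ^ p.toReal) (n + 1)
  Q n := Ell.mkCLM hp
    { toFun := fun y j => if h : j < n + 1 then y ⟨j, h⟩ else 0
      map_add' := fun x y => by
        ext t
        by_cases ht : t < n + 1
        · simp only [dif_pos ht, Pi.add_apply, PiLp.add_apply]
        · simp only [dif_neg ht, Pi.add_apply, add_zero]
      map_smul' := fun c x => by
        ext t
        by_cases ht : t < n + 1
        · simp only [dif_pos ht, Pi.smul_apply, PiLp.smul_apply, RingHom.id_apply]
        · simp only [dif_neg ht, Pi.smul_apply, smul_zero] } 1 zero_le_one fun y s => by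
      have hP := toReal_pos_of_fact p hp
      rw [one_mul, EllFin.norm_rpow hp]
      refine le_trans (Finset.sum_le_sum fun t _ => le_of_eq ?_)
        (sum_norm_extend_le hP (Fin.val : Fin (n + 1) → ℕ) Fin.val_injective (fun j => y j) s)
      by_cases ht : t < n + 1
      · have := Fin.val_injective.extend_apply (fun j => y j) (0 : ℕ → 𝕜) (⟨t, ht⟩ : Fin (n + 1))
        simp only [LinearMap.coe_mk, AddHom.coe_mk, ht, dite_true]
        simp only at this
        rw [this]
      · rw [Function.extend_apply' _ _ _ (by rintro ⟨j, rfl⟩; exact ht j.2)]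
        simp only [LinearMap.coe_mk, AddHom.coe_mk, dif_neg ht, Pi.zero_apply]
  one_le_K := le_rfl
  norm_J_le n := EllFin.norm_mkCLM_le _ _ _ _ _
  norm_Q_le n := Ell.norm_mkCLM_le _ _ _ _ _
  tendsto_Q_J x := by
    have h := ((lp.hasSum_single hp x).tendsto_sum_nat).comp (tendsto_add_atTop_nat 1)
    refine h.congr fun n => ?_
    ext t
    simp only [Function.comp_apply, lp.coeFn_sum, Finset.sum_apply, lp.single_apply,
      Ell.mkCLM_apply, LinearMap.coe_mk, AddHom.coe_mk]
    by_cases ht : t < n + 1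
    · simp [ht, Pi.single_apply]
    · simp [ht, Pi.single_apply]

end Operators

/-! ### Uniform quantization in `ℓ_p^n` and local factorization of `ℒ_p`-spaces -/

section Quantization

theorem one_lt_toReal {p : ℝ≥0∞} (hp : 1 < p) (hp' : p ≠ ∞) : 1 < p.toReal := by
  have := (ENNReal.toReal_lt_toReal (by simp) hp').2 hp
  simpa using this

variable {𝕜 : Type*} [RCLike 𝕜] {p : ℝ≥0∞} [Fact (1 ≤ p)]

theorem EllFin.norm_mono (hp : p ≠ ∞) {n : ℕ} {x y : EllFin 𝕜 p n} (h : ∀ j, ‖x j‖ ≤ ‖y j‖) :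
    ‖x‖ ≤ ‖y‖ :=
  EllFin.norm_le_of_forall_le hp (norm_nonneg _) h (EllFin.norm_rpow hp y).ge

/-- Hölder's inequality for a weighted mean. -/
theorem weighted_mean_rpow_le {ι : Type*} (s : Finset ι) {P : ℝ} (hP : 1 < P) (w : ι → ℝ)
    (hw : ∀ j, 0 ≤ w j) (x : ι → 𝕜) :
    ‖(((∑ j ∈ s, w j ^ P) ^ (1 / P - 1) : ℝ) : 𝕜) * ∑ j ∈ s, ((w j ^ (P - 1) : ℝ) : 𝕜) * x j‖ ^ P ≤
      ∑ j ∈ s, ‖x j‖ ^ P := by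
  have hP0 : 0 < P := by linarith
  have hP1 : 0 < P - 1 := by linarith
  set W := ∑ j ∈ s, w j ^ P with hW
  have hW0 : 0 ≤ W := Finset.sum_nonneg fun j _ => Real.rpow_nonneg (hw j) _
  have hR0 : 0 ≤ ∑ j ∈ s, ‖x j‖ ^ P := Finset.sum_nonneg fun j _ => by positivity
  have h1 : ‖∑ j ∈ s, ((w j ^ (P - 1) : ℝ) : 𝕜) * x j‖ ≤
      W ^ (1 - 1 / P) * (∑ j ∈ s, ‖x j‖ ^ P) ^ (1 / P) := by
    refine (norm_sum_le _ _).trans ?_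
    have hc : (P / (P - 1)).HolderConjugate P := (Real.HolderConjugate.conjExponent hP).symm
    have := Real.inner_le_Lp_mul_Lq_of_nonneg s hc (f := fun j => w j ^ (P - 1))
      (g := fun j => ‖x j‖) (fun j _ => Real.rpow_nonneg (hw j) _) fun j _ => norm_nonneg _
    refine le_trans (le_of_eq (Finset.sum_congr rfl fun j _ => ?_)) (this.trans (le_of_eq ?_))
    · rw [norm_mul, RCLike.norm_ofReal, abs_of_nonneg (Real.rpow_nonneg (hw j) _)]
    · congr 1
      have h2 : ∀ j, (w j ^ (P - 1)) ^ (P / (P - 1)) = w j ^ P := fun j => by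
        rw [← Real.rpow_mul (hw j)]; congr 1; field_simp
      simp only [h2, ← hW]
      congr 1
      field_simp
  have h3 : W ^ (1 / P - 1) * W ^ (1 - 1 / P) ≤ 1 := by
    rcases hW0.eq_or_lt with h | h
    · rw [← h, Real.zero_rpow, zero_mul]
      · norm_num
      · have : 1 / P < 1 := by rw [div_lt_one hP0]; exact hP
        linarith
    · rw [← Real.rpow_add h]; simp
  have h4 : ‖((W ^ (1 / P - 1) : ℝ) : 𝕜) * ∑ j ∈ s, ((w j ^ (P - 1) : ℝ) : 𝕜) * x j‖ ≤
      (∑ j ∈ s, ‖x j‖ ^ P) ^ (1 / P) := by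
    rw [norm_mul, RCLike.norm_ofReal, abs_of_nonneg (Real.rpow_nonneg hW0 _)]
    calc W ^ (1 / P - 1) * ‖∑ j ∈ s, ((w j ^ (P - 1) : ℝ) : 𝕜) * x j‖
        ≤ W ^ (1 / P - 1) * (W ^ (1 - 1 / P) * (∑ j ∈ s, ‖x j‖ ^ P) ^ (1 / P)) :=
          mul_le_mul_of_nonneg_left h1 (Real.rpow_nonneg hW0 _)
      _ = (W ^ (1 / P - 1) * W ^ (1 - 1 / P)) * (∑ j ∈ s, ‖x j‖ ^ P) ^ (1 / P) := by ring
      _ ≤ 1 * (∑ j ∈ s, ‖x j‖ ^ P) ^ (1 / P) :=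
          mul_le_mul_of_nonneg_right h3 (Real.rpow_nonneg hR0 _)
      _ = _ := one_mul _
  refine (Real.rpow_le_rpow (norm_nonneg _) h4 hP0.le).trans (le_of_eq ?_)
  rw [← Real.rpow_mul hR0, one_div_mul_cancel hP0.ne', Real.rpow_one]

/-- Conditional expectation: if the coordinates are partitioned into `m` classes, then the vectors
that are multiples of the weight `w` on each class form a norm-one complemented copy of `ℓ_p^m`. -/
theorem EllFin.exists_averaging (hp : 1 < p) (hp' : p ≠ ∞) {k m : ℕ} (κ : Fin k → Fin m)
    (w : Fin k → ℝ) (hw : ∀ j, 0 ≤ w j) :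
    ∃ (A : EllFin 𝕜 p k →L[𝕜] EllFin 𝕜 p m) (B : EllFin 𝕜 p m →L[𝕜] EllFin 𝕜 p k),
      ‖A‖ ≤ 1 ∧ ‖B‖ ≤ 1 ∧ ∀ (α : Fin m → 𝕜) (x : EllFin 𝕜 p k),
        (∀ j, x j = α (κ j) * (w j : 𝕜)) → B (A x) = x := by
  have hP := one_lt_toReal hp hp'
  set P := p.toReal with hPdef
  have hP0 : 0 < P := by linarith
  let W : Fin m → ℝ := fun c => ∑ j with κ j = c, w j ^ P
  have hW0 : ∀ c, 0 ≤ W c := fun c => Finset.sum_nonneg fun j _ => Real.rpow_nonneg (hw j) _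
  have hwW : ∀ j, W (κ j) = 0 → w j = 0 := by
    intro j h
    have := (Finset.sum_eq_zero_iff_of_nonneg fun i _ => Real.rpow_nonneg (hw i) _).1 h j
      (by simp)
    exact (Real.rpow_eq_zero (hw j) hP0.ne').1 this
  let A : EllFin 𝕜 p k →L[𝕜] EllFin 𝕜 p m := EllFin.mkCLM hp'
    { toFun := fun x c => ((W c ^ (1 / P - 1) : ℝ) : 𝕜) *
        ∑ j with κ j = c, ((w j ^ (P - 1) : ℝ) : 𝕜) * x j
      map_add' := fun x y => by
        ext c
        simp only [PiLp.add_apply, Pi.add_apply, mul_add, Finset.sum_add_distrib]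
      map_smul' := fun a x => by
        ext c
        simp only [PiLp.smul_apply, Pi.smul_apply, smul_eq_mul, RingHom.id_apply]
        rw [mul_left_comm, Finset.mul_sum (a := a)]
        congr 1
        exact Finset.sum_congr rfl fun j _ => by ring } 1 zero_le_one fun x => by
      rw [one_mul, EllFin.norm_rpow hp',
        ← Finset.sum_fiberwise (s := Finset.univ) (g := κ) (f := fun j => ‖x j‖ ^ p.toReal)]
      exact Finset.sum_le_sum fun c _ => weighted_mean_rpow_le _ hP w hw _
  let B : EllFin 𝕜 p m →L[𝕜] EllFin 𝕜 p k := EllFin.mkCLM hp'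
    { toFun := fun y j => ((w j * W (κ j) ^ (-(1 / P)) : ℝ) : 𝕜) * y (κ j)
      map_add' := fun x y => by
        ext c
        simp only [PiLp.add_apply, Pi.add_apply, mul_add]
      map_smul' := fun a x => by
        ext c
        simp only [PiLp.smul_apply, Pi.smul_apply, smul_eq_mul, RingHom.id_apply]
        ring } 1 zero_le_one fun y => by
      rw [one_mul, EllFin.norm_rpow hp', ← Finset.sum_fiberwise (s := Finset.univ) (g := κ)]
      refine Finset.sum_le_sum fun c _ => ?_
      have h1 : ∀ j ∈ Finset.univ.filter fun j => κ j = c,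
          ‖((w j * W (κ j) ^ (-(1 / P)) : ℝ) : 𝕜) * y (κ j)‖ ^ P =
            w j ^ P * ((W c)⁻¹ * ‖y c‖ ^ P) := by
        intro j hj
        rw [(Finset.mem_filter.1 hj).2, norm_mul, RCLike.norm_ofReal, abs_of_nonneg
          (mul_nonneg (hw j) (Real.rpow_nonneg (hW0 c) _)), Real.mul_rpow
          (mul_nonneg (hw j) (Real.rpow_nonneg (hW0 c) _)) (norm_nonneg _),
          Real.mul_rpow (hw j) (Real.rpow_nonneg (hW0 c) _), ← Real.rpow_mul (hW0 c),
          neg_mul, one_div_mul_cancel hP0.ne', Real.rpow_neg_one, mul_assoc]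
      simp only [LinearMap.coe_mk, AddHom.coe_mk]
      rw [Finset.sum_congr rfl h1, ← Finset.sum_mul]
      change W c * ((W c)⁻¹ * ‖y c‖ ^ P) ≤ _
      rcases (hW0 c).eq_or_lt with h | h
      · rw [← h]; simp only [zero_mul]; positivity
      · rw [mul_inv_cancel_left₀ h.ne']
  refine ⟨A, B, EllFin.norm_mkCLM_le _ _ _ _ _, EllFin.norm_mkCLM_le _ _ _ _ _, fun α x hx => ?_⟩
  ext j
  change ((w j * W (κ j) ^ (-(1 / P)) : ℝ) : 𝕜) * (((W (κ j) ^ (1 / P - 1) : ℝ) : 𝕜) *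
        ∑ i with κ i = κ j, ((w i ^ (P - 1) : ℝ) : 𝕜) * x i) = x j
  have h1 : ∑ i with κ i = κ j, ((w i ^ (P - 1) : ℝ) : 𝕜) * x i =
      α (κ j) * ((W (κ j) : ℝ) : 𝕜) := by
    simp only [W, RCLike.ofReal_sum, Finset.mul_sum]
    refine Finset.sum_congr rfl fun i hi => ?_
    rw [hx i, (Finset.mem_filter.1 hi).2]
    have h2 : w i ^ P = w i ^ (P - 1) * w i := by
      rcases (hw i).eq_or_lt with h | h
      · rw [← h, Real.zero_rpow hP0.ne', mul_zero]
      · rw [Real.rpow_sub_one h.ne', div_mul_cancel₀ _ h.ne']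
    rw [h2]; push_cast; ring
  rw [h1, hx j]
  rcases (hW0 (κ j)).eq_or_lt with h | h
  · rw [hwW j h.symm]; simp
  · have h3 : W (κ j) ^ (-(1 / P)) * W (κ j) ^ (1 / P - 1) * W (κ j) = 1 := by
      rw [← Real.rpow_add h, ← Real.rpow_add_one h.ne']
      ring_nf
      simp
    have h4 : ((W (κ j) ^ (-(1 / P)) : ℝ) : 𝕜) * ((W (κ j) ^ (1 / P - 1) : ℝ) : 𝕜) *
        ((W (κ j) : ℝ) : 𝕜) = 1 := by
      rw [← RCLike.ofReal_mul, ← RCLike.ofReal_mul, h3, RCLike.ofReal_one]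
    push_cast
    calc _ = α (κ j) * (w j : 𝕜) * (((W (κ j) ^ (-(1 / P)) : ℝ) : 𝕜) *
        ((W (κ j) ^ (1 / P - 1) : ℝ) : 𝕜) * ((W (κ j) : ℝ) : 𝕜)) := by ring
      _ = _ := by rw [h4, mul_one]

variable (𝕜) in
/-- Finitely many vectors of bounded norm in `ℓ_p^k` can be compressed, up to `ε`, into an
`ℓ_p^m` with `m` independent of `k`: discretize the ratios of the coordinates. -/
theorem EllFin.exists_compression (hp : 1 < p) (hp' : p ≠ ∞) (ι : Type*) [Fintype ι] (M : ℝ)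
    {ε : ℝ} (hε : 0 < ε) :
    ∃ m : ℕ, ∀ (k : ℕ) (v : ι → EllFin 𝕜 p k), (∀ i, ‖v i‖ ≤ M) →
      ∃ (A : EllFin 𝕜 p k →L[𝕜] EllFin 𝕜 p m) (B : EllFin 𝕜 p m →L[𝕜] EllFin 𝕜 p k),
        ‖A‖ ≤ 1 ∧ ‖B‖ ≤ 1 ∧ ∀ i, ‖B (A (v i)) - v i‖ ≤ ε := by
  -- Relative to the weight `w j = ∑ i, |v i j|` the coordinate vectors `(v i j)_i` lie in a fixed
  -- compact ball; `m` is the size of a `δ`-net of this ball, independent of `k` and of `v`.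
  let N : ℝ := Fintype.card ι * |M| + 1
  have hN : 0 < N := by positivity
  let δ : ℝ := ε / (2 * N)
  have hδ : 0 < δ := by positivity
  obtain ⟨t, -, htf, htc⟩ := (isCompact_closedBall (0 : ι → 𝕜) 1).finite_cover_balls hδ
  let T := htf.toFinset
  refine ⟨T.card, fun k v hv => ?_⟩
  let w : Fin k → ℝ := fun j => ∑ i, ‖v i j‖
  have hw : ∀ j, 0 ≤ w j := fun j => Finset.sum_nonneg fun i _ => norm_nonneg _
  have hvw : ∀ i j, ‖v i j‖ ≤ w j := fun i j =>
    Finset.single_le_sum (f := fun i => ‖v i j‖) (fun i _ => norm_nonneg _) (Finset.mem_univ i)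
  let u : Fin k → ι → 𝕜 := fun j i => v i j / (w j : 𝕜)
  have hu : ∀ j, u j ∈ Metric.closedBall (0 : ι → 𝕜) 1 := by
    intro j
    rw [mem_closedBall_zero_iff, pi_norm_le_iff_of_nonneg zero_le_one]
    intro i
    rw [norm_div, RCLike.norm_ofReal, abs_of_nonneg (hw j)]
    exact div_le_one_of_le₀ (hvw i j) (hw j)
  have huv : ∀ i j, v i j = u j i * (w j : 𝕜) := by
    intro i j
    by_cases h : w j = 0
    · have h1 : v i j = 0 := norm_le_zero_iff.1 ((hvw i j).trans h.le)
      simp [h1, h]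
    · rw [div_mul_cancel₀]
      simpa using h
  have hex : ∀ j, ∃ a : T, u j ∈ Metric.ball (a : ι → 𝕜) δ := by
    intro j
    have := htc (hu j)
    simp only [Set.mem_iUnion] at this
    obtain ⟨a, ha, hb⟩ := this
    exact ⟨⟨a, by simpa [T] using ha⟩, hb⟩
  choose a ha using hex
  obtain ⟨A, B, hA, hB, hAB⟩ := EllFin.exists_averaging (𝕜 := 𝕜) hp hp'
    (fun j => T.equivFin (a j)) w hw
  refine ⟨A, B, hA, hB, fun i => ?_⟩
  -- the quantized vector, on which the averaging operator acts as the identity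
  let x : EllFin 𝕜 p k := WithLp.toLp p fun j => (a j : ι → 𝕜) i * (w j : 𝕜)
  have hx : B (A x) = x := hAB (fun c => (T.equivFin.symm c : ι → 𝕜) i) x fun j => by simp [x]
  -- the weight `w` as a vector, to bound the quantization error
  let w' : EllFin 𝕜 p k := ∑ i, WithLp.toLp p fun j => ((‖v i j‖ : ℝ) : 𝕜)
  have hw'n : ‖w'‖ ≤ N := by
    refine (norm_sum_le _ _).trans ?_
    have h1 : ∀ i ∈ Finset.univ, ‖(WithLp.toLp p fun j => ((‖v i j‖ : ℝ) : 𝕜) : EllFin 𝕜 p k)‖ ≤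
        |M| := fun i _ => by
      refine (EllFin.norm_mono hp' fun j => ?_).trans ((hv i).trans (le_abs_self M))
      simp
    refine (Finset.sum_le_sum h1).trans ?_
    simp [N]
  have hw'j : ∀ j, w' j = (w j : 𝕜) := fun j => by simp [w', w]
  have hdiff : ‖v i - x‖ ≤ ε / 2 := by
    have h1 : ‖v i - x‖ ≤ ‖(δ : 𝕜) • w'‖ := by
      refine EllFin.norm_mono hp' fun j => ?_
      rw [PiLp.sub_apply, PiLp.smul_apply, hw'j, huv i j]
      change ‖u j i * (w j : 𝕜) - (a j : ι → 𝕜) i * (w j : 𝕜)‖ ≤ _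
      rw [← sub_mul, norm_mul, smul_eq_mul, norm_mul, RCLike.norm_ofReal, RCLike.norm_ofReal,
        abs_of_pos hδ]
      refine mul_le_mul_of_nonneg_right ?_ (abs_nonneg _)
      have h2 := ha j
      rw [mem_ball_iff_norm] at h2
      exact (norm_le_pi_norm (u j - (a j : ι → 𝕜)) i).trans h2.le
    refine h1.trans ?_
    rw [norm_smul, RCLike.norm_ofReal, abs_of_pos hδ]
    refine (mul_le_mul_of_nonneg_left hw'n hδ.le).trans (le_of_eq ?_)
    simp only [δ]; field_simp
  have h3 : B (A (v i)) - v i = B (A (v i - x)) - (v i - x) := by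
    rw [map_sub, map_sub, hx]; abel
  rw [h3]
  have h4 : ‖B (A (v i - x))‖ ≤ ‖v i - x‖ := by
    have h5 := B.le_of_opNorm_le hB (A (v i - x))
    have h6 := A.le_of_opNorm_le hA (v i - x)
    linarith
  linarith [norm_sub_le (B (A (v i - x))) (v i - x)]

end Quantization

section LocalFactorization

variable {𝕜 : Type*} [RCLike 𝕜] {p : ℝ≥0∞} [Fact (1 ≤ p)] {X : Type*}
  [NormedAddCommGroup X] [NormedSpace 𝕜 X]

/-- The isomorphisms in the definition of an `ℒ_p`-space can be rescaled so that the inverse is a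
contraction. -/
theorem IsScriptLpWith.exists_normalized {C : ℝ} (h : IsScriptLpWith 𝕜 p C X)
    (E : Submodule 𝕜 X) [FiniteDimensional 𝕜 E] :
    ∃ F : Submodule 𝕜 X, E ≤ F ∧ ∃ (n : ℕ) (T : F →L[𝕜] EllFin 𝕜 p n) (S : EllFin 𝕜 p n →L[𝕜] F),
      (∀ x, S (T x) = x) ∧ (∀ y, T (S y) = y) ∧ ‖T‖ ≤ C ∧ ‖S‖ ≤ 1 := by
  obtain ⟨F, hEF, n, T, hT⟩ := h E inferInstance
  refine ⟨F, hEF, n, ?_⟩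
  have hC : 0 ≤ C := le_trans (by positivity) hT
  set T' : F →L[𝕜] EllFin 𝕜 p n := (T : F →L[𝕜] EllFin 𝕜 p n) with hT'
  set S' : EllFin 𝕜 p n →L[𝕜] F := (T.symm : EllFin 𝕜 p n →L[𝕜] F) with hS'
  have hST : ∀ x, S' (T' x) = x := fun x => T.symm_apply_apply x
  have hTS : ∀ y, T' (S' y) = y := fun y => T.apply_symm_apply y
  by_cases h0 : ‖S'‖ = 0
  · refine ⟨T', S', hST, hTS, ?_, by rw [h0]; exact zero_le_one⟩
    have hS0 : S' = 0 := norm_eq_zero.1 h0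
    have hT0 : T' = 0 := by
      ext1 x
      have := hTS (T' x)
      rw [hS0] at this
      simpa using this.symm
    rw [hT0, norm_zero]
    exact hC
  · have hpos : 0 < ‖S'‖ := lt_of_le_of_ne (norm_nonneg _) (Ne.symm h0)
    have hne : ((‖S'‖ : ℝ) : 𝕜) ≠ 0 := by simpa using h0
    refine ⟨((‖S'‖ : ℝ) : 𝕜) • T', ((‖S'‖ : ℝ) : 𝕜)⁻¹ • S', fun x => ?_, fun y => ?_, ?_, ?_⟩
    · simp only [smul_apply, map_smul, hST]
      exact smul_inv_smul₀ hne x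
    · simp only [smul_apply, map_smul, hTS]
      exact inv_smul_smul₀ hne y
    · rw [norm_smul, RCLike.norm_ofReal, abs_norm, mul_comm]
      exact hT
    · rw [norm_smul, norm_inv, RCLike.norm_ofReal, abs_norm, inv_mul_cancel₀ h0]

/-- The identity of an `ℒ_p`-space factors through `ℓ_p^m`, up to a small error on a given finite
set. The operator into `ℓ_p^m` is a limit of compressions of the isomorphisms given by the
definition; the limit exists because `m` does not depend on the subspace. -/
theorem IsScriptLpWith.exists_local_factorization (hp : 1 < p) (hp' : p ≠ ∞) {C : ℝ} (hC : 1 ≤ C)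
    (h : IsScriptLpWith 𝕜 p C X) (s : Finset X) {ε : ℝ} (hε : 0 < ε) :
    ∃ (m : ℕ) (A : X →L[𝕜] EllFin 𝕜 p m) (B : EllFin 𝕜 p m →L[𝕜] X),
      ‖A‖ ≤ C ∧ ‖B‖ ≤ C ∧ ∀ x ∈ s, ‖B (A x) - x‖ ≤ ε := by
  classical
  have hC0 : 0 ≤ C := zero_le_one.trans hC
  have hfd : ∀ t : Finset X, FiniteDimensional 𝕜 (Submodule.span 𝕜 (t : Set X)) := fun t =>
    FiniteDimensional.span_of_finite 𝕜 t.finite_toSet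
  choose F hF n T S hST hTS hT hS using fun t : Finset X =>
    h.exists_normalized (Submodule.span 𝕜 (t : Set X))
  -- the isomorphism `T t`, extended by zero
  let T' : ∀ t, X → EllFin 𝕜 p (n t) := fun t x => if hx : x ∈ F t then T t ⟨x, hx⟩ else 0
  have hT'n : ∀ t x, ‖T' t x‖ ≤ C * ‖x‖ := by
    intro t x
    by_cases hx : x ∈ F t
    · simp only [T', dif_pos hx]
      exact (T t).le_of_opNorm_le (hT t) ⟨x, hx⟩
    · simp only [T', dif_neg hx, norm_zero]
      positivity
  obtain ⟨m, hm⟩ := EllFin.exists_compression 𝕜 hp hp' s (C * ∑ x ∈ s, ‖x‖)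
    (show 0 < ε / 2 by positivity)
  choose A B hA hB hAB using fun t => hm (n t) (fun x : s => T' t x) fun x =>
    (hT'n t x).trans (mul_le_mul_of_nonneg_left
      (Finset.single_le_sum (f := fun x => ‖x‖) (fun _ _ => norm_nonneg _) x.2) hC0)
  -- along this ultrafilter the subspaces `F t` eventually contain every given vector
  let U : Ultrafilter (Finset X) := Ultrafilter.of atTop
  have hU : (U : Filter (Finset X)) ≤ atTop := Ultrafilter.of_le atTop
  have hmem : ∀ x, ∀ᶠ t in (U : Filter (Finset X)), x ∈ F t := fun x => by
    refine hU ?_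
    filter_upwards [eventually_ge_atTop {x}] with t ht
    exact hF t (Submodule.subset_span (by simpa using ht))
  have hlim : ∀ x, Tendsto (fun t => A t (T' t x)) U (𝓝 (ulim U fun t => A t (T' t x))) := by
    intro x
    have : ProperSpace (EllFin 𝕜 p m) := FiniteDimensional.proper_rclike 𝕜 _
    refine tendsto_ulim (C := C * ‖x‖) (Eventually.of_forall fun t => ?_)
    have := (A t).le_of_opNorm_le (hA t) (T' t x)
    linarith [hT'n t x]
  let L : X →L[𝕜] EllFin 𝕜 p m := LinearMap.mkContinuous
    { toFun := fun x => ulim U fun t => A t (T' t x)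
      map_add' := fun x y => by
        refine ulim_eq_of_tendsto (((hlim x).add (hlim y)).congr' ?_)
        filter_upwards [hmem x, hmem y] with t hx hy
        simp only [T', dif_pos hx, dif_pos hy, dif_pos ((F t).add_mem hx hy)]
        rw [← map_add, ← map_add]
        rfl
      map_smul' := fun c x => by
        refine ulim_eq_of_tendsto (((hlim x).const_smul c).congr' ?_)
        filter_upwards [hmem x] with t hx
        simp only [T', dif_pos hx, dif_pos ((F t).smul_mem c hx)]
        rw [← map_smul, ← map_smul]
        rfl } C fun x => by
      refine le_of_tendsto (hlim x).norm (Eventually.of_forall fun t => ?_)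
      have := (A t).le_of_opNorm_le (hA t) (T' t x)
      linarith [hT'n t x]
  have hev : ∀ᶠ t in (U : Filter (Finset X)), ∀ x ∈ s,
      x ∈ F t ∧ ‖A t (T' t x) - L x‖ ≤ ε / 2 := by
    rw [Filter.eventually_all_finset]
    intro x _
    refine (hmem x).and ?_
    filter_upwards [Metric.tendsto_nhds.1 (hlim x) (ε / 2) (by positivity)] with t ht
    rw [dist_eq_norm] at ht
    exact ht.le
  -- a single `t` serves all `x ∈ s`; its inverse isomorphism gives the operator back into `X`
  obtain ⟨t, ht⟩ := hev.exists
  refine ⟨m, L, (F t).subtypeL ∘L S t ∘L B t, LinearMap.mkContinuous_norm_le _ hC0 _, ?_, ?_⟩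
  · refine ContinuousLinearMap.opNorm_le_bound _ hC0 fun y => ?_
    have h1 := (S t).le_of_opNorm_le (hS t) (B t y)
    have h2 := (B t).le_of_opNorm_le (hB t) y
    have h3 : ‖y‖ ≤ C * ‖y‖ := le_mul_of_one_le_left (norm_nonneg _) hC
    change ‖S t (B t y)‖ ≤ _
    linarith
  · intro x hx
    obtain ⟨hxF, hxL⟩ := ht x hx
    have h1 : ((S t (T t ⟨x, hxF⟩) : F t) : X) = x := by rw [hST]
    have h2 : T' t x = T t ⟨x, hxF⟩ := dif_pos hxF
    change ‖((S t (B t (L x)) : F t) : X) - x‖ ≤ ε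
    have h3 : ((S t (B t (L x)) : F t) : X) - x =
        ((S t (B t (L x - A t (T' t x)) + (B t (A t (T' t x)) - T' t x)) : F t) : X) := by
      rw [map_sub, sub_add_sub_cancel, map_sub, Submodule.coe_sub, h2, h1]
    rw [h3]
    have h4 := (S t).le_of_opNorm_le (hS t) (B t (L x - A t (T' t x)) + (B t (A t (T' t x)) - T' t x))
    have h5 := norm_add_le (B t (L x - A t (T' t x))) (B t (A t (T' t x)) - T' t x)
    have h6 := (B t).le_of_opNorm_le (hB t) (L x - A t (T' t x))
    have h7 := hAB t ⟨x, hx⟩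
    rw [norm_sub_rev] at hxL
    simp only [one_mul] at h4 h6
    refine h4.trans (h5.trans ?_)
    simp only at h7
    linarith

/-- A separable `ℒ_p`-space has an approximation of the identity through `ℓ_p^n`. -/
theorem IsScriptLp.nonempty_lpApprox [TopologicalSpace.SeparableSpace X] (hp : 1 < p)
    (hp' : p ≠ ∞) (h : IsScriptLp 𝕜 p X) : Nonempty (LpApprox 𝕜 p X) := by
  classical
  obtain ⟨C, hC, h⟩ := h
  have hC0 : 0 ≤ C := zero_le_one.trans hC
  let d := TopologicalSpace.denseSeq X
  have hd : DenseRange d := TopologicalSpace.denseRange_denseSeq X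
  choose m A B hA hB hAB using fun N : ℕ => h.exists_local_factorization hp hp' hC
    ((Finset.range (N + 1)).image d) (show (0 : ℝ) < 1 / (N + 1) by positivity)
  -- the largest admissible stage that fits into `ℓ_p^{n+1}`
  let ν : ℕ → ℕ := fun n => Nat.findGreatest (fun N => m N ≤ n + 1) n
  have hν : Tendsto ν atTop atTop := by
    refine tendsto_atTop.2 fun N => ?_
    filter_upwards [eventually_ge_atTop (max N (m N))] with n hn
    exact Nat.le_findGreatest ((le_max_left _ _).trans hn) (by
      have := (le_max_right N (m N)).trans hn; omega)
  have hmν : ∀ᶠ n in atTop, m (ν n) ≤ n + 1 := by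
    filter_upwards [eventually_ge_atTop (m 0)] with n hn
    exact Nat.findGreatest_spec (P := fun N => m N ≤ n + 1) (Nat.zero_le n) (by omega)
  have hconv : ∀ x, Tendsto (fun N => B N (A N x)) atTop (𝓝 x) := by
    intro x
    rw [Metric.tendsto_atTop]
    intro ε hε
    obtain ⟨i, hi⟩ := hd.exists_dist_lt x (show 0 < ε / (2 * (C * C + 1)) by positivity)
    rw [dist_eq_norm, lt_div_iff₀ (by positivity)] at hi
    obtain ⟨N₀, hN₀⟩ := exists_nat_one_div_lt (show 0 < ε / 2 by positivity)
    refine ⟨max i N₀, fun N hN => ?_⟩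
    have h1 := hAB N (d i) (Finset.mem_image_of_mem _ (Finset.mem_range.2 (by
      have := (le_max_left i N₀).trans hN; omega)))
    have h2 : (1 : ℝ) / (N + 1) ≤ 1 / (N₀ + 1) := by
      have : (N₀ : ℝ) ≤ N := by exact_mod_cast (le_max_right i N₀).trans hN
      exact one_div_le_one_div_of_le (by positivity) (by linarith)
    have h3 : B N (A N x) - x = B N (A N (x - d i)) + (B N (A N (d i)) - d i) - (x - d i) := by
      rw [map_sub, map_sub]; abel
    have h4 := (B N).le_of_opNorm_le (hB N) (A N (x - d i))
    have h5 := mul_le_mul_of_nonneg_left ((A N).le_of_opNorm_le (hA N) (x - d i)) hC0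
    rw [dist_eq_norm, h3]
    have h6 := norm_sub_le (B N (A N (x - d i)) + (B N (A N (d i)) - d i)) (x - d i)
    have h7 := norm_add_le (B N (A N (x - d i))) (B N (A N (d i)) - d i)
    have h8 : C * (C * ‖x - d i‖) + ‖x - d i‖ < ε / 2 := by linarith
    linarith
  refine ⟨⟨C, fun n => EllFin.pad 𝕜 p hp' _ _ ∘L A (ν n), fun n => B (ν n) ∘L
    EllFin.pad 𝕜 p hp' _ _, hC, fun n => ?_, fun n => ?_, fun x => ?_⟩⟩
  · refine (ContinuousLinearMap.opNorm_comp_le _ _).trans ?_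
    have := mul_le_mul (EllFin.norm_pad_le (𝕜 := 𝕜) hp' (m (ν n)) (n + 1)) (hA (ν n))
      (norm_nonneg _) zero_le_one
    simpa using this
  · refine (ContinuousLinearMap.opNorm_comp_le _ _).trans ?_
    have := mul_le_mul (hB (ν n)) (EllFin.norm_pad_le (𝕜 := 𝕜) hp' (n + 1) (m (ν n)))
      (norm_nonneg _) hC0
    simpa using this
  · refine ((hconv x).comp hν).congr' ?_
    filter_upwards [hmν] with n hn
    simp only [Function.comp_apply, ContinuousLinearMap.comp_apply]
    rw [EllFin.pad_pad hp' hn]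

end LocalFactorization

/-! ### Complemented copies of `ℓ_p` from almost biorthogonal systems -/

section System

variable {𝕜 : Type*} [RCLike 𝕜] {p : ℝ≥0∞} [Fact (1 ≤ p)] {X : Type*}
  [NormedAddCommGroup X] [NormedSpace 𝕜 X]

/-- A sequence with an upper `p`-estimate and a sequence of functionals with the dual estimate that
are biorthogonal up to a small perturbation span a complemented copy of `ℓ_p`. -/
theorem factors_ell_of_system [CompleteSpace X] (hp : p ≠ ∞) (x : ℕ → X) (f : ℕ → X →L[𝕜] 𝕜)
    {C : ℝ} (hC : 0 ≤ C)
    (hx : ∀ N (c : ℕ → 𝕜), ‖∑ i ∈ Finset.range N, c i • x i‖ ^ p.toReal ≤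
      C ^ p.toReal * ∑ i ∈ Finset.range N, ‖c i‖ ^ p.toReal)
    (hf : ∀ N y, ∑ i ∈ Finset.range N, ‖f i y‖ ^ p.toReal ≤ (C * ‖y‖) ^ p.toReal)
    (hfx : ∀ i j, ‖f i (x j) - if i = j then 1 else 0‖ ≤ (1 / 2) ^ i * (1 / 2) ^ j / 8) :
    Factors 𝕜 (Ell 𝕜 p) X := by
  classical
  have hP1 := one_le_toReal_of_fact p hp
  set P := p.toReal with hPdef
  have hP : 0 < P := by linarith
  let a : X →L[𝕜] Ell 𝕜 p := Ell.mkCLM hp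
    { toFun := fun y i => f i y
      map_add' := fun y z => by ext i; simp
      map_smul' := fun c y => by ext i; simp } C hC fun y s => by
      obtain ⟨N, hN⟩ := s.exists_nat_subset_range
      exact (Finset.sum_le_sum_of_subset_of_nonneg hN fun _ _ _ => by positivity).trans (hf N y)
  have hx' : ∀ (s : Finset ℕ) (c : ℕ → 𝕜),
      ‖∑ i ∈ s, c i • x i‖ ^ P ≤ C ^ P * ∑ i ∈ s, ‖c i‖ ^ P := by
    intro s c
    obtain ⟨N, hN⟩ := s.exists_nat_subset_range
    have h := hx N fun i => if i ∈ s then c i else 0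
    have h1 : ∑ i ∈ Finset.range N, (if i ∈ s then c i else 0) • x i = ∑ i ∈ s, c i • x i := by
      rw [← Finset.sum_subset hN fun i _ hi => by simp [hi]]
      exact Finset.sum_congr rfl fun i hi => by simp [hi]
    have h2 : ∑ i ∈ Finset.range N, ‖if i ∈ s then c i else 0‖ ^ P = ∑ i ∈ s, ‖c i‖ ^ P := by
      rw [← Finset.sum_subset hN fun i _ hi => by simp [hi, hP.ne']]
      exact Finset.sum_congr rfl fun i hi => by simp [hi]
    rwa [h1, h2] at h
  have hxn : ∀ (s : Finset ℕ) (y : Ell 𝕜 p), ‖∑ i ∈ s, y i • x i‖ ≤ C * ‖y‖ := by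
    intro s y
    refine (Real.rpow_le_rpow_iff (norm_nonneg _) (by positivity) hP).1 ((hx' s y).trans ?_)
    rw [Real.mul_rpow hC (norm_nonneg _)]
    exact mul_le_mul_of_nonneg_left (lp.sum_rpow_le_norm_rpow hP y s) (by positivity)
  have hsum : ∀ y : Ell 𝕜 p, Summable fun i => y i • x i := by
    intro y
    rw [summable_iff_vanishing_norm]
    intro ε hε
    obtain ⟨s, hs⟩ := summable_iff_vanishing_norm.1 ((lp.memℓp y).summable hP)
      (ε ^ P / (C ^ P + 1)) (by positivity)
    refine ⟨s, fun t ht => ?_⟩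
    have h1 := hs t ht
    rw [Real.norm_of_nonneg (Finset.sum_nonneg fun _ _ => by positivity),
      lt_div_iff₀ (by positivity)] at h1
    refine (Real.rpow_lt_rpow_iff (norm_nonneg _) hε.le hP).1 ((hx' t y).trans_lt ?_)
    have h2 : 0 ≤ ∑ i ∈ t, ‖y i‖ ^ P := Finset.sum_nonneg fun _ _ => by positivity
    by_cases h3 : ∑ i ∈ t, ‖y i‖ ^ P = 0
    · rw [h3, mul_zero]; positivity
    · have : 0 < ∑ i ∈ t, ‖y i‖ ^ P := lt_of_le_of_ne h2 (Ne.symm h3)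
      linarith
  let b : Ell 𝕜 p →L[𝕜] X := LinearMap.mkContinuous
    { toFun := fun y => ∑' i, y i • x i
      map_add' := fun y z => by
        rw [← (hsum y).tsum_add (hsum z)]
        simp [add_smul]
      map_smul' := fun c y => by
        rw [RingHom.id_apply, ← (hsum y).tsum_const_smul c]
        simp [smul_smul] } C fun y =>
      le_of_tendsto (hsum y).hasSum.norm (Eventually.of_forall fun s => hxn s y)
  have hb : ∀ y, b y = ∑' i, y i • x i := fun y => rfl
  -- `a ∘ b` is a perturbation of the identity of `ℓ_p`, hence invertible
  let R : Ell 𝕜 p →L[𝕜] Ell 𝕜 p := a ∘L b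
  have hRi : ∀ y i, ‖(y - R y) i‖ ≤ (1 / 2) ^ (i + 1) * (‖y‖ / 2) := by
    intro y i
    have h1 : HasSum (fun j => y j * f i (x j)) (R y i) := by
      have := (f i).hasSum (hsum y).hasSum
      simpa [R, a, hb] using this
    have h2 : HasSum (fun j => y j * if i = j then 1 else 0) (y i) := by
      have := hasSum_ite_eq i (y i)
      refine this.congr_fun ?_
      intro j
      by_cases hj : i = j
      · simp [hj]
      · simp [hj, Ne.symm hj]
    have h3 := h2.sub h1
    have h4 : HasSum (fun j => ‖y‖ * (1 / 2) ^ i / 8 * (1 / 2 : ℝ) ^ j)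
        (‖y‖ * (1 / 2) ^ i / 8 * 2) := hasSum_geometric_two.mul_left _
    have h5 : ‖y i - R y i‖ ≤ ‖y‖ * (1 / 2) ^ i / 8 * 2 := by
      refine HasSum.norm_le_of_bounded h3 h4 fun j => ?_
      rw [← mul_sub, norm_mul, norm_sub_rev]
      have h6 := lp.norm_apply_le_norm (zero_lt_one.trans_le (Fact.out (p := 1 ≤ p))).ne' y j
      refine (mul_le_mul h6 (hfx i j) (norm_nonneg _) (norm_nonneg _)).trans (le_of_eq (by ring))
    refine h5.trans (le_of_eq ?_)
    ring
  have hR : ‖1 - R‖ < 1 := by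
    refine lt_of_le_of_lt (ContinuousLinearMap.opNorm_le_bound _ (M := 1 / 2) (by norm_num)
      fun y => ?_) (by norm_num : (1 : ℝ) / 2 < 1)
    change ‖y - R y‖ ≤ 1 / 2 * ‖y‖
    refine lp.norm_le_of_forall_sum_le hP (by positivity) fun s => ?_
    have h1 : ∀ i ∈ s, ‖(y - R y) i‖ ^ P ≤ (1 / 2 : ℝ) ^ (i + 1) * (1 / 2 * ‖y‖) ^ P := by
      intro i _
      refine (Real.rpow_le_rpow (norm_nonneg _) (hRi y i) hP.le).trans ?_
      rw [Real.mul_rpow (by positivity) (by positivity)]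
      refine mul_le_mul ?_ (le_of_eq (by ring_nf)) (by positivity) (by positivity)
      refine (Real.rpow_le_rpow_of_exponent_ge (by positivity) ?_ hP1).trans_eq (Real.rpow_one _)
      exact pow_le_one₀ (by norm_num) (by norm_num)
    refine (Finset.sum_le_sum h1).trans ?_
    rw [← Finset.sum_mul]
    refine mul_le_of_le_one_left (by positivity) ?_
    have h2 : HasSum (fun i => (1 / 2 : ℝ) ^ (i + 1)) 1 := by
      have := hasSum_geometric_two.mul_left (1 / 2 : ℝ)
      simpa [pow_succ, mul_comm] using this
    exact sum_le_hasSum s (fun i _ => by positivity) h2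
  obtain ⟨u, hu⟩ : IsUnit R := by
    have := isUnit_one_sub_of_norm_lt_one hR
    rwa [sub_sub_cancel] at this
  refine ⟨b, (↑u⁻¹ : Ell 𝕜 p →L[𝕜] Ell 𝕜 p) ∘L a, fun y => ?_⟩
  have h1 : (↑u⁻¹ : Ell 𝕜 p →L[𝕜] Ell 𝕜 p) * R = 1 := by rw [← hu]; exact u.inv_mul
  exact congrArg (fun T : Ell 𝕜 p →L[𝕜] Ell 𝕜 p => T y) h1

/-- The vector `conj a * ‖a‖ ^ (r - 2)`, which norms `a` in the duality of `ℓ_r` and its dual. -/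
noncomputable def dualCoord (r : ℝ) (a : 𝕜) : 𝕜 := (starRingEnd 𝕜) a * ((‖a‖ ^ (r - 2) : ℝ) : 𝕜)

theorem dualCoord_mul {r : ℝ} (hr : 1 < r) (a : 𝕜) : dualCoord r a * a = ((‖a‖ ^ r : ℝ) : 𝕜) := by
  by_cases ha : a = 0
  · subst ha; simp [Real.zero_rpow (show r ≠ 0 by linarith)]
  · have hpos : 0 < ‖a‖ := norm_pos_iff.2 ha
    have h1 : ‖a‖ ^ r = ‖a‖ ^ 2 * ‖a‖ ^ (r - 2) := by
      rw [← Real.rpow_natCast, ← Real.rpow_add hpos]; congr 1; push_cast; ring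
    rw [h1, dualCoord, mul_right_comm, RCLike.conj_mul]
    push_cast; rfl

theorem norm_dualCoord {r : ℝ} (hr : 1 < r) (a : 𝕜) : ‖dualCoord r a‖ = ‖a‖ ^ (r - 1) := by
  by_cases ha : a = 0
  · subst ha; simp [dualCoord, Real.zero_rpow (show r - 1 ≠ 0 by linarith)]
  · have hpos : 0 < ‖a‖ := norm_pos_iff.2 ha
    rw [dualCoord, norm_mul, RCLike.norm_conj, RCLike.norm_ofReal,
      abs_of_nonneg (Real.rpow_nonneg hpos.le _), mul_comm, ← Real.rpow_add_one hpos.ne']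
    congr 1; ring

/-- The converse of Hölder's inequality for finite sums. -/
theorem sum_rpow_le_of_forall_pairing {ι : Type*} (s : Finset ι) {r r' : ℝ}
    (hr : r.HolderConjugate r') (a : ι → 𝕜) {B : ℝ} (hB : 0 ≤ B)
    (h : ∀ c : ι → 𝕜, ‖∑ i ∈ s, c i * a i‖ ≤ B * (∑ i ∈ s, ‖c i‖ ^ r') ^ (1 / r')) :
    ∑ i ∈ s, ‖a i‖ ^ r ≤ B ^ r := by
  have hr1 : 1 < r := hr.lt
  have hr0 : 0 < r := hr.pos
  set A := ∑ i ∈ s, ‖a i‖ ^ r with hA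
  have hA0 : 0 ≤ A := Finset.sum_nonneg fun i _ => by positivity
  have h1 := h fun i => dualCoord r (a i)
  have h2 : ∀ i, ‖dualCoord r (a i)‖ ^ r' = ‖a i‖ ^ r := fun i => by
    rw [norm_dualCoord hr1, ← Real.rpow_mul (norm_nonneg _), hr.sub_one_mul_conj]
  simp only [dualCoord_mul hr1, h2, ← hA] at h1
  rw [← RCLike.ofReal_sum, ← hA, RCLike.norm_ofReal, abs_of_nonneg hA0] at h1
  rcases hA0.eq_or_lt with h0 | hpos
  · rw [← h0]; positivity
  · have h3 : A ^ (1 / r) ≤ B := by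
      have h4 : A = A ^ (1 / r) * A ^ (1 / r') := by
        rw [← Real.rpow_add hpos, one_div, one_div, hr.inv_add_inv_eq_one, Real.rpow_one]
      have h5 : 0 < A ^ (1 / r') := by positivity
      refine le_of_mul_le_mul_right ?_ h5
      rw [← h4]; exact h1
    have h6 := Real.rpow_le_rpow (by positivity) h3 hr0.le
    rwa [← Real.rpow_mul hA0, one_div_mul_cancel hr0.ne', Real.rpow_one] at h6

theorem norm_sum_mul_le_of_sum_le {ι : Type*} (s : Finset ι) {r r' : ℝ} (hr : r.HolderConjugate r')
    (c a : ι → 𝕜) {A B : ℝ} (hc : ∑ i ∈ s, ‖c i‖ ^ r' ≤ A) (ha : ∑ i ∈ s, ‖a i‖ ^ r ≤ B) :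
    ‖∑ i ∈ s, c i * a i‖ ≤ A ^ (1 / r') * B ^ (1 / r) := by
  refine (norm_sum_le _ _).trans ?_
  simp only [norm_mul]
  have hr0 := hr.pos
  have hr0' := hr.symm.pos
  refine (Real.inner_le_Lp_mul_Lq_of_nonneg s hr.symm (fun i _ => norm_nonneg (c i))
    fun i _ => norm_nonneg (a i)).trans ?_
  have h1 : 0 ≤ ∑ i ∈ s, ‖c i‖ ^ r' := Finset.sum_nonneg fun i _ => by positivity
  have h2 : 0 ≤ ∑ i ∈ s, ‖a i‖ ^ r := Finset.sum_nonneg fun i _ => by positivity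
  have h3 := h1.trans hc
  exact mul_le_mul (Real.rpow_le_rpow h1 hc (by positivity))
    (Real.rpow_le_rpow h2 ha (by positivity)) (by positivity) (by positivity)

end System

/-! ### Almost disjoint families of functions -/

section AlmostDisjoint

/-- A finite sum of nonnegative numbers differs from its largest term by at most the sum of the
overlaps of each term with the sum of the preceding ones. -/
theorem exists_sum_le_add_sum_min {s : ℝ} (hs : 0 < s) (b : ℕ → ℝ) (hb : ∀ i, 0 ≤ b i) (N : ℕ) :
    ∃ M, 0 ≤ M ∧ M ^ s ≤ ∑ i ∈ Finset.range N, b i ^ s ∧ ∑ i ∈ Finset.range N, b i ≤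
      M + ∑ i ∈ Finset.range N, min (b i) (∑ l ∈ Finset.range i, b l) := by
  induction N with
  | zero => exact ⟨0, le_rfl, by simp [hs.ne'], by simp⟩
  | succ N ih =>
    obtain ⟨M, hM0, hM1, hM2⟩ := ih
    have hsum : 0 ≤ ∑ i ∈ Finset.range N, b i ^ s :=
      Finset.sum_nonneg fun i _ => Real.rpow_nonneg (hb i) _
    have hmin : 0 ≤ ∑ i ∈ Finset.range N, min (b i) (∑ l ∈ Finset.range i, b l) :=
      Finset.sum_nonneg fun i _ => le_min (hb i) (Finset.sum_nonneg fun l _ => hb l)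
    refine ⟨max M (b N), le_max_of_le_left hM0, ?_, ?_⟩
    · rw [Finset.sum_range_succ]
      have h1 : 0 ≤ b N ^ s := Real.rpow_nonneg (hb N) _
      rcases max_cases M (b N) with h | h <;> rw [h.1] <;> linarith
    · rw [Finset.sum_range_succ, Finset.sum_range_succ]
      set σ := ∑ i ∈ Finset.range N, b i
      have h1 := max_add_min σ (b N)
      rw [min_comm (b N) σ]
      have h2 : max σ (b N) ≤ max M (b N) +
          ∑ i ∈ Finset.range N, min (b i) (∑ l ∈ Finset.range i, b l) := by
        refine max_le (hM2.trans ?_) ?_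
        · linarith [le_max_left M (b N)]
        · linarith [le_max_right M (b N)]
      linarith

variable {ι : Type*} [Fintype ι]

/-- Minkowski's inequality for several summands. -/
theorem Lp_norm_sum_le {s : ℝ} (hs : 1 ≤ s) (m : ℕ → ι → ℝ) (hm : ∀ i t, 0 ≤ m i t) (N : ℕ) :
    (∑ t, (∑ i ∈ Finset.range N, m i t) ^ s) ^ (1 / s) ≤
      ∑ i ∈ Finset.range N, (∑ t, m i t ^ s) ^ (1 / s) := by
  have hs0 : 0 < s := by linarith
  induction N with
  | zero => simp [Real.zero_rpow hs0.ne', hs0.ne']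
  | succ N ih =>
    simp only [Finset.sum_range_succ]
    refine (Real.Lp_add_le_of_nonneg Finset.univ hs
      (fun t _ => Finset.sum_nonneg fun i _ => hm i t) fun t _ => hm N t).trans ?_
    linarith

/-- An upper `s`-estimate for linear combinations of almost disjoint functions. -/
theorem sum_rpow_le_of_almost_disjoint {s : ℝ} (hs : 1 ≤ s) (a : ℕ → ι → ℝ)
    (ha : ∀ i t, 0 ≤ a i t) (γ : ℕ → ℝ) (hγ : ∀ i, 0 ≤ γ i) (θ : ℕ → ℝ) (hθ : ∀ i, 0 ≤ θ i) (N : ℕ)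
    (hθs : ∑ i ∈ Finset.range N, θ i ≤ 1) (hnorm : ∀ i < N, ∑ t, a i t ^ s ≤ 2)
    (hdisj : ∀ i < N, ∑ t, min (a i t) (∑ l ∈ Finset.range i, a l t) ^ s ≤ θ i ^ s) :
    ∑ t, (∑ i ∈ Finset.range N, γ i * a i t) ^ s ≤
      3 ^ s * ∑ i ∈ Finset.range N, γ i ^ s := by
  have hs0 : 0 < s := by linarith
  set Γ := ∑ i ∈ Finset.range N, γ i ^ s with hΓ
  have hΓ0 : 0 ≤ Γ := Finset.sum_nonneg fun i _ => Real.rpow_nonneg (hγ i) _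
  set g := Γ ^ (1 / s) with hg
  have hg0 : 0 ≤ g := Real.rpow_nonneg hΓ0 _
  have hgs : g ^ s = Γ := by rw [hg, ← Real.rpow_mul hΓ0, one_div_mul_cancel hs0.ne', Real.rpow_one]
  have hγg : ∀ i ∈ Finset.range N, γ i ≤ g := by
    intro i hi
    refine (Real.rpow_le_rpow_iff (hγ i) hg0 hs0).1 ?_
    rw [hgs]
    exact Finset.single_le_sum (f := fun i => γ i ^ s)
      (fun i _ => Real.rpow_nonneg (hγ i) _) hi
  let m : ℕ → ι → ℝ := fun i t => min (a i t) (∑ l ∈ Finset.range i, a l t)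
  have hm : ∀ i t, 0 ≤ m i t := fun i t => le_min (ha i t) (Finset.sum_nonneg fun l _ => ha l t)
  -- pointwise, the sum is bounded by its largest term plus the overlaps
  choose M hM0 hM1 hM2 using fun t => exists_sum_le_add_sum_min hs0 (fun i => γ i * a i t)
    (fun i => mul_nonneg (hγ i) (ha i t)) N
  have hpt : ∀ t, ∑ i ∈ Finset.range N, γ i * a i t ≤
      M t + g * ∑ i ∈ Finset.range N, m i t := by
    intro t
    refine (hM2 t).trans (add_le_add le_rfl ?_)
    rw [Finset.mul_sum]
    refine Finset.sum_le_sum fun i hi => ?_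
    rw [show g * m i t = min (g * a i t) (g * ∑ l ∈ Finset.range i, a l t) from
      mul_min_of_nonneg _ _ hg0]
    refine min_le_min (mul_le_mul_of_nonneg_right (hγg i hi) (ha i t)) ?_
    rw [Finset.mul_sum]
    refine Finset.sum_le_sum fun l hl => mul_le_mul_of_nonneg_right (hγg l ?_) (ha l t)
    simp only [Finset.mem_range] at hi hl ⊢
    omega
  have hS0 : ∀ t, 0 ≤ ∑ i ∈ Finset.range N, γ i * a i t := fun t =>
    Finset.sum_nonneg fun i _ => mul_nonneg (hγ i) (ha i t)
  have hm0 : ∀ t, 0 ≤ ∑ i ∈ Finset.range N, m i t := fun t => Finset.sum_nonneg fun i _ => hm i t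
  have h1 : (∑ t, (∑ i ∈ Finset.range N, γ i * a i t) ^ s) ^ (1 / s) ≤ 3 * g := by
    calc (∑ t, (∑ i ∈ Finset.range N, γ i * a i t) ^ s) ^ (1 / s)
        ≤ (∑ t, (M t + g * ∑ i ∈ Finset.range N, m i t) ^ s) ^ (1 / s) := by
          refine Real.rpow_le_rpow (Finset.sum_nonneg fun t _ => Real.rpow_nonneg (hS0 t) _)
            (Finset.sum_le_sum fun t _ => Real.rpow_le_rpow (hS0 t) (hpt t) hs0.le) (by positivity)
      _ ≤ (∑ t, M t ^ s) ^ (1 / s) + (∑ t, (g * ∑ i ∈ Finset.range N, m i t) ^ s) ^ (1 / s) :=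
          Real.Lp_add_le_of_nonneg Finset.univ hs (fun t _ => hM0 t)
            fun t _ => mul_nonneg hg0 (hm0 t)
      _ ≤ 2 * g + g := by
          refine add_le_add ?_ ?_
          · have h2 : ∑ t, M t ^ s ≤ 2 * Γ := by
              calc ∑ t, M t ^ s ≤ ∑ t, ∑ i ∈ Finset.range N, (γ i * a i t) ^ s :=
                    Finset.sum_le_sum fun t _ => hM1 t
                _ = ∑ i ∈ Finset.range N, γ i ^ s * ∑ t, a i t ^ s := by
                    rw [Finset.sum_comm]
                    refine Finset.sum_congr rfl fun i _ => ?_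
                    rw [Finset.mul_sum]
                    exact Finset.sum_congr rfl fun t _ => Real.mul_rpow (hγ i) (ha i t)
                _ ≤ ∑ i ∈ Finset.range N, γ i ^ s * 2 :=
                    Finset.sum_le_sum fun i hi => mul_le_mul_of_nonneg_left
                      (hnorm i (Finset.mem_range.1 hi)) (Real.rpow_nonneg (hγ i) _)
                _ = 2 * Γ := by rw [← Finset.sum_mul, mul_comm]
            refine (Real.rpow_le_rpow (Finset.sum_nonneg fun t _ => Real.rpow_nonneg (hM0 t) _) h2
              (by positivity)).trans ?_
            rw [Real.mul_rpow (by norm_num) hΓ0]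
            refine mul_le_mul_of_nonneg_right ?_ hg0
            refine (Real.rpow_le_rpow_of_exponent_le (by norm_num) ?_).trans_eq (Real.rpow_one 2)
            rw [div_le_one hs0]; exact hs
          · have h3 : ∑ t, (g * ∑ i ∈ Finset.range N, m i t) ^ s =
                Γ * ∑ t, (∑ i ∈ Finset.range N, m i t) ^ s := by
              rw [Finset.mul_sum]
              exact Finset.sum_congr rfl fun t _ => by rw [Real.mul_rpow hg0 (hm0 t), hgs]
            rw [h3, Real.mul_rpow hΓ0 (Finset.sum_nonneg fun t _ => Real.rpow_nonneg (hm0 t) _)]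
            refine mul_le_of_le_one_right hg0 ((Lp_norm_sum_le hs m hm N).trans
              (le_trans (Finset.sum_le_sum fun i hi => ?_) hθs))
            refine (Real.rpow_le_rpow (Finset.sum_nonneg fun t _ => Real.rpow_nonneg (hm i t) _)
              (hdisj i (Finset.mem_range.1 hi)) (by positivity)).trans_eq ?_
            rw [← Real.rpow_mul (hθ i), mul_one_div_cancel hs0.ne', Real.rpow_one]
      _ = 3 * g := by ring
  have h0 : 0 ≤ ∑ t, (∑ i ∈ Finset.range N, γ i * a i t) ^ s :=
    Finset.sum_nonneg fun t _ => Real.rpow_nonneg (hS0 t) _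
  have h4 := Real.rpow_le_rpow (Real.rpow_nonneg h0 _) h1 hs0.le
  rwa [← Real.rpow_mul h0, one_div_mul_cancel hs0.ne', Real.rpow_one,
    Real.mul_rpow (by norm_num) hg0, hgs] at h4

/-- The `ℓ_r` norm is at most the `ℓ_1` norm. -/
theorem sum_rpow_le_rpow_sum {r : ℝ} (hr : 1 ≤ r) (a : ℕ → ℝ) (ha : ∀ i, 0 ≤ a i) (N : ℕ) :
    ∑ i ∈ Finset.range N, a i ^ r ≤ (∑ i ∈ Finset.range N, a i) ^ r := by
  induction N with
  | zero => simp [Real.zero_rpow (show r ≠ 0 by linarith)]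
  | succ N ih =>
    rw [Finset.sum_range_succ, Finset.sum_range_succ]
    have := Real.add_rpow_le_rpow_add (Finset.sum_nonneg fun i (_ : i ∈ Finset.range N) => ha i)
      (ha N) hr
    linarith

/-- The pairing of `b` with the norming vector of `a` is controlled by the overlap `min a b`. -/
theorem rpow_sub_one_mul_le {r a b : ℝ} (hr : 2 ≤ r) (ha : 0 ≤ a) (hb : 0 ≤ b) :
    a ^ (r - 1) * b ≤ min a b * a ^ (r - 1) + min a b * b ^ (r - 1) := by
  have ha' : 0 ≤ a ^ (r - 1) := Real.rpow_nonneg ha _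
  have hb' : 0 ≤ b ^ (r - 1) := Real.rpow_nonneg hb _
  rcases le_total a b with h | h
  · rw [min_eq_left h]
    have h1 : ∀ x : ℝ, 0 ≤ x → x ^ (r - 1) = x ^ (r - 2) * x := by
      intro x hx
      rw [← Real.rpow_add_one' hx (by linarith)]; congr 1; ring
    have h2 : a ^ (r - 2) ≤ b ^ (r - 2) := Real.rpow_le_rpow ha h (by linarith)
    have h3 : a ^ (r - 1) * b ≤ a * b ^ (r - 1) := by
      rw [h1 a ha, h1 b hb]
      have := mul_le_mul_of_nonneg_right h2 (mul_nonneg ha hb)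
      linarith
    have := mul_nonneg ha ha'
    linarith
  · rw [min_eq_right h]
    have := mul_nonneg hb hb'
    linarith

end AlmostDisjoint

/-! ### Almost disjoint sequences in spaces that are not Hilbertian -/

section Disjoint

/-- The square of the norm of `Z` is equivalent to a function that satisfies the parallelogram law.
This weak form of being isomorphic to a Hilbert space, without homogeneity, is all that is used. -/
def IsHilbertian (Z : Type*) [NormedAddCommGroup Z] : Prop :=
  ∃ (ψ : Z → ℝ) (a b : ℝ), 0 < a ∧ (∀ x y, ψ (x + y) + ψ (x - y) = 2 * ψ x + 2 * ψ y) ∧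
    ∀ x, a * ‖x‖ ^ 2 ≤ ψ x ∧ ψ x ≤ b * ‖x‖ ^ 2

/-- There is a sequence `z` in `Z` whose images under `J n : Z → ℓ_r^{n+1}`, for almost all `n` with
respect to the ultrafilter, have an upper `r`-estimate and are almost biorthogonal to vectors `h i n`
with an upper `r'`-estimate. -/
def HasDisjointSystem {𝕜 : Type*} [RCLike 𝕜] {Z : Type*} [NormedAddCommGroup Z] [NormedSpace 𝕜 Z]
    (J : ∀ n : ℕ, Z →ₗ[𝕜] (Fin (n + 1) → 𝕜)) (r r' : ℝ) : Prop :=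
  ∃ (z : ℕ → Z) (h : ℕ → ∀ n : ℕ, Fin (n + 1) → 𝕜) (K : ℝ), 0 ≤ K ∧
    (∀ N (c : ℕ → 𝕜), ∀ᶠ n in (hyperfilter ℕ : Filter ℕ),
      ∑ t, ‖∑ i ∈ Finset.range N, c i * J n (z i) t‖ ^ r ≤
        K * ∑ i ∈ Finset.range N, ‖c i‖ ^ r) ∧
    (∀ N (c : ℕ → 𝕜), ∀ᶠ n in (hyperfilter ℕ : Filter ℕ),
      ∑ t, ‖∑ i ∈ Finset.range N, c i * h i n t‖ ^ r' ≤
        K * ∑ i ∈ Finset.range N, ‖c i‖ ^ r') ∧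
    ∀ i j, ∀ᶠ n in (hyperfilter ℕ : Filter ℕ),
      ‖∑ t, h i n t * J n (z j) t - if i = j then 1 else 0‖ ≤ (1 / 2) ^ i * (1 / 2) ^ j / 8

variable {𝕜 : Type*} [RCLike 𝕜] {Z : Type*} [NormedAddCommGroup Z] [NormedSpace 𝕜 Z]
  {J : ∀ n : ℕ, Z →ₗ[𝕜] (Fin (n + 1) → 𝕜)} {r C c : ℝ} {Φ : Z → ℝ}

theorem add_rpow_le_two_rpow_mul {r a b : ℝ} (hr : 0 ≤ r) (ha : 0 ≤ a) (hb : 0 ≤ b) :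
    (a + b) ^ r ≤ 2 ^ r * (a ^ r + b ^ r) := by
  have h : a + b ≤ 2 * max a b := by linarith [le_max_left a b, le_max_right a b]
  refine (Real.rpow_le_rpow (by positivity) h hr).trans ?_
  rw [Real.mul_rpow (by norm_num) (by positivity)]
  refine mul_le_mul_of_nonneg_left ?_ (by positivity)
  have h1 : 0 ≤ a ^ r := by positivity
  have h2 : 0 ≤ b ^ r := by positivity
  rcases max_cases a b with h | h <;> rw [h.1] <;> linarith

/-- The sum of the absolute values of the coordinates of the vectors in a list. -/
noncomputable def listWeight (J : ∀ n : ℕ, Z →ₗ[𝕜] (Fin (n + 1) → 𝕜)) (l : List Z) (n : ℕ)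
    (t : Fin (n + 1)) : ℝ := (l.map fun y => ‖J n y t‖).sum

theorem listWeight_nonneg (l : List Z) (n : ℕ) (t : Fin (n + 1)) : 0 ≤ listWeight J l n t := by
  refine List.sum_nonneg fun x hx => ?_
  obtain ⟨y, -, rfl⟩ := List.mem_map.1 hx
  exact norm_nonneg _

theorem listWeight_bounded (hr : 0 < r) (hC : ∀ n z, ∑ t, ‖J n z t‖ ^ r ≤ C * ‖z‖ ^ r)
    (l : List Z) : ∃ W, ∀ n, ∑ t, listWeight J l n t ^ r ≤ W := by
  induction l with
  | nil => exact ⟨0, fun n => by simp [listWeight, hr.ne']⟩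
  | cons y l ih =>
    obtain ⟨W, hW⟩ := ih
    refine ⟨2 ^ r * (C * ‖y‖ ^ r + W), fun n => ?_⟩
    have h1 : ∀ t ∈ Finset.univ, listWeight J (y :: l) n t ^ r ≤
        2 ^ r * (‖J n y t‖ ^ r + listWeight J l n t ^ r) := fun t _ => by
      simpa [listWeight] using add_rpow_le_two_rpow_mul hr.le (norm_nonneg (J n y t))
        (listWeight_nonneg l n t)
    refine (Finset.sum_le_sum h1).trans ?_
    rw [← Finset.mul_sum, Finset.sum_add_distrib]
    exact mul_le_mul_of_nonneg_left (add_le_add (hC n y) (hW n)) (by positivity)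

/-- The Kadec-Pełczyński dichotomy: unless `Z` is Hilbertian, it contains normalized vectors that
are almost disjoint from a given weight `w`. Otherwise the weighted `ℓ_2`-norm with density
`w ^ (r - 2)` would be equivalent to the given norm. -/
theorem exists_almost_disjoint (hr : 2 < r) (hC : ∀ n z, ∑ t, ‖J n z t‖ ^ r ≤ C * ‖z‖ ^ r)
    (hΦ : ∀ z, Tendsto (fun n => ∑ t, ‖J n z t‖ ^ r) (hyperfilter ℕ : Filter ℕ) (𝓝 (Φ z)))
    (hc : 0 < c) (hcΦ : ∀ z, c * ‖z‖ ^ r ≤ Φ z) (hZ : ¬ IsHilbertian Z)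
    (w : ∀ n : ℕ, Fin (n + 1) → ℝ) (hw : ∀ n t, 0 ≤ w n t) {W : ℝ}
    (hW : ∀ n, ∑ t, w n t ^ r ≤ W) {η : ℝ} (hη : 0 < η) :
    ∃ z, Φ z = 1 ∧ ∀ᶠ n in (hyperfilter ℕ : Filter ℕ), ∑ t, min ‖J n z t‖ (w n t) ^ r ≤ η := by
  by_contra! hcon
  refine hZ ?_
  have hr0 : 0 < r := by linarith
  have hΦC : ∀ z, Φ z ≤ C * ‖z‖ ^ r := fun z =>
    le_of_tendsto (hΦ z) (Eventually.of_forall fun n => hC n z)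
  have hW0 : 0 ≤ W := (Finset.sum_nonneg fun t _ => Real.rpow_nonneg (hw 0 t) _).trans (hW 0)
  -- the weighted `ℓ_2` norms; their limit `ψ` satisfies the parallelogram law
  let q : ℕ → Z → ℝ := fun n z => ∑ t, ‖J n z t‖ ^ 2 * w n t ^ (r - 2)
  have hq0 : ∀ n z, 0 ≤ q n z := fun n z => Finset.sum_nonneg fun t _ =>
    mul_nonneg (by positivity) (Real.rpow_nonneg (hw n t) _)
  have hpow : ∀ x : ℝ, 0 ≤ x → x ^ 2 * x ^ (r - 2) = x ^ r := fun x hx => by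
    rw [← Real.rpow_natCast, ← Real.rpow_add_of_nonneg hx (by positivity) (by linarith)]
    congr 1; push_cast; ring
  have hqle : ∀ n z, q n z ≤ ∑ t, ‖J n z t‖ ^ r + W := by
    intro n z
    refine le_trans ?_ (add_le_add le_rfl (hW n))
    rw [← Finset.sum_add_distrib]
    refine Finset.sum_le_sum fun t _ => ?_
    have h1 : 0 ≤ ‖J n z t‖ ^ r := by positivity
    have h2 : 0 ≤ w n t ^ r := Real.rpow_nonneg (hw n t) _
    have h3 : ‖J n z t‖ ^ 2 * w n t ^ (r - 2) ≤ max ‖J n z t‖ (w n t) ^ r := by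
      rw [← hpow _ (le_max_of_le_left (norm_nonneg _))]
      refine mul_le_mul (pow_le_pow_left₀ (norm_nonneg _) (le_max_left _ _) 2)
        (Real.rpow_le_rpow (hw n t) (le_max_right _ _) (by linarith))
        (Real.rpow_nonneg (hw n t) _) (by positivity)
    refine h3.trans ?_
    rcases max_cases ‖J n z t‖ (w n t) with h | h <;> rw [h.1] <;> linarith
  let ψ : Z → ℝ := fun z => ulim (hyperfilter ℕ) fun n => q n z
  have hψ : ∀ z, Tendsto (fun n => q n z) (hyperfilter ℕ : Filter ℕ) (𝓝 (ψ z)) := fun z => by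
    refine tendsto_ulim (C := C * ‖z‖ ^ r + W) (Eventually.of_forall fun n => ?_)
    rw [Real.norm_of_nonneg (hq0 n z)]
    linarith [hqle n z, hC n z]
  have hψsmul : ∀ (a : 𝕜) z, ψ (a • z) = ‖a‖ ^ 2 * ψ z := fun a z => by
    refine ulim_eq_of_tendsto (((hψ z).const_mul (‖a‖ ^ 2)).congr fun n => ?_)
    simp only [q, Finset.mul_sum, map_smul, Pi.smul_apply, smul_eq_mul, norm_mul]
    exact Finset.sum_congr rfl fun t _ => by ring
  have hΦsmul : ∀ (a : 𝕜) z, Φ (a • z) = ‖a‖ ^ r * Φ z := fun a z => by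
    refine tendsto_nhds_unique (hΦ (a • z)) (((hΦ z).const_mul (‖a‖ ^ r)).congr fun n => ?_)
    simp only [Finset.mul_sum, map_smul, Pi.smul_apply, smul_eq_mul, norm_mul]
    exact Finset.sum_congr rfl fun t _ => (Real.mul_rpow (norm_nonneg _) (norm_nonneg _)).symm
  -- bounds on the unit sphere of `Φ`
  have hlow : ∀ z, Φ z = 1 → η ≤ ψ z := by
    intro z hz
    refine ge_of_tendsto (hψ z) ?_
    filter_upwards [hcon z hz] with n hn
    refine hn.le.trans (Finset.sum_le_sum fun t _ => ?_)
    have h2 : 0 ≤ min ‖J n z t‖ (w n t) := le_min (norm_nonneg _) (hw n t)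
    rw [← hpow _ h2]
    exact mul_le_mul (pow_le_pow_left₀ h2 (min_le_left _ _) 2)
      (Real.rpow_le_rpow h2 (min_le_right _ _) (by linarith)) (Real.rpow_nonneg h2 _)
      (by positivity)
  have hupp : ∀ z, Φ z = 1 → ψ z ≤ 1 + W := by
    intro z hz
    refine le_of_tendsto_of_tendsto' (hψ z) ?_ (hqle · z)
    rw [← hz]
    exact (hΦ z).add_const W
  have hC0 : 0 ≤ |C| := abs_nonneg C
  refine ⟨ψ, η * c ^ (2 / r), (1 + W) * |C| ^ (2 / r), by positivity, fun x y => ?_, fun z => ?_⟩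
  · refine tendsto_nhds_unique ((hψ (x + y)).add (hψ (x - y)))
      ((((hψ x).const_mul 2).add ((hψ y).const_mul 2)).congr fun n => ?_)
    simp only [q, Finset.mul_sum, ← Finset.sum_add_distrib, map_add, map_sub, Pi.add_apply,
      Pi.sub_apply]
    refine Finset.sum_congr rfl fun t _ => ?_
    have := parallelogram_law_with_norm 𝕜 (J n x t) (J n y t)
    linear_combination (-(w n t ^ (r - 2))) * this
  · by_cases hz : z = 0
    · subst hz
      have h0 : ψ 0 = 0 := by simpa using hψsmul 0 0
      simp [h0]
    have hzpos : 0 < ‖z‖ := norm_pos_iff.2 hz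
    have hΦpos : 0 < Φ z := lt_of_lt_of_le (by positivity) (hcΦ z)
    let a : ℝ := Φ z ^ (-(1 / r))
    have ha : 0 < a := by positivity
    have han : ‖(a : 𝕜)‖ = a := by rw [RCLike.norm_ofReal, abs_of_pos ha]
    have h1 : Φ ((a : 𝕜) • z) = 1 := by
      rw [hΦsmul, han, ← Real.rpow_mul hΦpos.le, neg_mul, one_div_mul_cancel hr0.ne',
        Real.rpow_neg_one, inv_mul_cancel₀ hΦpos.ne']
    have h2 : ψ z = Φ z ^ (2 / r) * ψ ((a : 𝕜) • z) := by
      rw [hψsmul, han, ← mul_assoc, ← Real.rpow_natCast a, ← Real.rpow_mul hΦpos.le,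
        ← Real.rpow_add hΦpos]
      have : 2 / r + -(1 / r) * ((2 : ℕ) : ℝ) = 0 := by push_cast; ring
      rw [this, Real.rpow_zero, one_mul]
    have h3 : ∀ b : ℝ, 0 ≤ b → (b * ‖z‖ ^ r) ^ (2 / r) = b ^ (2 / r) * ‖z‖ ^ 2 := by
      intro b hb
      rw [Real.mul_rpow hb (by positivity), ← Real.rpow_mul (norm_nonneg _),
        mul_div_cancel₀ _ hr0.ne', ← Real.rpow_natCast ‖z‖]
      norm_num
    have h4 : c ^ (2 / r) * ‖z‖ ^ 2 ≤ Φ z ^ (2 / r) := by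
      rw [← h3 c hc.le]
      exact Real.rpow_le_rpow (by positivity) (hcΦ z) (by positivity)
    have h5 : Φ z ^ (2 / r) ≤ |C| ^ (2 / r) * ‖z‖ ^ 2 := by
      rw [← h3 _ hC0]
      refine Real.rpow_le_rpow hΦpos.le ((hΦC z).trans ?_) (by positivity)
      exact mul_le_mul_of_nonneg_right (le_abs_self C) (by positivity)
    have h6 := hlow _ h1
    have h7 := hupp _ h1
    rw [h2]
    have h8 : 0 ≤ Φ z ^ (2 / r) := by positivity
    constructor
    · calc η * c ^ (2 / r) * ‖z‖ ^ 2 = (c ^ (2 / r) * ‖z‖ ^ 2) * η := by ring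
        _ ≤ Φ z ^ (2 / r) * ψ ((a : 𝕜) • z) := mul_le_mul h4 h6 hη.le h8
    · calc Φ z ^ (2 / r) * ψ ((a : 𝕜) • z) ≤ (|C| ^ (2 / r) * ‖z‖ ^ 2) * (1 + W) :=
            mul_le_mul h5 h7 (hη.le.trans h6) (by positivity)
        _ = _ := by ring

/-- Iterating the dichotomy, with the sum of the absolute values of the vectors chosen so far as
weight. -/
theorem exists_almost_disjoint_seq (hr : 2 < r)
    (hC : ∀ n z, ∑ t, ‖J n z t‖ ^ r ≤ C * ‖z‖ ^ r)
    (hΦ : ∀ z, Tendsto (fun n => ∑ t, ‖J n z t‖ ^ r) (hyperfilter ℕ : Filter ℕ) (𝓝 (Φ z)))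
    (hc : 0 < c) (hcΦ : ∀ z, c * ‖z‖ ^ r ≤ Φ z) (hZ : ¬ IsHilbertian Z)
    (η : ℕ → ℝ) (hη : ∀ i, 0 < η i) :
    ∃ z : ℕ → Z, (∀ i, Φ (z i) = 1) ∧ ∀ i, ∀ᶠ n in (hyperfilter ℕ : Filter ℕ),
      ∑ t, min ‖J n (z i) t‖ (∑ l ∈ Finset.range i, ‖J n (z l) t‖) ^ r ≤ η i := by
  have hstep : ∀ (l : List Z) (i : ℕ), ∃ z, Φ z = 1 ∧ ∀ᶠ n in (hyperfilter ℕ : Filter ℕ),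
      ∑ t, min ‖J n z t‖ (listWeight J l n t) ^ r ≤ η i := fun l i => by
    obtain ⟨W, hW⟩ := listWeight_bounded (by linarith) hC l
    exact exists_almost_disjoint hr hC hΦ hc hcΦ hZ _ (listWeight_nonneg l) hW (hη i)
  choose step hstep1 hstep2 using hstep
  let L : ℕ → List Z := fun i => Nat.rec [] (fun i l => step l i :: l) i
  have hL : ∀ i n t, listWeight J (L i) n t = ∑ l ∈ Finset.range i, ‖J n (step (L l) l) t‖ := by
    intro i n t
    induction i with
    | zero => rfl
    | succ i ih =>
      rw [Finset.sum_range_succ, ← ih, add_comm (listWeight J (L i) n t)]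
      rfl
  refine ⟨fun i => step (L i) i, fun i => hstep1 _ _, fun i => ?_⟩
  filter_upwards [hstep2 (L i) i] with n hn
  simpa only [hL] using hn

/-- In a space that is not Hilbertian, almost disjoint vectors together with their norming vectors
form a disjoint system. -/
theorem hasDisjointSystem_of_not_isHilbertian {r' : ℝ} (hrr' : r.HolderConjugate r') (hr : 2 < r)
    (hC : ∀ n z, ∑ t, ‖J n z t‖ ^ r ≤ C * ‖z‖ ^ r)
    (hΦ : ∀ z, Tendsto (fun n => ∑ t, ‖J n z t‖ ^ r) (hyperfilter ℕ : Filter ℕ) (𝓝 (Φ z)))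
    (hc : 0 < c) (hcΦ : ∀ z, c * ‖z‖ ^ r ≤ Φ z) (hZ : ¬ IsHilbertian Z) :
    HasDisjointSystem J r r' := by
  have hr0 : 0 < r := by linarith
  have hr1 : 1 < r := by linarith
  have hr'1 : 1 < r' := hrr'.symm.lt
  have hr'0 : 0 < r' := by linarith
  have hr'r : r' ≤ r := by
    have h1 := hrr'.sub_one_mul_conj
    nlinarith
  -- the overlaps `θ k` with `k = max i j` have to stay below `(1 / 2) ^ i * (1 / 2) ^ j / 32`
  let θ : ℕ → ℝ := fun i => (1 / 4) ^ i / 32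
  have hθ : ∀ i, 0 < θ i := fun i => by positivity
  have hθ1 : ∀ i, θ i ≤ 1 := fun i => by
    have : ((1 : ℝ) / 4) ^ i ≤ 1 := pow_le_one₀ (by norm_num) (by norm_num)
    simp only [θ]; linarith
  have hθs : ∀ N, ∑ i ∈ Finset.range N, θ i ≤ 1 := fun N => by
    have h1 : ∀ i ∈ Finset.range N, θ i ≤ (1 / 2) ^ i / 2 := fun i _ => by
      have : ((1 : ℝ) / 4) ^ i ≤ (1 / 2) ^ i := pow_le_pow_left₀ (by norm_num) (by norm_num) i
      have h0 : (0 : ℝ) ≤ (1 / 4) ^ i := by positivity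
      simp only [θ]; linarith
    refine (Finset.sum_le_sum h1).trans ?_
    exact sum_le_hasSum _ (fun i _ => by positivity) (by simpa using hasSum_geometric_two.div_const 2)
  obtain ⟨z, hz1, hz2⟩ := exists_almost_disjoint_seq hr hC hΦ hc hcΦ hZ (fun i => θ i ^ r)
    fun i => Real.rpow_pos_of_pos (hθ i) _
  have hnorm : ∀ i, ∀ᶠ n in (hyperfilter ℕ : Filter ℕ), ∑ t, ‖J n (z i) t‖ ^ r ≤ 2 := fun i => by
    have := hΦ (z i)
    rw [hz1 i] at this
    exact this.eventually_le_const (by norm_num)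
  have hgood : ∀ N, ∀ᶠ n in (hyperfilter ℕ : Filter ℕ), ∀ i < N, ∑ t, ‖J n (z i) t‖ ^ r ≤ 2 ∧
      ∑ t, min ‖J n (z i) t‖ (∑ l ∈ Finset.range i, ‖J n (z l) t‖) ^ r ≤ θ i ^ r := fun N => by
    have := (Filter.eventually_all_finset (l := (hyperfilter ℕ : Filter ℕ)) (Finset.range N)).2
      fun i _ => (hnorm i).and (hz2 i)
    filter_upwards [this] with n hn i hi
    exact hn i (Finset.mem_range.2 hi)
  refine ⟨z, fun i n t => dualCoord r (J n (z i) t), 3 ^ r, by positivity, ?_, ?_, ?_⟩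
  · intro N c
    filter_upwards [hgood N] with n hn
    refine le_trans (Finset.sum_le_sum fun t _ => ?_) (sum_rpow_le_of_almost_disjoint hr1.le
      (fun i t => ‖J n (z i) t‖) (fun i t => norm_nonneg _) (fun i => ‖c i‖)
      (fun i => norm_nonneg _) θ (fun i => (hθ i).le) N (hθs N) (fun i hi => (hn i hi).1)
      fun i hi => (hn i hi).2)
    refine Real.rpow_le_rpow (norm_nonneg _) ((norm_sum_le _ _).trans (le_of_eq ?_)) hr0.le
    simp only [norm_mul]
  · intro N c
    filter_upwards [hgood N] with n hn
    -- the norming vectors have absolute values `|J n (z i)| ^ (r - 1)`, which are almost disjoint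
    -- in `ℓ_{r'}`
    have hconj : ∀ x : ℝ, 0 ≤ x → (x ^ (r - 1)) ^ r' = x ^ r := fun x hx => by
      rw [← Real.rpow_mul hx, hrr'.sub_one_mul_conj]
    have key := sum_rpow_le_of_almost_disjoint hr'1.le
      (fun i t => ‖J n (z i) t‖ ^ (r - 1)) (fun i t => by positivity) (fun i => ‖c i‖)
      (fun i => norm_nonneg _) θ (fun i => (hθ i).le) N (hθs N)
      (fun i hi => by simpa only [hconj _ (norm_nonneg _)] using (hn i hi).1)
      fun i hi => by
        refine le_trans (Finset.sum_le_sum fun t _ => ?_) ((hn i hi).2.trans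
          (Real.rpow_le_rpow_of_exponent_ge (hθ i) (hθ1 i) hr'r))
        have hσ : 0 ≤ ∑ l ∈ Finset.range i, ‖J n (z l) t‖ :=
          Finset.sum_nonneg fun l _ => norm_nonneg _
        have hσ' : 0 ≤ ∑ l ∈ Finset.range i, ‖J n (z l) t‖ ^ (r - 1) :=
          Finset.sum_nonneg fun l _ => by positivity
        rw [← hconj _ (le_min (norm_nonneg _) hσ)]
        refine Real.rpow_le_rpow (le_min (by positivity) hσ') ?_ hr'0.le
        have h1 := sum_rpow_le_rpow_sum (show 1 ≤ r - 1 by linarith) (fun l => ‖J n (z l) t‖)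
          (fun l => norm_nonneg _) i
        rcases le_total ‖J n (z i) t‖ (∑ l ∈ Finset.range i, ‖J n (z l) t‖) with h | h
        · rw [min_eq_left h]; exact min_le_left _ _
        · rw [min_eq_right h]; exact (min_le_right _ _).trans h1
    refine le_trans (Finset.sum_le_sum fun t _ => ?_) (key.trans ?_)
    · refine Real.rpow_le_rpow (norm_nonneg _) ((norm_sum_le _ _).trans (le_of_eq ?_)) hr'0.le
      simp only [norm_mul, norm_dualCoord hr1]
    · refine mul_le_mul_of_nonneg_right ?_ (Finset.sum_nonneg fun i _ => by positivity)
      exact Real.rpow_le_rpow_of_exponent_le (by norm_num) hr'r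
  · intro i j
    by_cases hij : i = j
    · subst hij
      have h1 : Tendsto (fun n => ((∑ t, ‖J n (z i) t‖ ^ r : ℝ) : 𝕜)) (hyperfilter ℕ : Filter ℕ)
          (𝓝 ((1 : ℝ) : 𝕜)) := by
        have := hΦ (z i)
        rw [hz1 i] at this
        exact (RCLike.continuous_ofReal.tendsto _).comp this
      have h2 := Metric.tendsto_nhds.1 h1 ((1 / 2) ^ i * (1 / 2) ^ i / 8) (by positivity)
      filter_upwards [h2] with n hn
      rw [dist_eq_norm] at hn
      simp only [dualCoord_mul hr1, if_true]
      push_cast at hn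
      exact hn.le
    · let k := max i j
      filter_upwards [hgood (k + 1)] with n hn
      have hik : i < k + 1 := Nat.lt_succ_of_le (le_max_left _ _)
      have hjk : j < k + 1 := Nat.lt_succ_of_le (le_max_right _ _)
      set m : Fin (n + 1) → ℝ := fun t => min ‖J n (z i) t‖ ‖J n (z j) t‖ with hm
      have hm0 : ∀ t, 0 ≤ m t := fun t => le_min (norm_nonneg _) (norm_nonneg _)
      have hmk : ∑ t, m t ^ r ≤ θ k ^ r := by
        refine le_trans (Finset.sum_le_sum fun t _ => ?_) (hn k (Nat.lt_succ_self k)).2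
        refine Real.rpow_le_rpow (hm0 t) (le_min ?_ ?_) hr0.le
        · rcases max_choice i j with h | h
          · rw [show k = i from h]; exact min_le_left _ _
          · rw [show k = j from h]; exact min_le_right _ _
        · rcases lt_or_gt_of_ne hij with h | h
          · exact (min_le_left _ _).trans (Finset.single_le_sum (f := fun l => ‖J n (z l) t‖)
              (fun l _ => norm_nonneg _) (Finset.mem_range.2 (lt_max_of_lt_right h)))
          · exact (min_le_right _ _).trans (Finset.single_le_sum (f := fun l => ‖J n (z l) t‖)
              (fun l _ => norm_nonneg _) (Finset.mem_range.2 (lt_max_of_lt_left h)))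
      have hhold : ∀ l < k + 1, ∑ t, m t * ‖J n (z l) t‖ ^ (r - 1) ≤ 2 * θ k := by
        intro l hl
        have h1 := Real.inner_le_Lp_mul_Lq_of_nonneg Finset.univ hrr' (f := m)
          (g := fun t => ‖J n (z l) t‖ ^ (r - 1)) (fun t _ => hm0 t) fun t _ => by positivity
        have h2 : ∀ t, (‖J n (z l) t‖ ^ (r - 1)) ^ r' = ‖J n (z l) t‖ ^ r := fun t => by
          rw [← Real.rpow_mul (norm_nonneg _), hrr'.sub_one_mul_conj]
        simp only [h2] at h1
        refine h1.trans ?_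
        have h3 : (∑ t, m t ^ r) ^ (1 / r) ≤ θ k := by
          refine (Real.rpow_le_rpow (Finset.sum_nonneg fun t _ => Real.rpow_nonneg (hm0 t) _)
            hmk (by positivity)).trans_eq ?_
          rw [← Real.rpow_mul (hθ k).le, mul_one_div_cancel hr0.ne', Real.rpow_one]
        have h4 : (∑ t, ‖J n (z l) t‖ ^ r) ^ (1 / r') ≤ 2 := by
          refine (Real.rpow_le_rpow (Finset.sum_nonneg fun t _ => by positivity) (hn l hl).1
            (by positivity)).trans ?_
          refine (Real.rpow_le_rpow_of_exponent_le (by norm_num) ?_).trans_eq (Real.rpow_one 2)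
          rw [div_le_one hr'0]; exact hr'1.le
        have h5 : 0 ≤ (∑ t, ‖J n (z l) t‖ ^ r) ^ (1 / r') :=
          Real.rpow_nonneg (Finset.sum_nonneg fun t _ => by positivity) _
        refine (mul_le_mul h3 h4 h5 (hθ k).le).trans_eq (mul_comm _ _)
      rw [if_neg hij, sub_zero]
      refine (norm_sum_le _ _).trans ?_
      have h6 : ∀ t ∈ Finset.univ, ‖dualCoord r (J n (z i) t) * J n (z j) t‖ ≤
          m t * ‖J n (z i) t‖ ^ (r - 1) + m t * ‖J n (z j) t‖ ^ (r - 1) := fun t _ => by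
        rw [norm_mul, norm_dualCoord hr1]
        exact rpow_sub_one_mul_le hr.le (norm_nonneg _) (norm_nonneg _)
      refine (Finset.sum_le_sum h6).trans ?_
      rw [Finset.sum_add_distrib]
      have h7 : (4 : ℝ) * θ k ≤ (1 / 2) ^ i * (1 / 2) ^ j / 8 := by
        have h8 : ((1 : ℝ) / 4) ^ k = (1 / 2) ^ k * (1 / 2) ^ k := by
          rw [← mul_pow]; norm_num
        have h9 : ((1 : ℝ) / 2) ^ k ≤ (1 / 2) ^ i :=
          pow_le_pow_of_le_one (by norm_num) (by norm_num) (le_max_left _ _)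
        have h10 : ((1 : ℝ) / 2) ^ k ≤ (1 / 2) ^ j :=
          pow_le_pow_of_le_one (by norm_num) (by norm_num) (le_max_right _ _)
        have h11 := mul_le_mul h9 h10 (by positivity) (by positivity)
        simp only [θ]
        rw [h8]
        linarith
      linarith [hhold i hik, hhold j hjk]

end Disjoint

/-! ### From disjoint systems to complemented copies of `ℓ_p` -/

namespace LpApprox

variable {𝕜 : Type*} [RCLike 𝕜] {p : ℝ≥0∞} [Fact (1 ≤ p)] {X : Type*}
  [NormedAddCommGroup X] [NormedSpace 𝕜 X] (S : LpApprox 𝕜 p X)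

/-- The coordinates of `J n x`. -/
noncomputable def coord (n : ℕ) : X →ₗ[𝕜] (Fin (n + 1) → 𝕜) :=
  (WithLp.linearEquiv p 𝕜 (Fin (n + 1) → 𝕜)).toLinearMap ∘ₗ (S.J n).toLinearMap

theorem sum_norm_coord (hp : p ≠ ∞) (n : ℕ) (x : X) :
    ∑ t, ‖S.coord n x t‖ ^ p.toReal = ‖S.J n x‖ ^ p.toReal := (EllFin.norm_rpow hp _).symm

theorem sum_norm_coord_le (hp : p ≠ ∞) (n : ℕ) (x : X) :
    ∑ t, ‖S.coord n x t‖ ^ p.toReal ≤ (S.K * ‖x‖) ^ p.toReal := by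
  rw [S.sum_norm_coord hp]
  exact Real.rpow_le_rpow (norm_nonneg _) (S.norm_J_apply_le n x) ENNReal.toReal_nonneg

/-- The coordinates of the functional `f ∘ Q n` on `ℓ_p^{n+1}`. -/
noncomputable def dualCoords (n : ℕ) : (X →L[𝕜] 𝕜) →ₗ[𝕜] (Fin (n + 1) → 𝕜) where
  toFun f t := f (S.Q n (WithLp.toLp p (Pi.single t 1)))
  map_add' f g := by ext t; simp
  map_smul' c f := by ext t; simp

theorem apply_Q (n : ℕ) (f : X →L[𝕜] 𝕜) (y : EllFin 𝕜 p (n + 1)) :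
    f (S.Q n y) = ∑ t, y t * S.dualCoords n f t := by
  have hy : y = ∑ t, y t • (WithLp.toLp p (Pi.single t 1) : EllFin 𝕜 p (n + 1)) := by
    ext j
    simp [Pi.single_apply]
  conv_lhs => rw [hy]
  simp [dualCoords]

theorem sum_norm_dualCoords_le (hp : p ≠ ∞) {r : ℝ} (hr : p.toReal.HolderConjugate r) (n : ℕ)
    (f : X →L[𝕜] 𝕜) : ∑ t, ‖S.dualCoords n f t‖ ^ r ≤ (S.K * ‖f‖) ^ r := by
  refine sum_rpow_le_of_forall_pairing Finset.univ hr.symm _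
    (mul_nonneg S.K_pos.le (norm_nonneg _)) fun c => ?_
  have h := S.apply_Q n f (WithLp.toLp p c)
  simp only at h
  rw [← h]
  have h1 : ‖(WithLp.toLp p c : EllFin 𝕜 p (n + 1))‖ =
      (∑ t, ‖c t‖ ^ p.toReal) ^ (1 / p.toReal) :=
    PiLp.norm_eq_sum (toReal_pos_of_fact p hp) _
  rw [← h1]
  refine (f.le_opNorm _).trans ?_
  have := mul_le_mul_of_nonneg_left (S.norm_Q_apply_le n (WithLp.toLp p c)) (norm_nonneg f)
  linarith

/-- The limit of the dual norms of the coordinates of `f` controls the norm of `f`. -/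
theorem norm_le_of_sum_dualCoords (hp : p ≠ ∞) {r : ℝ} (hr : p.toReal.HolderConjugate r)
    (f : X →L[𝕜] 𝕜) {B : ℝ}
    (h : ∀ᶠ n in (hyperfilter ℕ : Filter ℕ), ∑ t, ‖S.dualCoords n f t‖ ^ r ≤ B) (x : X) :
    ‖f x‖ ≤ S.K * ‖x‖ * B ^ (1 / r) := by
  have h1 := ((f.continuous.tendsto x).comp (S.tendsto_hyperfilter x)).norm
  refine le_of_tendsto h1 ?_
  filter_upwards [h] with n hn
  simp only [Function.comp_apply]
  rw [S.apply_Q]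
  have h2 := norm_sum_mul_le_of_sum_le Finset.univ hr.symm (fun t => S.J n x t)
    (fun t => S.dualCoords n f t) (S.sum_norm_coord_le hp n x) hn
  refine h2.trans (le_of_eq ?_)
  rw [← Real.rpow_mul (mul_nonneg S.K_pos.le (norm_nonneg _)),
    mul_one_div_cancel hr.pos.ne', Real.rpow_one]

/-- A family of functionals on `ℓ_p^{n+1}`, bounded in the dual norm, induces a functional on `X`. -/
theorem exists_functional (hp : p ≠ ∞) {r : ℝ} (hr : p.toReal.HolderConjugate r)
    (g : ∀ n : ℕ, Fin (n + 1) → 𝕜) {B : ℝ}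
    (hg : ∀ᶠ n in (hyperfilter ℕ : Filter ℕ), ∑ t, ‖g n t‖ ^ r ≤ B) :
    ∃ f : X →L[𝕜] 𝕜, ∀ x, Tendsto (fun n => ∑ t, g n t * S.coord n x t)
      (hyperfilter ℕ : Filter ℕ) (𝓝 (f x)) := by
  have hb : ∀ x, ∀ᶠ n in (hyperfilter ℕ : Filter ℕ),
      ‖∑ t, g n t * S.coord n x t‖ ≤ B ^ (1 / r) * S.K * ‖x‖ := fun x => by
    filter_upwards [hg] with n hn
    refine (norm_sum_mul_le_of_sum_le Finset.univ hr _ _ hn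
      (S.sum_norm_coord_le hp n x)).trans (le_of_eq ?_)
    rw [← Real.rpow_mul (mul_nonneg S.K_pos.le (norm_nonneg _)),
      mul_one_div_cancel hr.pos.ne', Real.rpow_one, mul_assoc]
  have hlim := fun x => tendsto_ulim (hb x)
  exact ⟨LinearMap.mkContinuous
    { toFun := fun x => ulim (hyperfilter ℕ) fun n => ∑ t, g n t * S.coord n x t
      map_add' := fun x y => by
        refine ulim_eq_of_tendsto (((hlim x).add (hlim y)).congr fun n => ?_)
        simp only [map_add, Pi.add_apply, mul_add, Finset.sum_add_distrib]
      map_smul' := fun c x => by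
        refine ulim_eq_of_tendsto (((hlim x).const_mul c).congr fun n => ?_)
        simp only [map_smul, Pi.smul_apply, smul_eq_mul, Finset.mul_sum]
        exact Finset.sum_congr rfl fun t _ => by ring } (B ^ (1 / r) * S.K) fun x =>
        le_of_tendsto (hlim x).norm (hb x), hlim⟩

theorem sum_single_rpow {r : ℝ} (hr : 0 < r) (i : ℕ) :
    ∑ l ∈ Finset.range (i + 1), ‖(Pi.single i 1 : ℕ → 𝕜) l‖ ^ r = 1 := by
  rw [Finset.sum_eq_single i]
  · simp
  · intro l _ hl; simp [hl, hr.ne']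
  · simp

theorem sum_single_mul (i : ℕ) (a : ℕ → 𝕜) :
    ∑ l ∈ Finset.range (i + 1), (Pi.single i 1 : ℕ → 𝕜) l * a l = a i := by
  rw [Finset.sum_eq_single i]
  · simp
  · intro l _ hl; simp [hl]
  · simp

/-- The scalar bound behind the two transfer theorems below. -/
theorem rpow_mul_rpow_le {P r K B σ : ℝ} (hP : P.HolderConjugate r) (hK : 0 ≤ K) (hB : 0 ≤ B)
    (hσ : 0 ≤ σ) : (B * (K * σ) ^ (1 / P)) ^ P ≤ (B * (K ^ (1 / P) + K ^ (1 / r))) ^ P * σ := by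
  have h1 : 0 ≤ K ^ (1 / P) := by positivity
  have h2 : 0 ≤ K ^ (1 / r) := by positivity
  rw [Real.mul_rpow hK hσ, ← mul_assoc, Real.mul_rpow (by positivity) (by positivity),
    ← Real.rpow_mul hσ, one_div_mul_cancel hP.pos.ne', Real.rpow_one]
  refine mul_le_mul_of_nonneg_right (Real.rpow_le_rpow (by positivity) ?_ hP.pos.le) hσ
  exact mul_le_mul_of_nonneg_left (by linarith) hB

/-- A disjoint system in `X` itself gives a complemented copy of `ℓ_p` in `X`. -/
theorem factors_ell_of_hasDisjointSystem [CompleteSpace X] (hp : p ≠ ∞) {r : ℝ}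
    (hr : p.toReal.HolderConjugate r) (h : HasDisjointSystem S.coord p.toReal r) :
    Factors 𝕜 (Ell 𝕜 p) X := by
  obtain ⟨z, h, K, hK, h1, h2, h3⟩ := h
  have hP := hr.pos
  have hK1 : 0 ≤ K ^ (1 / p.toReal) := by positivity
  have hK2 : 0 ≤ K ^ (1 / r) := by positivity
  have hS := S.K_pos
  have hh : ∀ i, ∀ᶠ n in (hyperfilter ℕ : Filter ℕ), ∑ t, ‖h i n t‖ ^ r ≤ K := fun i => by
    filter_upwards [h2 (i + 1) (Pi.single i 1)] with n hn
    rw [sum_single_rpow hr.symm.pos] at hn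
    simpa only [sum_single_mul (𝕜 := 𝕜) i fun l => h l n _, mul_one] using hn
  choose f hf using fun i => S.exists_functional hp hr (h i) (hh i)
  refine factors_ell_of_system hp z f (C := S.K * (K ^ (1 / p.toReal) + K ^ (1 / r)))
    (by positivity) (fun N c => ?_) (fun N y => ?_) fun i j => ?_
  · set σ := ∑ i ∈ Finset.range N, ‖c i‖ ^ p.toReal
    have hσ : 0 ≤ σ := Finset.sum_nonneg fun i _ => by positivity
    refine le_trans ?_ (rpow_mul_rpow_le hr hK hS.le hσ)
    rw [Real.mul_rpow hS.le (by positivity), ← Real.rpow_mul (by positivity),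
      one_div_mul_cancel hP.ne', Real.rpow_one]
    refine (S.norm_rpow_le_gauge _).trans (mul_le_mul_of_nonneg_left ?_ (by positivity))
    refine le_of_tendsto (S.tendsto_gauge _) ?_
    filter_upwards [h1 N c] with n hn
    rw [← S.sum_norm_coord hp]
    simpa only [map_sum, map_smul, Finset.sum_apply, Pi.smul_apply, smul_eq_mul] using hn
  · have h4 : ∑ i ∈ Finset.range N, ‖f i y‖ ^ p.toReal ≤
        (K ^ (1 / r) * (S.K * ‖y‖)) ^ p.toReal := by
      refine sum_rpow_le_of_forall_pairing _ hr _ (by positivity) fun c => ?_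
      have h5 : Tendsto (fun n => ∑ t, (∑ i ∈ Finset.range N, c i * h i n t) * S.coord n y t)
          (hyperfilter ℕ : Filter ℕ) (𝓝 (∑ i ∈ Finset.range N, c i * f i y)) := by
        refine (tendsto_finsetSum _ fun i _ => (hf i y).const_mul (c i)).congr fun n => ?_
        simp only [Finset.mul_sum, Finset.sum_mul]
        rw [Finset.sum_comm]
        exact Finset.sum_congr rfl fun t _ => Finset.sum_congr rfl fun i _ => by ring
      refine le_of_tendsto h5.norm ?_
      filter_upwards [h2 N c] with n hn
      refine (norm_sum_mul_le_of_sum_le Finset.univ hr _ _ hn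
        (S.sum_norm_coord_le hp n y)).trans (le_of_eq ?_)
      rw [← Real.rpow_mul (by positivity), mul_one_div_cancel hP.ne', Real.rpow_one,
        Real.mul_rpow hK (Finset.sum_nonneg fun i _ => by positivity)]
      ring
    refine h4.trans (Real.rpow_le_rpow (by positivity) ?_ hP.le)
    have : 0 ≤ K ^ (1 / p.toReal) * (S.K * ‖y‖) := by positivity
    linarith
  · refine le_of_tendsto ((hf i (z j)).sub_const (if i = j then (1 : 𝕜) else 0)).norm ?_
    filter_upwards [h3 i j] with n hn using hn

theorem _root_.HasWeakLimits.of_eventually {ι Y : Type*} [NormedAddCommGroup Y] [NormedSpace 𝕜 Y]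
    {U : Ultrafilter ι} (hY : HasWeakLimits 𝕜 U Y) (y : ι → Y) {M : ℝ}
    (hM : ∀ᶠ i in (U : Filter ι), ‖y i‖ ≤ M) :
    ∃ z, ∀ f : Y →L[𝕜] 𝕜, Tendsto (fun i => f (y i)) U (𝓝 (f z)) := by
  classical
  obtain ⟨z, hz⟩ := hY (fun i => if ‖y i‖ ≤ M then y i else 0) |M| fun i => by
    by_cases h : ‖y i‖ ≤ M
    · simpa [h] using h.trans (le_abs_self M)
    · simp [h]
  refine ⟨z, fun f => (hz f).congr' ?_⟩
  filter_upwards [hM] with i hi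
  simp [hi]

/-- A disjoint system in the dual of `X` gives a complemented copy of `ℓ_p` in `X`; the biorthogonal
vectors in `X` are obtained as weak limits. -/
theorem factors_ell_of_hasDisjointSystem_dual [CompleteSpace X] (hp : p ≠ ∞) {r : ℝ}
    (hr : p.toReal.HolderConjugate r) (hX : HasWeakLimits 𝕜 (hyperfilter ℕ) X)
    (h : HasDisjointSystem S.dualCoords r p.toReal) : Factors 𝕜 (Ell 𝕜 p) X := by
  obtain ⟨g, h, K, hK, h1, h2, h3⟩ := h
  have hP := hr.pos
  have hK1 : 0 ≤ K ^ (1 / p.toReal) := by positivity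
  have hK2 : 0 ≤ K ^ (1 / r) := by positivity
  have hS := S.K_pos
  have hcomb : ∀ N (c : ℕ → 𝕜), ∀ᶠ n in (hyperfilter ℕ : Filter ℕ),
      ‖∑ i ∈ Finset.range N, c i • S.Q n (WithLp.toLp p (h i n))‖ ≤
        S.K * (K * ∑ i ∈ Finset.range N, ‖c i‖ ^ p.toReal) ^ (1 / p.toReal) := fun N c => by
    filter_upwards [h2 N c] with n hn
    have h4 : ∑ i ∈ Finset.range N, c i • S.Q n (WithLp.toLp p (h i n)) =
        S.Q n (∑ i ∈ Finset.range N, c i • WithLp.toLp p (h i n)) := by simp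
    rw [h4]
    refine (S.norm_Q_apply_le n _).trans (mul_le_mul_of_nonneg_left ?_ hS.le)
    refine EllFin.norm_le_of_sum_le hp (Real.rpow_nonneg (mul_nonneg hK
      (Finset.sum_nonneg fun i _ => by positivity)) _) ?_
    rw [← Real.rpow_mul (mul_nonneg hK (Finset.sum_nonneg fun i _ => by positivity)),
      one_div_mul_cancel hP.ne', Real.rpow_one]
    simpa using hn
  have hh : ∀ i, ∀ᶠ n in (hyperfilter ℕ : Filter ℕ),
      ‖S.Q n (WithLp.toLp p (h i n))‖ ≤ S.K * K ^ (1 / p.toReal) := fun i => by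
    filter_upwards [hcomb (i + 1) (Pi.single i 1)] with n hn
    rw [sum_single_rpow hP, mul_one, Finset.sum_eq_single i (fun l _ hl => by
      simp [hl]) (by simp)] at hn
    simpa using hn
  choose x hx using fun i => hX.of_eventually (fun n => S.Q n (WithLp.toLp p (h i n))) (hh i)
  refine factors_ell_of_system hp x g (C := S.K * (K ^ (1 / p.toReal) + K ^ (1 / r)))
    (by positivity) (fun N c => ?_) (fun N y => ?_) fun i j => ?_
  · set σ := ∑ i ∈ Finset.range N, ‖c i‖ ^ p.toReal with hσdef
    have hσ : 0 ≤ σ := Finset.sum_nonneg fun i _ => by positivity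
    refine le_trans (Real.rpow_le_rpow (norm_nonneg _) ?_ hP.le) (rpow_mul_rpow_le hr hK hS.le hσ)
    refine norm_le_of_weak_tendsto (𝕜 := 𝕜) (hcomb N c) fun f => ?_
    simp only [map_sum, map_smul]
    exact tendsto_finsetSum _ fun i _ => (hx i f).const_smul (c i)
  · have h4 : ∑ i ∈ Finset.range N, ‖g i y‖ ^ p.toReal ≤
        (K ^ (1 / r) * (S.K * ‖y‖)) ^ p.toReal := by
      refine sum_rpow_le_of_forall_pairing _ hr _ (by positivity) fun c => ?_
      have h5 := S.norm_le_of_sum_dualCoords hp hr (∑ i ∈ Finset.range N, c i • g i)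
        (B := K * ∑ i ∈ Finset.range N, ‖c i‖ ^ r) (by
          filter_upwards [h1 N c] with n hn
          simpa only [map_sum, map_smul, Finset.sum_apply, Pi.smul_apply, smul_eq_mul] using hn) y
      rw [Real.mul_rpow hK (Finset.sum_nonneg fun i _ => by positivity)] at h5
      simp only [sum_apply, smul_apply, smul_eq_mul] at h5
      refine h5.trans (le_of_eq (by ring))
    refine h4.trans (Real.rpow_le_rpow (by positivity) ?_ hP.le)
    have : 0 ≤ K ^ (1 / p.toReal) * (S.K * ‖y‖) := by positivity
    linarith
  · refine le_of_tendsto ((hx j (g i)).sub_const (if i = j then (1 : 𝕜) else 0)).norm ?_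
    filter_upwards [h3 j i] with n hn
    rw [S.apply_Q]
    simp only [eq_comm (a := i) (b := j)]
    linarith

/-- The Hilbertian case: an orthonormal sequence for the limit of the inner products. -/
theorem hasDisjointSystem_two (hp : p.toReal = 2) (hX : ¬ FiniteDimensional 𝕜 X) :
    HasDisjointSystem S.coord 2 2 := by
  have hp' : p ≠ ∞ := by rintro rfl; simp at hp
  have hconj : (2 : ℝ).HolderConjugate 2 := Real.HolderConjugate.two_two
  have hconjp : p.toReal.HolderConjugate 2 := by rw [hp]; exact hconj
  have hgauge : ∀ x, Tendsto (fun n => ∑ t, ‖S.coord n x t‖ ^ (2 : ℝ))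
      (hyperfilter ℕ : Filter ℕ) (𝓝 (S.gauge x)) := fun x => by
    refine (S.tendsto_gauge x).congr fun n => ?_
    rw [← S.sum_norm_coord hp', hp]
  -- the limit inner product with a fixed vector
  have hB : ∀ x, ∃ f : X →L[𝕜] 𝕜, ∀ y, Tendsto
      (fun n => ∑ t, (starRingEnd 𝕜) (S.coord n x t) * S.coord n y t)
        (hyperfilter ℕ : Filter ℕ) (𝓝 (f y)) := fun x => by
    refine S.exists_functional hp' hconjp (fun n t => (starRingEnd 𝕜) (S.coord n x t))
      (B := (S.K * ‖x‖) ^ p.toReal) (Eventually.of_forall fun n => ?_)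
    simp only [RCLike.norm_conj]
    have := S.sum_norm_coord_le hp' n x
    rwa [hp] at this ⊢
  choose b hb using hB
  have hbself : ∀ x, b x x = ((S.gauge x : ℝ) : 𝕜) := fun x => by
    refine tendsto_nhds_unique (hb x x) ?_
    refine ((RCLike.continuous_ofReal.tendsto _).comp (hgauge x)).congr fun n => ?_
    simp [RCLike.conj_mul]
  have hbsymm : ∀ x y, b y x = (starRingEnd 𝕜) (b x y) := fun x y => by
    refine tendsto_nhds_unique (hb y x) ?_
    refine ((RCLike.continuous_conj.tendsto _).comp (hb x y)).congr fun n => ?_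
    simp [mul_comm]
  -- finitely many linear conditions have a nonzero solution in an infinite-dimensional space
  have hstep : ∀ l : List X, ∃ z, S.gauge z = 1 ∧ ∀ y ∈ l, b y z = 0 := by
    intro l
    let A : X →ₗ[𝕜] (Fin l.length → 𝕜) := LinearMap.pi fun i => (b (l.get i)).toLinearMap
    have hA : ¬ Function.Injective A := fun hinj => hX (FiniteDimensional.of_injective A hinj)
    obtain ⟨z, hz, hz0⟩ : ∃ z, A z = 0 ∧ z ≠ 0 := by
      by_contra! hcon
      exact hA ((injective_iff_map_eq_zero A).2 hcon)
    have hg : 0 < S.gauge z := by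
      have h1 := S.norm_rpow_le_gauge z
      have h2 : 0 < ‖z‖ ^ p.toReal := Real.rpow_pos_of_pos (norm_pos_iff.2 hz0) _
      have h3 : 0 < S.K ^ p.toReal := Real.rpow_pos_of_pos S.K_pos _
      by_contra hcon
      push Not at hcon
      nlinarith
    let a : ℝ := (Real.sqrt (S.gauge z))⁻¹
    have ha : a ^ 2 * S.gauge z = 1 := by
      simp only [a, inv_pow, Real.sq_sqrt hg.le]
      exact inv_mul_cancel₀ hg.ne'
    refine ⟨(a : 𝕜) • z, ?_, fun y hy => ?_⟩
    · refine tendsto_nhds_unique (hgauge _) ?_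
      rw [← ha]
      refine ((hgauge z).const_mul (a ^ 2)).congr fun n => ?_
      rw [Finset.mul_sum]
      refine Finset.sum_congr rfl fun t _ => ?_
      simp only [map_smul, Pi.smul_apply, smul_eq_mul, norm_mul, RCLike.norm_ofReal,
        Real.rpow_two, mul_pow, sq_abs]
    · obtain ⟨i, hi, rfl⟩ := List.getElem_of_mem hy
      have := congrFun hz ⟨i, hi⟩
      simp only [A, LinearMap.pi_apply, List.get_eq_getElem, Pi.zero_apply] at this
      rw [map_smul, show b l[i] z = 0 from this, smul_zero]
  choose step hstep1 hstep2 using hstep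
  let L : ℕ → List X := fun i => Nat.rec [] (fun _ l => step l :: l) i
  have hL : ∀ i, ∀ l < i, step (L l) ∈ L i := by
    intro i
    induction i with
    | zero => intro l hl; omega
    | succ i ih =>
      intro l hl
      change _ ∈ step (L i) :: L i
      rcases Nat.lt_succ_iff_lt_or_eq.1 hl with h | h
      · exact List.mem_cons_of_mem _ (ih l h)
      · rw [h]; exact List.mem_cons_self
  let z : ℕ → X := fun i => step (L i)
  have horth : ∀ i j, b (z i) (z j) = if i = j then 1 else 0 := by
    intro i j
    rcases lt_trichotomy i j with h | h | h
    · rw [if_neg h.ne]; exact hstep2 (L j) _ (hL j i h)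
    · subst h; rw [if_pos rfl, hbself, hstep1]; simp
    · rw [if_neg h.ne', hbsymm (z j) (z i), show b (z j) (z i) = 0 from hstep2 (L i) _ (hL i j h),
        map_zero]
  have hgcomb : ∀ N (c : ℕ → 𝕜), S.gauge (∑ i ∈ Finset.range N, c i • z i) =
      ∑ i ∈ Finset.range N, ‖c i‖ ^ (2 : ℝ) := by
    intro N c
    have h1 := hbself (∑ i ∈ Finset.range N, c i • z i)
    have h2 : ∀ j ∈ Finset.range N, b (∑ i ∈ Finset.range N, c i • z i) (z j) =
        (starRingEnd 𝕜) (c j) := by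
      intro j hj
      rw [hbsymm (z j), map_sum]
      simp [horth, hj]
    rw [map_sum, Finset.sum_congr rfl (fun j hj => by
      rw [map_smul, h2 j hj, smul_eq_mul, RCLike.mul_conj] :
        ∀ j ∈ Finset.range N, b (∑ i ∈ Finset.range N, c i • z i) (c j • z j) =
          ((‖c j‖ : ℝ) : 𝕜) ^ 2)] at h1
    have h3 : ((∑ i ∈ Finset.range N, ‖c i‖ ^ (2 : ℝ) : ℝ) : 𝕜) =
        ((S.gauge (∑ i ∈ Finset.range N, c i • z i) : ℝ) : 𝕜) := by
      rw [← h1]; simp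
    exact (RCLike.ofReal_inj.1 h3).symm
  have hest : ∀ N (c : ℕ → 𝕜), ∀ᶠ n in (hyperfilter ℕ : Filter ℕ),
      ∑ t, ‖∑ i ∈ Finset.range N, c i * S.coord n (z i) t‖ ^ (2 : ℝ) ≤
        2 * ∑ i ∈ Finset.range N, ‖c i‖ ^ (2 : ℝ) := by
    intro N c
    have hσ : 0 ≤ ∑ i ∈ Finset.range N, ‖c i‖ ^ (2 : ℝ) :=
      Finset.sum_nonneg fun i _ => by positivity
    have h1 := hgauge (∑ i ∈ Finset.range N, c i • z i)
    rw [hgcomb] at h1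
    simp only [map_sum, map_smul, Finset.sum_apply, Pi.smul_apply, smul_eq_mul] at h1
    rcases hσ.eq_or_lt with h0 | hpos
    · -- all coefficients vanish
      have h2 : ∀ i ∈ Finset.range N, c i = 0 := fun i hi => by
        have := (Finset.sum_eq_zero_iff_of_nonneg fun i _ => by positivity).1 h0.symm i hi
        simpa using this
      refine Eventually.of_forall fun n => ?_
      rw [← h0, mul_zero]
      refine (Finset.sum_eq_zero fun t _ => ?_).le
      rw [Finset.sum_eq_zero fun i hi => by rw [h2 i hi, zero_mul]]
      simp
    · exact h1.eventually_le_const (by linarith)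
  refine ⟨z, fun i n t => (starRingEnd 𝕜) (S.coord n (z i) t), 2, by norm_num, hest,
    fun N c => ?_, fun i j => ?_⟩
  · filter_upwards [hest N fun i => (starRingEnd 𝕜) (c i)] with n hn
    simp only [RCLike.norm_conj] at hn
    refine le_trans (Finset.sum_le_sum fun t _ => le_of_eq ?_) hn
    rw [← RCLike.norm_conj]
    simp
  · have h1 := hb (z i) (z j)
    rw [horth] at h1
    filter_upwards [Metric.tendsto_nhds.1 h1 ((1 / 2) ^ i * (1 / 2) ^ j / 8) (by positivity)]
      with n hn
    rw [dist_eq_norm] at hn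
    exact hn.le

end LpApprox

/-! ### `ℒ_p`-spaces with `p ≠ 2` are not Hilbertian -/

section NotHilbertian

variable {𝕜 : Type*} [RCLike 𝕜] {p : ℝ≥0∞} [Fact (1 ≤ p)] {X : Type*}
  [NormedAddCommGroup X] [NormedSpace 𝕜 X]

/-- An infinite-dimensional `ℒ_p`-space contains uniform copies of `ℓ_p^n` for arbitrarily
large `n`, recorded through sums of the unit vectors with signs. -/
theorem IsScriptLpWith.exists_unit_vectors (hp : p ≠ ∞) {C : ℝ}
    (h : IsScriptLpWith 𝕜 p C X) (hX : ¬ FiniteDimensional 𝕜 X) (k : ℕ) :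
    ∃ n, k ≤ n ∧ ∃ x : Fin n → X, (∀ i, ‖x i‖ ≤ 1) ∧ (∀ i, 1 ≤ C * ‖x i‖) ∧
      ∀ s : Fin n → ℤˣ, ‖∑ i, (s i : ℤ) • x i‖ ≤ (n : ℝ) ^ (1 / p.toReal) ∧
        (n : ℝ) ^ (1 / p.toReal) ≤ C * ‖∑ i, (s i : ℤ) • x i‖ := by
  have hP := toReal_pos_of_fact p hp
  -- a subspace of dimension `k`
  obtain ⟨v, hv⟩ : ∃ v : Fin k → X, LinearIndependent 𝕜 v := by
    have h1 : Cardinal.aleph0 ≤ Module.rank 𝕜 X := by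
      rw [← not_lt]
      intro hlt
      exact hX (Module.rank_lt_aleph0_iff.1 hlt)
    have h2 : (k : Cardinal) ≤ Module.rank 𝕜 X := (Cardinal.natCast_le_aleph0).trans h1
    obtain ⟨s, hs, hlin⟩ := exists_finset_linearIndependent_of_le_rank h2
    refine ⟨fun i => (s.equivFinOfCardEq hs).symm i, ?_⟩
    exact hlin.comp _ (s.equivFinOfCardEq hs).symm.injective
  have hfd : FiniteDimensional 𝕜 (Submodule.span 𝕜 (Set.range v)) :=
    FiniteDimensional.span_of_finite 𝕜 (Set.finite_range v)
  obtain ⟨F, hF, n, T, S, hST, hTS, hT, hS⟩ := h.exists_normalized (Submodule.span 𝕜 (Set.range v))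
  have hkn : k ≤ n := by
    let e : F ≃ₗ[𝕜] EllFin 𝕜 p n := LinearEquiv.ofLinearMap T.toLinearMap S.toLinearMap
      (LinearMap.ext hTS) (LinearMap.ext hST)
    have : FiniteDimensional 𝕜 F := Module.Finite.equiv e.symm
    have h1 := Submodule.finrank_mono hF
    rw [finrank_span_eq_card hv, e.finrank_eq] at h1
    rw [(WithLp.linearEquiv p 𝕜 (Fin n → 𝕜)).finrank_eq] at h1
    simpa using h1
  let u : Fin n → EllFin 𝕜 p n := fun i => WithLp.toLp p (Pi.single i 1)
  have hu : ∀ i, ‖u i‖ = 1 := fun i =>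
    (PiLp.norm_single p (fun _ : Fin n => 𝕜) i (1 : 𝕜)).trans norm_one
  have hs : ∀ s : Fin n → ℤˣ, ‖∑ i, (s i : ℤ) • u i‖ = (n : ℝ) ^ (1 / p.toReal) := fun s => by
    have h1 : ∀ j, ‖(∑ i, (s i : ℤ) • u i) j‖ = 1 := fun j => by
      have h2 : (∑ i, (s i : ℤ) • u i) j = ((s j : ℤ) : 𝕜) := by
        simp [u, Pi.single_apply]
      rw [h2]
      rcases Int.units_eq_one_or (s j) with h | h <;> simp [h]
    rw [PiLp.norm_eq_sum hP, Finset.sum_congr rfl fun j _ => by rw [h1 j]]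
    simp
  have hlow : ∀ y, ‖y‖ ≤ C * ‖((S y : F) : X)‖ := fun y => by
    have := T.le_of_opNorm_le hT (S y)
    rwa [hTS] at this
  have hupp : ∀ y, ‖((S y : F) : X)‖ ≤ ‖y‖ := fun y => by
    simpa using S.le_of_opNorm_le hS y
  refine ⟨n, hkn, fun i => (S (u i) : F), fun i => ?_, fun i => ?_, fun s => ?_⟩
  · exact (hupp _).trans (hu i).le
  · exact (hu i).ge.trans (hlow _)
  · have h1 : ∑ i, (s i : ℤ) • ((S (u i) : F) : X) = ((S (∑ i, (s i : ℤ) • u i) : F) : X) := by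
      simp
    rw [h1, ← hs s]
    exact ⟨hupp _, hlow _⟩

/-- Signs for which a function with the upper half of the parallelogram law is large. -/
theorem exists_signs_ge {Z : Type*} [AddCommGroup Z] {ψ : Z → ℝ} (h0 : 0 ≤ ψ 0)
    (hψ : ∀ x y, 2 * ψ x + 2 * ψ y ≤ ψ (x + y) + ψ (x - y)) {n : ℕ} (x : Fin n → Z) :
    ∃ s : Fin n → ℤˣ, ∑ i, ψ (x i) ≤ ψ (∑ i, (s i : ℤ) • x i) := by
  induction n with
  | zero => exact ⟨fun _ => 1, by simpa using h0⟩
  | succ n ih =>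
    obtain ⟨s, hs⟩ := ih fun i => x i.castSucc
    have h1 := hψ (∑ i : Fin n, (s i : ℤ) • x i.castSucc) (x (Fin.last n))
    rcases le_total (ψ (∑ i : Fin n, (s i : ℤ) • x i.castSucc - x (Fin.last n)))
      (ψ (∑ i : Fin n, (s i : ℤ) • x i.castSucc + x (Fin.last n))) with h | h
    · refine ⟨Fin.snoc s 1, ?_⟩
      simp only [Fin.sum_univ_castSucc, Fin.snoc_castSucc, Fin.snoc_last, Units.val_one, one_smul]
      linarith
    · refine ⟨Fin.snoc s (-1), ?_⟩
      simp only [Fin.sum_univ_castSucc, Fin.snoc_castSucc, Fin.snoc_last, Units.val_neg,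
        Units.val_one, neg_smul, one_smul, ← sub_eq_add_neg]
      linarith

/-- Signs for which a function with the lower half of the parallelogram law is small. -/
theorem exists_signs_le {Z : Type*} [AddCommGroup Z] {ψ : Z → ℝ} (h0 : ψ 0 ≤ 0)
    (hψ : ∀ x y, ψ (x + y) + ψ (x - y) ≤ 2 * ψ x + 2 * ψ y) {n : ℕ} (x : Fin n → Z) :
    ∃ s : Fin n → ℤˣ, ψ (∑ i, (s i : ℤ) • x i) ≤ ∑ i, ψ (x i) := by
  obtain ⟨s, hs⟩ := exists_signs_ge (ψ := fun z => -ψ z) (by simpa using h0)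
    (fun x y => by linarith [hψ x y]) x
  rw [Finset.sum_neg_distrib] at hs
  exact ⟨s, neg_le_neg_iff.1 hs⟩

theorem exists_lt_rpow (B : ℝ) {α : ℝ} (hα : 0 < α) : ∃ k : ℕ, 0 < k ∧ ∀ n : ℕ, k ≤ n →
    B < (n : ℝ) ^ α := by
  have h := (tendsto_rpow_atTop hα).comp tendsto_natCast_atTop_atTop
  obtain ⟨k, hk⟩ := (h.eventually_gt_atTop B).exists_forall_of_atTop
  exact ⟨k + 1, Nat.succ_pos k, fun n hn => hk n (by omega)⟩

/-- For `p > 2` an infinite-dimensional `ℒ_p`-space has no cotype `2`, hence is not Hilbertian. -/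
theorem IsScriptLp.not_isHilbertian (hp : p ≠ ∞) (hp2 : 2 < p.toReal) (h : IsScriptLp 𝕜 p X)
    (hX : ¬ FiniteDimensional 𝕜 X) : ¬ IsHilbertian X := by
  -- suitable signs give `‖∑ ± x i‖ ^ 2 ≳ n`, while this is at most `n ^ (2 / p)`
  rintro ⟨ψ, a, b, ha, hψ, hab⟩
  obtain ⟨C, hC, h⟩ := h
  have hC0 : 0 < C := by linarith
  have hα : 0 < 1 - 2 / p.toReal := by
    rw [sub_pos, div_lt_one (by linarith)]; exact hp2
  obtain ⟨k, hk, hB⟩ := exists_lt_rpow (|b| * C ^ 2 / a) hα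
  obtain ⟨n, hkn, x, -, hx, hs⟩ := h.exists_unit_vectors hp hX k
  have hn : (0 : ℝ) < n := by exact_mod_cast hk.trans_le hkn
  obtain ⟨s, hsum⟩ := exists_signs_ge (ψ := ψ) (by have := (hab 0).1; simpa using this)
    (fun x y => (hψ x y).ge) x
  have h1 : ∀ i ∈ Finset.univ, a / C ^ 2 ≤ ψ (x i) := fun i _ => by
    refine le_trans ?_ (hab (x i)).1
    rw [div_le_iff₀ (by positivity)]
    have : 1 ≤ (C * ‖x i‖) ^ 2 := one_le_pow₀ (hx i)
    nlinarith
  have h2 := Finset.sum_le_sum h1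
  simp only [Finset.sum_const, Finset.card_univ, Fintype.card_fin, nsmul_eq_mul] at h2
  have h3 : ψ (∑ i, (s i : ℤ) • x i) ≤ |b| * (n : ℝ) ^ (2 / p.toReal) := by
    refine (hab _).2.trans ?_
    have h4 : ‖∑ i, (s i : ℤ) • x i‖ ^ 2 ≤ (n : ℝ) ^ (2 / p.toReal) := by
      refine (pow_le_pow_left₀ (norm_nonneg _) (hs s).1 2).trans (le_of_eq ?_)
      rw [← Real.rpow_natCast, ← Real.rpow_mul hn.le]
      congr 1; push_cast; ring
    exact mul_le_mul (le_abs_self b) h4 (by positivity) (abs_nonneg b)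
  have h5 := hB n hkn
  rw [div_lt_iff₀ ha, Real.rpow_sub hn, Real.rpow_one] at h5
  have h6 : (0 : ℝ) < (n : ℝ) ^ (2 / p.toReal) := by positivity
  rw [div_mul_eq_mul_div, lt_div_iff₀ h6] at h5
  have h7 : (n : ℝ) * (a / C ^ 2) ≤ |b| * (n : ℝ) ^ (2 / p.toReal) := h2.trans (hsum.trans h3)
  rw [mul_div_assoc', div_le_iff₀ (by positivity)] at h7
  linarith

/-- For `p < 2` an infinite-dimensional `ℒ_p`-space has no type `2`. A Hilbertian structure `ψ` on the
dual would induce, by conjugation of quadratic forms, a function on the space itself with the lower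
half of the parallelogram law, and hence type `2`. -/
theorem IsScriptLp.not_isHilbertian_dual (hp : p ≠ ∞) (hp2 : p.toReal < 2) (h : IsScriptLp 𝕜 p X)
    (hX : ¬ FiniteDimensional 𝕜 X) : ¬ IsHilbertian (X →L[𝕜] 𝕜) := by
  rintro ⟨ψ, a, b, ha, hψ, hab⟩
  have hP := toReal_pos_of_fact p hp
  obtain ⟨C, hC, h⟩ := h
  have hC0 : 0 < C := by linarith
  -- the conjugate function of `ψ`
  let G : X → (X →L[𝕜] 𝕜) → ℝ := fun x f => 2 * RCLike.re (f x) - ψ f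
  have hG : ∀ x f, G x f ≤ ‖x‖ ^ 2 / a := fun x f => by
    have h1 : RCLike.re (f x) ≤ ‖f‖ * ‖x‖ := (RCLike.re_le_norm _).trans (f.le_opNorm x)
    have h2 := (hab f).1
    rw [le_div_iff₀ ha]
    simp only [G]
    nlinarith [sq_nonneg (a * ‖f‖ - ‖x‖)]
  have hbdd : ∀ x, BddAbove (Set.range (G x)) := fun x => ⟨_, by rintro _ ⟨f, rfl⟩; exact hG x f⟩
  let θ : X → ℝ := fun x => ⨆ f, G x f
  have hθle : ∀ x, θ x ≤ ‖x‖ ^ 2 / a := fun x => ciSup_le (hG x)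
  have hleθ : ∀ x f, G x f ≤ θ x := fun x f => le_ciSup (hbdd x) f
  have hpar : ∀ x y, θ (x + y) + θ (x - y) ≤ 2 * θ x + 2 * θ y := by
    intro x y
    have h1 : ∀ f g, G (x + y) f + G (x - y) g ≤ 2 * θ x + 2 * θ y := by
      intro f g
      -- substitute `f = u + v`, `g = u - v`
      let u : X →L[𝕜] 𝕜 := (1 / 2 : 𝕜) • (f + g)
      let v : X →L[𝕜] 𝕜 := (1 / 2 : 𝕜) • (f - g)
      have hf : f = u + v := by
        simp only [u, v]
        ext z
        simp only [add_apply, smul_apply, sub_apply, smul_eq_mul]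
        ring
      have hg : g = u - v := by
        simp only [u, v]
        ext z
        simp only [add_apply, smul_apply, sub_apply, smul_eq_mul]
        ring
      have h2 := hψ u v
      have h3 := hleθ x u
      have h4 := hleθ y v
      rw [hf, hg]
      simp only [G, add_apply, sub_apply, map_add, map_sub] at *
      linarith
    have h5 : ∀ f, G (x + y) f ≤ 2 * θ x + 2 * θ y - θ (x - y) := fun f => by
      have : θ (x - y) ≤ 2 * θ x + 2 * θ y - G (x + y) f :=
        ciSup_le fun g => by linarith [h1 f g]
      linarith
    have h6 : θ (x + y) ≤ 2 * θ x + 2 * θ y - θ (x - y) := ciSup_le h5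
    linarith
  have hb : 0 < |b| + 1 := by positivity
  have hlow : ∀ x, ‖x‖ ^ 2 / (|b| + 1) ≤ θ x := by
    intro x
    obtain ⟨f, hf, hfx⟩ := exists_dual_vector'' 𝕜 x
    let t : ℝ := ‖x‖ / (|b| + 1)
    have ht : 0 ≤ t := by positivity
    refine le_trans ?_ (hleθ x ((t : 𝕜) • f))
    have h1 : ψ ((t : 𝕜) • f) ≤ (|b| + 1) * t ^ 2 := by
      refine (hab _).2.trans ?_
      refine mul_le_mul (by linarith [le_abs_self b]) ?_ (by positivity) hb.le
      rw [norm_smul, RCLike.norm_ofReal, abs_of_nonneg ht]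
      exact pow_le_pow_left₀ (by positivity) (mul_le_of_le_one_right ht hf) 2
    have h2 : RCLike.re (((t : 𝕜) • f) x) = t * ‖x‖ := by
      rw [smul_apply, hfx, smul_eq_mul, ← RCLike.ofReal_mul, RCLike.ofReal_re]
    simp only [G, h2]
    have h3 : (|b| + 1) * t ^ 2 = ‖x‖ ^ 2 / (|b| + 1) := by
      simp only [t]; field_simp
    have h4 : t * ‖x‖ = ‖x‖ ^ 2 / (|b| + 1) := by
      simp only [t]; field_simp
    linarith
  -- suitable signs give `‖∑ ± x i‖ ^ 2 ≲ n`, while this is at least of order `n ^ (2 / p)`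
  have hα : 0 < 2 / p.toReal - 1 := by
    rw [sub_pos, lt_div_iff₀ hP]; linarith
  obtain ⟨k, hk, hB⟩ := exists_lt_rpow (C ^ 2 * (|b| + 1) / a) hα
  obtain ⟨n, hkn, x, hx, -, hs⟩ := h.exists_unit_vectors hp hX k
  have hn : (0 : ℝ) < n := by exact_mod_cast hk.trans_le hkn
  obtain ⟨s, hsum⟩ := exists_signs_le (ψ := θ) (by have := hθle 0; simpa using this) hpar x
  have h1 : ∀ i ∈ Finset.univ, θ (x i) ≤ 1 / a := fun i _ => by
    refine (hθle (x i)).trans ?_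
    have : ‖x i‖ ^ 2 ≤ 1 := pow_le_one₀ (norm_nonneg _) (hx i)
    gcongr
  have h2 := Finset.sum_le_sum h1
  simp only [Finset.sum_const, Finset.card_univ, Fintype.card_fin, nsmul_eq_mul] at h2
  have h3 : (n : ℝ) ^ (2 / p.toReal) ≤ C ^ 2 * ((|b| + 1) * θ (∑ i, (s i : ℤ) • x i)) := by
    have h4 := hlow (∑ i, (s i : ℤ) • x i)
    rw [div_le_iff₀ hb] at h4
    have h5 : (n : ℝ) ^ (2 / p.toReal) ≤ C ^ 2 * ‖∑ i, (s i : ℤ) • x i‖ ^ 2 := by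
      rw [← mul_pow]
      refine le_trans (le_of_eq ?_) (pow_le_pow_left₀ (by positivity) (hs s).2 2)
      rw [← Real.rpow_natCast, ← Real.rpow_mul hn.le]
      congr 1; push_cast; ring
    refine h5.trans (mul_le_mul_of_nonneg_left ?_ (by positivity))
    linarith
  have h5 := hB n hkn
  rw [div_lt_iff₀ ha, Real.rpow_sub hn, Real.rpow_one, div_mul_eq_mul_div, lt_div_iff₀ hn] at h5
  have h6 : C ^ 2 * ((|b| + 1) * θ (∑ i, (s i : ℤ) • x i)) ≤ C ^ 2 * ((|b| + 1) * (n * (1 / a))) :=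
    mul_le_mul_of_nonneg_left (mul_le_mul_of_nonneg_left (hsum.trans h2) hb.le) (by positivity)
  have h7 := h3.trans h6
  have h8 : C ^ 2 * ((|b| + 1) * (n * (1 / a))) * a = C ^ 2 * (|b| + 1) * n := by
    field_simp
  have h9 := mul_le_mul_of_nonneg_right h7 ha.le
  rw [h8] at h9
  linarith

/-- An infinite-dimensional separable `ℒ_p`-space, `1 < p < ∞`, contains a complemented copy
of `ℓ_p`. -/
theorem IsScriptLp.factors_ell [CompleteSpace X] (S : LpApprox 𝕜 p X) (hp : 1 < p) (hp' : p ≠ ∞)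
    (h : IsScriptLp 𝕜 p X) (hX : ¬ FiniteDimensional 𝕜 X) : Factors 𝕜 (Ell 𝕜 p) X := by
  have hP := one_lt_toReal hp hp'
  have hconj := Real.HolderConjugate.conjExponent hP
  set r := p.toReal.conjExponent with hr
  have hKpos := S.K_pos
  rcases lt_trichotomy p.toReal 2 with hlt | heq | hgt
  · refine S.factors_ell_of_hasDisjointSystem_dual hp' hconj (S.hasWeakLimits hp hp' _) ?_
    have hr2 : 2 < r := by
      have h1 := hconj.sub_one_mul_conj
      have h2 := hconj.symm.pos
      nlinarith
    have hr0 : 0 < r := by linarith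
    have hbd : ∀ f, ∀ᶠ n in (hyperfilter ℕ : Filter ℕ),
        ‖∑ t, ‖S.dualCoords n f t‖ ^ r‖ ≤ (S.K * ‖f‖) ^ r := fun f =>
      Eventually.of_forall fun n => by
        rw [Real.norm_of_nonneg (Finset.sum_nonneg fun t _ => by positivity)]
        exact S.sum_norm_dualCoords_le hp' hconj n f
    have hlim := fun f => tendsto_ulim (hbd f)
    refine hasDisjointSystem_of_not_isHilbertian hconj.symm hr2 (C := S.K ^ r)
      (c := (S.K ^ r)⁻¹) (fun n f => ?_) hlim (by positivity) (fun f => ?_)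
      (h.not_isHilbertian_dual hp' hlt hX)
    · rw [← Real.mul_rpow hKpos.le (norm_nonneg _)]
      exact S.sum_norm_dualCoords_le hp' hconj n f
    · set Φ := ulim (hyperfilter ℕ) fun n => ∑ t, ‖S.dualCoords n f t‖ ^ r with hΦ
      have hΦ0 : 0 ≤ Φ := ge_of_tendsto (hlim f) (Eventually.of_forall fun n =>
        Finset.sum_nonneg fun t _ => by positivity)
      have h1 : ‖f‖ ≤ S.K * Φ ^ (1 / r) := by
        refine f.opNorm_le_bound (by positivity) fun x => ?_
        have h2 : ∀ ε > 0, ‖f x‖ ≤ S.K * ‖x‖ * (Φ + ε) ^ (1 / r) := fun ε hε =>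
          S.norm_le_of_sum_dualCoords hp' hconj f ((hlim f).eventually_le_const (by linarith)) x
        have h3 : Tendsto (fun ε : ℝ => S.K * ‖x‖ * (Φ + ε) ^ (1 / r)) (𝓝[>] 0)
            (𝓝 (S.K * ‖x‖ * (Φ + 0) ^ (1 / r))) := by
          have hc : Continuous fun ε : ℝ => S.K * ‖x‖ * (Φ + ε) ^ (1 / r) :=
            continuous_const.mul ((Real.continuous_rpow_const (by positivity)).comp
              (continuous_const.add continuous_id))
          exact (hc.tendsto 0).mono_left nhdsWithin_le_nhds
        rw [add_zero] at h3
        refine (ge_of_tendsto h3 ?_).trans (le_of_eq (by ring))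
        filter_upwards [self_mem_nhdsWithin] with ε hε using h2 ε hε
      have h4 := Real.rpow_le_rpow (norm_nonneg _) h1 hr0.le
      rw [Real.mul_rpow hKpos.le (by positivity), ← Real.rpow_mul hΦ0,
        one_div_mul_cancel hr0.ne', Real.rpow_one] at h4
      rw [inv_mul_le_iff₀ (by positivity)]
      exact h4
  · have h2 : r = 2 := by
      have h1 := hconj.sub_one_mul_conj
      rw [heq] at h1
      linarith
    refine S.factors_ell_of_hasDisjointSystem hp' hconj ?_
    rw [h2, heq]
    exact S.hasDisjointSystem_two heq hX
  · refine S.factors_ell_of_hasDisjointSystem hp' hconj ?_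
    refine hasDisjointSystem_of_not_isHilbertian hconj hgt (C := S.K ^ p.toReal)
      (c := (S.K ^ p.toReal)⁻¹) (Φ := S.gauge) (fun n x => ?_) (fun x => ?_) (by positivity)
      (fun x => ?_) (h.not_isHilbertian hp' hgt hX)
    · rw [← Real.mul_rpow hKpos.le (norm_nonneg _)]
      exact S.sum_norm_coord_le hp' n x
    · simpa only [S.sum_norm_coord hp'] using S.tendsto_gauge x
    · rw [inv_mul_le_iff₀ (by positivity)]
      exact S.norm_rpow_le_gauge x

end NotHilbertian

/-! ### The space `L_p[0,1]` -/

open MeasureTheory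

section StepFunctions

variable {𝕜 : Type*} [RCLike 𝕜] {p : ℝ≥0∞} {Ω : Type*} [MeasurableSpace Ω] {μ : Measure Ω}
  {ι : Type*} {κ : Ω → ι}

theorem enorm_rpow_eq_ofReal {E : Type*} [NormedAddCommGroup E] (a : E) {P : ℝ} (hP : 0 ≤ P) :
    ‖a‖ₑ ^ P = ENNReal.ofReal (‖a‖ ^ P) := by
  rw [← ofReal_norm, ENNReal.ofReal_rpow_of_nonneg (norm_nonneg a) hP]

/-- The function that is constant on the fibres of `κ`, with values `c`, normalized so that the
`L_p` norm of the part on each fibre is the absolute value of the coefficient. -/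
noncomputable def stepFun (p : ℝ≥0∞) (μ : Measure Ω) (κ : Ω → ι) (c : ι → 𝕜) (t : Ω) : 𝕜 :=
  ((μ.real (κ ⁻¹' {κ t}) ^ (-(1 / p.toReal)) : ℝ) : 𝕜) * c (κ t)

/-- The normalized mean over the fibres of `κ`, a left inverse of `stepFun`. -/
noncomputable def fibreMean (p : ℝ≥0∞) (μ : Measure Ω) (κ : Ω → ι) (x : Ω → 𝕜) (i : ι) : 𝕜 :=
  ((μ.real (κ ⁻¹' {i}) ^ (1 / p.toReal - 1) : ℝ) : 𝕜) * ∫ t in κ ⁻¹' {i}, x t ∂μ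

theorem measurable_stepFun [MeasurableSpace ι] [Countable ι] [DiscreteMeasurableSpace ι] (hκ : Measurable κ)
    (c : ι → 𝕜) : Measurable (stepFun p μ κ c) :=
  (Measurable.of_discrete (f := fun i : ι =>
    ((μ.real (κ ⁻¹' {i}) ^ (-(1 / p.toReal)) : ℝ) : 𝕜) * c i)).comp hκ

theorem lintegral_stepFun [MeasurableSpace ι] [Countable ι] [DiscreteMeasurableSpace ι]
    [IsFiniteMeasure μ] (hP : 0 < p.toReal) (hκ : Measurable κ) (hpos : ∀ i, 0 < μ.real (κ ⁻¹' {i})) (c : ι → 𝕜) :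
    ∫⁻ t, ‖stepFun p μ κ c t‖ₑ ^ p.toReal ∂μ = ∑' i, ‖c i‖ₑ ^ p.toReal := by
  have h1 := lintegral_map (μ := μ) (g := κ) (f := fun i : ι =>
    ‖((μ.real (κ ⁻¹' {i}) ^ (-(1 / p.toReal)) : ℝ) : 𝕜) * c i‖ₑ ^ p.toReal)
    Measurable.of_discrete hκ
  refine h1.symm.trans ?_
  rw [lintegral_countable']
  refine tsum_congr fun i => ?_
  rw [Measure.map_apply hκ (measurableSet_singleton i), ← ofReal_measureReal,
    enorm_rpow_eq_ofReal _ hP.le, enorm_rpow_eq_ofReal _ hP.le,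
    ← ENNReal.ofReal_mul (by positivity)]
  congr 1
  have hm := hpos i
  rw [norm_mul, RCLike.norm_ofReal, abs_of_nonneg (by positivity),
    Real.mul_rpow (by positivity) (norm_nonneg _), ← Real.rpow_mul hm.le,
    show -(1 / p.toReal) * p.toReal = -1 by field_simp, Real.rpow_neg_one]
  field_simp

theorem eLpNorm_stepFun_le [MeasurableSpace ι] [Countable ι] [DiscreteMeasurableSpace ι]
    [IsFiniteMeasure μ] (hP : 0 < p.toReal) (hκ : Measurable κ) (hpos : ∀ i, 0 < μ.real (κ ⁻¹' {i})) {c : ι → 𝕜}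
    {M : ℝ} (hM : 0 ≤ M) (hc : ∑' i, ‖c i‖ₑ ^ p.toReal ≤ ENNReal.ofReal (M ^ p.toReal)) :
    eLpNorm (stepFun p μ κ c) p μ ≤ ENNReal.ofReal M := by
  rw [ENNReal.toReal_pos_iff] at hP
  have hP' := ENNReal.toReal_pos hP.1.ne' hP.2.ne
  rw [eLpNorm_eq_lintegral_rpow_enorm_toReal hP.1.ne' hP.2.ne, lintegral_stepFun hP' hκ hpos]
  refine (ENNReal.rpow_le_rpow hc (by positivity)).trans (le_of_eq ?_)
  rw [← ENNReal.ofReal_rpow_of_nonneg hM hP'.le, ← ENNReal.rpow_mul, mul_one_div_cancel hP'.ne',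
    ENNReal.rpow_one]

theorem memLp_stepFun [MeasurableSpace ι] [Countable ι] [DiscreteMeasurableSpace ι]
    [IsFiniteMeasure μ] (hP : 0 < p.toReal) (hκ : Measurable κ)
    (hpos : ∀ i, 0 < μ.real (κ ⁻¹' {i})) {c : ι → 𝕜} {M : ℝ} (hM : 0 ≤ M)
    (hc : ∑' i, ‖c i‖ₑ ^ p.toReal ≤ ENNReal.ofReal (M ^ p.toReal)) :
    MemLp (stepFun p μ κ c) p μ :=
  ⟨(measurable_stepFun hκ _).aestronglyMeasurable,
    (eLpNorm_stepFun_le hP hκ hpos hM hc).trans_lt ENNReal.ofReal_lt_top⟩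

/-- The map from sequence spaces into `L_p` induced by `stepFun`. -/
noncomputable def stepCLM [Fact (1 ≤ p)] [MeasurableSpace ι] [Countable ι] [DiscreteMeasurableSpace ι]
    [IsFiniteMeasure μ] (hP : 0 < p.toReal) (hκ : Measurable κ)
    (hpos : ∀ i, 0 < μ.real (κ ⁻¹' {i})) {E : Type*} [NormedAddCommGroup E] [NormedSpace 𝕜 E]
    (L : E →ₗ[𝕜] (ι → 𝕜))
    (hL : ∀ x, ∑' i, ‖L x i‖ₑ ^ p.toReal ≤ ENNReal.ofReal (‖x‖ ^ p.toReal)) :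
    E →L[𝕜] Lp 𝕜 p μ :=
  LinearMap.mkContinuous
    { toFun := fun x => MemLp.toLp (stepFun p μ κ (L x))
        (memLp_stepFun hP hκ hpos (norm_nonneg x) (hL x))
      map_add' := fun x y => by
        rw [← MemLp.toLp_add]
        congr 1
        ext t
        simp [stepFun, mul_add]
      map_smul' := fun a x => by
        rw [RingHom.id_apply, ← MemLp.toLp_const_smul]
        congr 1
        ext t
        simp [stepFun, mul_left_comm] } 1 fun x => by
    rw [one_mul]
    exact (Lp.norm_toLp _ (memLp_stepFun hP hκ hpos (norm_nonneg x) (hL x))).trans_le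
      (ENNReal.toReal_le_of_le_ofReal (norm_nonneg x)
        (eLpNorm_stepFun_le hP hκ hpos (norm_nonneg x) (hL x)))

section

variable [Fact (1 ≤ p)] [MeasurableSpace ι] [Countable ι] [DiscreteMeasurableSpace ι] [IsFiniteMeasure μ]
  (hP : 0 < p.toReal) (hκ : Measurable κ) (hpos : ∀ i, 0 < μ.real (κ ⁻¹' {i}))
  {E : Type*} [NormedAddCommGroup E] [NormedSpace 𝕜 E] (L : E →ₗ[𝕜] (ι → 𝕜))
  (hL : ∀ x, ∑' i, ‖L x i‖ₑ ^ p.toReal ≤ ENNReal.ofReal (‖x‖ ^ p.toReal))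

theorem coeFn_stepCLM (x : E) : stepCLM (μ := μ) hP hκ hpos L hL x =ᵐ[μ] stepFun p μ κ (L x) :=
  MemLp.coeFn_toLp (memLp_stepFun hP hκ hpos (norm_nonneg x) (hL x))

theorem norm_stepCLM_le : ‖stepCLM (μ := μ) hP hκ hpos L hL‖ ≤ 1 :=
  LinearMap.mkContinuous_norm_le _ zero_le_one _

end

theorem fibreMean_congr {x y : Ω → 𝕜} (h : x =ᵐ[μ] y) : fibreMean p μ κ x = fibreMean p μ κ y := by
  ext i
  rw [fibreMean, fibreMean, integral_congr_ae (ae_restrict_of_ae h)]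

theorem fibreMean_stepFun [MeasurableSpace ι] [DiscreteMeasurableSpace ι] (hκ : Measurable κ)
    (hpos : ∀ i, 0 < μ.real (κ ⁻¹' {i})) (c : ι → 𝕜) :
    fibreMean p μ κ (stepFun p μ κ c) = c := by
  ext i
  have hm := hpos i
  have h1 : ∫ t in κ ⁻¹' {i}, stepFun p μ κ c t ∂μ =
      ∫ _ in κ ⁻¹' {i}, ((μ.real (κ ⁻¹' {i}) ^ (-(1 / p.toReal)) : ℝ) : 𝕜) * c i ∂μ := by
    refine setIntegral_congr_fun (hκ (measurableSet_singleton i)) fun t ht => ?_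
    have : κ t = i := ht
    simp only [stepFun, this]
  rw [fibreMean, h1, setIntegral_const, RCLike.real_smul_eq_coe_mul, ← mul_assoc, ← mul_assoc,
    ← RCLike.ofReal_mul, ← RCLike.ofReal_mul]
  have h2 : μ.real (κ ⁻¹' {i}) ^ (1 / p.toReal - 1) * μ.real (κ ⁻¹' {i}) *
      μ.real (κ ⁻¹' {i}) ^ (-(1 / p.toReal)) = 1 := by
    rw [← Real.rpow_add_one hm.ne', ← Real.rpow_add hm]
    simp
  rw [h2, RCLike.ofReal_one, one_mul]

/-- The step function of the means is the function of averages over the fibres. -/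
theorem stepFun_fibreMean (hpos : ∀ i, 0 < μ.real (κ ⁻¹' {i})) (x : Ω → 𝕜) (t : Ω) :
    stepFun p μ κ (fibreMean p μ κ x) t =
      ((μ.real (κ ⁻¹' {κ t}))⁻¹ : ℝ) * ∫ s in κ ⁻¹' {κ t}, x s ∂μ := by
  have hm := hpos (κ t)
  rw [stepFun, fibreMean, ← mul_assoc, ← RCLike.ofReal_mul, ← Real.rpow_add hm]
  congr 2
  rw [← Real.rpow_neg_one]
  congr 1
  ring

theorem enorm_fibreMean_rpow_le [Fact (1 ≤ p)] [IsFiniteMeasure μ] (hp : p ≠ ∞)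
    (hpos : ∀ i, 0 < μ.real (κ ⁻¹' {i})) {x : Ω → 𝕜} (hx : AEStronglyMeasurable x μ) (i : ι) :
    ‖fibreMean p μ κ x i‖ₑ ^ p.toReal ≤ ∫⁻ t in κ ⁻¹' {i}, ‖x t‖ₑ ^ p.toReal ∂μ := by
  have hP := toReal_pos_of_fact p hp
  have hp1 : 1 ≤ p := Fact.out
  have hm := hpos i
  have h1 : ‖∫ t in κ ⁻¹' {i}, x t ∂μ‖ₑ ≤ eLpNorm x p (μ.restrict (κ ⁻¹' {i})) *
      ENNReal.ofReal (μ.real (κ ⁻¹' {i}) ^ (1 - 1 / p.toReal)) := by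
    refine (enorm_integral_le_lintegral_enorm _).trans ?_
    have := eLpNorm_le_eLpNorm_mul_rpow_measure_univ hp1 (hx.mono_measure
      (Measure.restrict_le_self (s := κ ⁻¹' {i})))
    rw [eLpNorm_one_eq_lintegral_enorm, Measure.restrict_apply_univ, ← ofReal_measureReal,
      ENNReal.ofReal_rpow_of_pos hm] at this
    simpa using this
  have h2 : ‖fibreMean p μ κ x i‖ₑ ≤ eLpNorm x p (μ.restrict (κ ⁻¹' {i})) := by
    rw [fibreMean, enorm_mul]
    refine (mul_le_mul_right h1 _).trans (le_of_eq ?_)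
    rw [← ofReal_norm, RCLike.norm_ofReal, abs_of_nonneg (by positivity), mul_left_comm,
      ← ENNReal.ofReal_mul (by positivity), ← Real.rpow_add hm]
    simp
  refine (ENNReal.rpow_le_rpow h2 hP.le).trans (le_of_eq ?_)
  rw [eLpNorm_eq_lintegral_rpow_enorm_toReal (by positivity) hp, ← ENNReal.rpow_mul,
    one_div_mul_cancel hP.ne', ENNReal.rpow_one]

theorem sum_norm_fibreMean_le [Fact (1 ≤ p)] [IsFiniteMeasure μ] [MeasurableSpace ι]
    [DiscreteMeasurableSpace ι] (hp : p ≠ ∞) (hκ : Measurable κ) (hpos : ∀ i, 0 < μ.real (κ ⁻¹' {i})) (x : Lp 𝕜 p μ)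
    (s : Finset ι) : ∑ i ∈ s, ‖fibreMean p μ κ x i‖ ^ p.toReal ≤ ‖x‖ ^ p.toReal := by
  have hP := toReal_pos_of_fact p hp
  have hp0 : p ≠ 0 := (zero_lt_one.trans_le (Fact.out : 1 ≤ p)).ne'
  rw [← ENNReal.ofReal_le_ofReal_iff (by positivity),
    ENNReal.ofReal_sum_of_nonneg fun i _ => by positivity, ← enorm_rpow_eq_ofReal _ hP.le]
  simp only [← enorm_rpow_eq_ofReal _ hP.le]
  refine (Finset.sum_le_sum fun i _ =>
    enorm_fibreMean_rpow_le hp hpos (Lp.aestronglyMeasurable x) i).trans ?_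
  rw [← lintegral_biUnion_finset (fun i _ j _ hij => (Set.disjoint_singleton.2 hij).preimage κ)
    fun i _ => hκ (measurableSet_singleton i)]
  refine (setLIntegral_le_lintegral _ _).trans (le_of_eq ?_)
  rw [Lp.enorm_def, eLpNorm_eq_lintegral_rpow_enorm_toReal hp0 hp, ← ENNReal.rpow_mul, one_div_mul_cancel hP.ne', ENNReal.rpow_one]

/-- `fibreMean` as a linear map on `L_p`. -/
noncomputable def fibreMeanLM [Fact (1 ≤ p)] [IsFiniteMeasure μ] (κ : Ω → ι) :
    Lp 𝕜 p μ →ₗ[𝕜] (ι → 𝕜) where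
  toFun x := fibreMean p μ κ x
  map_add' x y := by
    have hint : ∀ x : Lp 𝕜 p μ, Integrable x μ := fun x => (Lp.memLp x).integrable Fact.out
    ext i
    rw [fibreMean_congr (Lp.coeFn_add x y)]
    simp only [fibreMean, Pi.add_apply]
    rw [integral_add (hint x).integrableOn (hint y).integrableOn, mul_add]
  map_smul' a x := by
    ext i
    rw [fibreMean_congr (Lp.coeFn_smul a x)]
    simp only [fibreMean, Pi.smul_apply, RingHom.id_apply, smul_eq_mul]
    rw [integral_const_mul, mul_left_comm]

@[simp] theorem fibreMeanLM_apply [Fact (1 ≤ p)] [IsFiniteMeasure μ] (x : Lp 𝕜 p μ) :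
    fibreMeanLM κ x = fibreMean p μ κ x := rfl

end StepFunctions

section UnitInterval

variable (𝕜 : Type*) [RCLike 𝕜] (p : ℝ≥0∞) [Fact (1 ≤ p)]

theorem measureReal_restrict_unit_pos {a b : ℝ} (ha : 0 ≤ a) (hab : a < b) (hb : b ≤ 1) {s : Set ℝ}
    (h : Set.Ioo a b ⊆ s) : 0 < (volume.restrict (Set.Icc (0 : ℝ) 1)).real s := by
  have h1 : (volume.restrict (Set.Icc (0 : ℝ) 1)).real (Set.Ioo a b) = b - a := by
    rw [measureReal_restrict_apply measurableSet_Ioo, Set.inter_eq_left.2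
      (Set.Ioo_subset_Icc_self.trans (Set.Icc_subset_Icc ha hb)), Real.volume_real_Ioo_of_le hab.le]
  have h2 := measureReal_mono (μ := volume.restrict (Set.Icc (0 : ℝ) 1)) h
  linarith

/-- The position of `t ∈ [0, 1]` in the partition into `n + 1` intervals of equal length. -/
noncomputable def unitCell (n : ℕ) (t : ℝ) : Fin (n + 1) :=
  ⟨min ⌊((n : ℝ) + 1) * t⌋₊ n, by omega⟩

theorem measurable_unitCell (n : ℕ) : Measurable (unitCell n) :=
  (Measurable.of_discrete (f := fun k : ℕ => (⟨min k n, by omega⟩ : Fin (n + 1)))).comp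
    (Nat.measurable_floor.comp (measurable_const_mul _))

theorem measureReal_unitCell_pos (n : ℕ) (i : Fin (n + 1)) :
    0 < (volume.restrict (Set.Icc (0 : ℝ) 1)).real (unitCell n ⁻¹' {i}) := by
  have hn : (0 : ℝ) < n + 1 := by positivity
  have hi : (i : ℝ) + 1 ≤ n + 1 := by exact_mod_cast i.2
  refine measureReal_restrict_unit_pos (a := i / (n + 1)) (b := (i + 1) / (n + 1)) (by positivity)
    (by gcongr; linarith) ((div_le_one hn).2 hi) fun t ht => ?_
  have h1 := (div_lt_iff₀' hn).1 ht.1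
  have h2 := (lt_div_iff₀' hn).1 ht.2
  have h3 : ⌊((n : ℝ) + 1) * t⌋₊ = i := by
    rw [Nat.floor_eq_iff ((Nat.cast_nonneg _).trans h1.le)]
    exact ⟨h1.le, h2⟩
  refine Fin.ext ?_
  simp only [unitCell, h3]
  omega

theorem abs_sub_le_of_unitCell_eq {n : ℕ} {s t : ℝ} (hs : s ∈ Set.Icc (0 : ℝ) 1)
    (ht : t ∈ Set.Icc (0 : ℝ) 1) (h : unitCell n s = unitCell n t) :
    |s - t| ≤ 1 / (n + 1) := by
  have hn : (0 : ℝ) < n + 1 := by positivity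
  have key : ∀ t ∈ Set.Icc (0 : ℝ) 1, ((unitCell n t : ℕ) : ℝ) ≤ (n + 1) * t ∧
      (n + 1) * t ≤ (unitCell n t : ℕ) + 1 := by
    intro t ht
    have h0 : 0 ≤ ((n : ℝ) + 1) * t := mul_nonneg hn.le ht.1
    refine ⟨le_trans (Nat.cast_le.2 (min_le_left _ _)) (Nat.floor_le h0), ?_⟩
    · rcases le_total ⌊((n : ℝ) + 1) * t⌋₊ n with h | h
      · simp only [unitCell, min_eq_left h]
        exact (Nat.lt_floor_add_one _).le
      · simp only [unitCell, min_eq_right h]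
        nlinarith [ht.2]
  have h1 := key s hs
  have h2 := key t ht
  rw [h] at h1
  rw [le_div_iff₀ hn, ← abs_of_pos hn, ← abs_mul, abs_le]
  constructor <;> linarith

/-- Averaging a function over the cells of a fine partition changes it little where it
oscillates little. -/
theorem norm_stepFun_fibreMean_sub_le {𝕜 : Type*} [RCLike 𝕜] {p : ℝ≥0∞} {Ω ι : Type*}
    [MeasurableSpace Ω] {μ : Measure Ω} [IsFiniteMeasure μ] {κ : Ω → ι}
    (hpos : ∀ i, 0 < μ.real (κ ⁻¹' {i})) {g : Ω → 𝕜} (hg : Integrable g μ) {η : ℝ} {t : Ω}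
    (h : ∀ᵐ s ∂μ, κ s = κ t → ‖g s - g t‖ ≤ η) :
    ‖stepFun p μ κ (fibreMean p μ κ g) t - g t‖ ≤ η := by
  have hm := hpos (κ t)
  have h1 : stepFun p μ κ (fibreMean p μ κ g) t - g t =
      ((μ.real (κ ⁻¹' {κ t}))⁻¹ : ℝ) * ∫ s in κ ⁻¹' {κ t}, (g s - g t) ∂μ := by
    rw [stepFun_fibreMean hpos, integral_sub hg.integrableOn integrableOn_const, setIntegral_const,
      mul_sub, RCLike.real_smul_eq_coe_mul, ← mul_assoc, ← RCLike.ofReal_mul,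
      inv_mul_cancel₀ hm.ne', RCLike.ofReal_one, one_mul]
  rw [h1, norm_mul, RCLike.norm_ofReal, abs_of_pos (inv_pos.2 hm), inv_mul_le_iff₀ hm, mul_comm]
  exact norm_setIntegral_le_of_norm_le_const_ae' (measure_lt_top _ _) h

variable {p}

/-- The means of a function over the `n + 1` cells of the unit interval. -/
noncomputable def LpUnit.toCells (hp : p ≠ ∞) (n : ℕ) :
    LpUnit 𝕜 p →L[𝕜] EllFin 𝕜 p (n + 1) :=
  EllFin.mkCLM hp (fibreMeanLM (unitCell n)) 1 zero_le_one fun x => by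
    rw [one_mul]
    exact sum_norm_fibreMean_le hp (measurable_unitCell n) (measureReal_unitCell_pos n) x _

/-- The step function on the unit interval with given values on `n + 1` cells. -/
noncomputable def LpUnit.ofCells (hp : p ≠ ∞) (n : ℕ) :
    EllFin 𝕜 p (n + 1) →L[𝕜] LpUnit 𝕜 p :=
  stepCLM (toReal_pos_of_fact p hp) (measurable_unitCell n) (measureReal_unitCell_pos n)
    (WithLp.linearEquiv p 𝕜 (Fin (n + 1) → 𝕜)).toLinearMap fun x => by
      have hP := toReal_pos_of_fact p hp
      rw [tsum_fintype, EllFin.norm_rpow hp, ENNReal.ofReal_sum_of_nonneg fun i _ => by positivity]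
      exact Finset.sum_le_sum fun i _ => (enorm_rpow_eq_ofReal _ hP.le).le

theorem LpUnit.norm_toCells_le (hp : p ≠ ∞) (n : ℕ) : ‖LpUnit.toCells 𝕜 hp n‖ ≤ 1 :=
  EllFin.norm_mkCLM_le _ _ _ _ _

theorem LpUnit.norm_ofCells_le (hp : p ≠ ∞) (n : ℕ) : ‖LpUnit.ofCells 𝕜 hp n‖ ≤ 1 :=
  norm_stepCLM_le _ _ _ _ _

variable {𝕜}

theorem LpUnit.norm_ofCells_toCells_le (hp : p ≠ ∞) (n : ℕ) (x : LpUnit 𝕜 p) :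
    ‖LpUnit.ofCells 𝕜 hp n (LpUnit.toCells 𝕜 hp n x)‖ ≤ ‖x‖ := by
  have h1 := (LpUnit.ofCells 𝕜 hp n).le_of_opNorm_le (LpUnit.norm_ofCells_le 𝕜 hp n)
    (LpUnit.toCells 𝕜 hp n x)
  have h2 := (LpUnit.toCells 𝕜 hp n).le_of_opNorm_le (LpUnit.norm_toCells_le 𝕜 hp n) x
  rw [one_mul] at h1 h2
  exact h1.trans h2

theorem LpUnit.coeFn_ofCells_toCells (hp : p ≠ ∞) (n : ℕ) (x : LpUnit 𝕜 p) :
    LpUnit.ofCells 𝕜 hp n (LpUnit.toCells 𝕜 hp n x) =ᵐ[volume.restrict (Set.Icc (0 : ℝ) 1)]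
      stepFun p (volume.restrict (Set.Icc (0 : ℝ) 1)) (unitCell n)
        (fibreMean p (volume.restrict (Set.Icc (0 : ℝ) 1)) (unitCell n) x) :=
  coeFn_stepCLM _ _ _ _ _ _

/-- A continuous function on the unit interval is close to its averages over fine partitions. -/
theorem LpUnit.norm_ofCells_toCells_sub_le (hp : p ≠ ∞) {g : ℝ → 𝕜}
    (hg : MemLp g p (volume.restrict (Set.Icc (0 : ℝ) 1))) {n : ℕ} {η : ℝ} (hη : 0 ≤ η)
    (h : ∀ s t, |s - t| ≤ 1 / ((n : ℝ) + 1) → ‖g s - g t‖ ≤ η) :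
    ‖LpUnit.ofCells 𝕜 hp n (LpUnit.toCells 𝕜 hp n (hg.toLp g)) - hg.toLp g‖ ≤ η := by
  have hbd : ∀ᵐ t ∂volume.restrict (Set.Icc (0 : ℝ) 1),
      ‖(LpUnit.ofCells 𝕜 hp n (LpUnit.toCells 𝕜 hp n (hg.toLp g)) - hg.toLp g : LpUnit 𝕜 p) t‖
        ≤ η := by
    filter_upwards [Lp.coeFn_sub (LpUnit.ofCells 𝕜 hp n (LpUnit.toCells 𝕜 hp n (hg.toLp g)))
      (hg.toLp g), LpUnit.coeFn_ofCells_toCells hp n (hg.toLp g), hg.coeFn_toLp,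
      ae_restrict_mem measurableSet_Icc] with t h1 h2 h3 ht
    rw [h1, Pi.sub_apply, h2, h3, fibreMean_congr hg.coeFn_toLp]
    refine norm_stepFun_fibreMean_sub_le (measureReal_unitCell_pos n)
      (hg.integrable Fact.out) ?_
    filter_upwards [ae_restrict_mem measurableSet_Icc] with s hs hst
    exact h s t (abs_sub_le_of_unitCell_eq hs ht hst)
  refine (Lp.norm_le_of_ae_bound hη hbd).trans (le_of_eq ?_)
  simp [measureUnivNNReal]

theorem LpUnit.tendsto_ofCells_toCells (hp : p ≠ ∞) (x : LpUnit 𝕜 p) :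
    Tendsto (fun n => LpUnit.ofCells 𝕜 hp n (LpUnit.toCells 𝕜 hp n x)) atTop (𝓝 x) := by
  rw [Metric.tendsto_atTop]
  intro ε hε
  obtain ⟨g, hgc, hxg, hcont, hg⟩ := (Lp.memLp x).exists_hasCompactSupport_eLpNorm_sub_le hp
    (ε := ENNReal.ofReal (ε / 4)) (by simpa using hε)
  have hx : ‖x - hg.toLp g‖ ≤ ε / 4 := by
    have h1 : x - hg.toLp g = ((Lp.memLp x).sub hg).toLp _ := by
      rw [MemLp.toLp_sub (Lp.memLp x) hg, Lp.toLp_coeFn]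
    rw [h1, Lp.norm_toLp]
    exact ENNReal.toReal_le_of_le_ofReal (by positivity) hxg
  obtain ⟨δ, hδ, hgδ⟩ := Metric.uniformContinuous_iff.1
    (hgc.uniformContinuous_of_continuous hcont) (ε / 4) (by positivity)
  obtain ⟨N, hN⟩ := exists_nat_one_div_lt hδ
  refine ⟨N, fun n hn => ?_⟩
  have h2 := LpUnit.norm_ofCells_toCells_sub_le hp hg (n := n) (η := ε / 4) (by positivity)
    fun s t hst => by
      rw [← dist_eq_norm]
      refine (hgδ ?_).le
      rw [Real.dist_eq]
      exact (hst.trans (Nat.one_div_le_one_div hn)).trans_lt hN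
  have h3 := LpUnit.norm_ofCells_toCells_le hp n (x - hg.toLp g)
  rw [map_sub, map_sub] at h3
  rw [dist_eq_norm]
  have h4 := norm_add₃_le
    (a := LpUnit.ofCells 𝕜 hp n (LpUnit.toCells 𝕜 hp n x) -
      LpUnit.ofCells 𝕜 hp n (LpUnit.toCells 𝕜 hp n (hg.toLp g)))
    (b := LpUnit.ofCells 𝕜 hp n (LpUnit.toCells 𝕜 hp n (hg.toLp g)) - hg.toLp g)
    (c := hg.toLp g - x)
  rw [sub_add_sub_cancel, sub_add_sub_cancel, norm_sub_rev (hg.toLp g) x] at h4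
  linarith

variable (𝕜)

/-- Averaging over partitions of the unit interval. -/
noncomputable def LpUnit.lpApprox (hp : p ≠ ∞) : LpApprox 𝕜 p (LpUnit 𝕜 p) where
  K := 1
  J := LpUnit.toCells 𝕜 hp
  Q := LpUnit.ofCells 𝕜 hp
  one_le_K := le_rfl
  norm_J_le := LpUnit.norm_toCells_le 𝕜 hp
  norm_Q_le := LpUnit.norm_ofCells_le 𝕜 hp
  tendsto_Q_J := LpUnit.tendsto_ofCells_toCells hp

/-- The position of `t ∈ (0, 1)` in the partition into the intervals `(1 / (k + 2), 1 / (k + 1)]`. -/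
noncomputable def harmonicCell (t : ℝ) : ℕ := ⌊1 / t⌋₊ - 1

theorem measurable_harmonicCell : Measurable harmonicCell :=
  (Measurable.of_discrete (f := fun k : ℕ => k - 1)).comp
    (Nat.measurable_floor.comp (measurable_const.div measurable_id))

theorem measureReal_harmonicCell_pos (k : ℕ) :
    0 < (volume.restrict (Set.Icc (0 : ℝ) 1)).real (harmonicCell ⁻¹' {k}) := by
  refine measureReal_restrict_unit_pos (a := 1 / (k + 2)) (b := 1 / (k + 1)) (by positivity)
    (by gcongr; norm_num) (by rw [div_le_one (by positivity)]; linarith [k.cast_nonneg (α := ℝ)])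
    fun t ht => ?_
  have ht0 : 0 < t := lt_trans (by positivity) ht.1
  have h1 := (div_lt_comm₀ (by positivity) ht0).1 ht.1
  have h2 := (lt_div_comm₀ ht0 (by positivity)).1 ht.2
  have h3 : ⌊1 / t⌋₊ = k + 1 := by
    rw [Nat.floor_eq_iff (by positivity)]
    push_cast
    exact ⟨h2.le, by linarith⟩
  exact congrArg (fun m => m - 1) h3

/-- The span of disjointly supported functions is a complemented copy of `ℓ_p` in `L_p[0,1]`. -/
theorem factors_ell_lpUnit (hp : p ≠ ∞) : Factors 𝕜 (Ell 𝕜 p) (LpUnit 𝕜 p) := by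
  have hP := toReal_pos_of_fact p hp
  let L : Ell 𝕜 p →ₗ[𝕜] (ℕ → 𝕜) :=
    { toFun := fun c => c
      map_add' := fun _ _ => rfl
      map_smul' := fun _ _ => rfl }
  have hL : ∀ c, ∑' i, ‖L c i‖ₑ ^ p.toReal ≤ ENNReal.ofReal (‖c‖ ^ p.toReal) := fun c => by
    rw [ENNReal.tsum_eq_iSup_sum]
    refine iSup_le fun s => ?_
    simp only [enorm_rpow_eq_ofReal _ hP.le]
    rw [← ENNReal.ofReal_sum_of_nonneg fun i _ => by positivity]
    exact ENNReal.ofReal_le_ofReal (lp.sum_rpow_le_norm_rpow hP c s)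
  refine ⟨stepCLM hP measurable_harmonicCell measureReal_harmonicCell_pos L hL,
    Ell.mkCLM hp (fibreMeanLM harmonicCell) 1 zero_le_one fun x s => ?_, fun c => ?_⟩
  · rw [one_mul]
    exact sum_norm_fibreMean_le hp measurable_harmonicCell measureReal_harmonicCell_pos x s
  · ext i
    rw [Ell.mkCLM_apply, fibreMeanLM_apply, fibreMean_congr (coeFn_stepCLM _ _ _ _ _ c),
      fibreMean_stepFun measurable_harmonicCell measureReal_harmonicCell_pos]
    rfl

end UnitInterval

/-! ### Isomorphisms of operator spaces -/

/-- Up to isomorphism, `B(X, Y)` depends only on `p` and `q`. -/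
theorem LpApprox.nonempty_operators_equiv {𝕜 : Type*} [RCLike 𝕜] {p q : ℝ≥0∞} [Fact (1 ≤ p)]
    [Fact (1 ≤ q)] {X Y : Type*} [NormedAddCommGroup X] [NormedSpace 𝕜 X] [NormedAddCommGroup Y]
    [NormedSpace 𝕜 Y] [CompleteSpace Y] (S : LpApprox 𝕜 p X) (R : LpApprox 𝕜 q Y) (hpq : p ≤ q)
    (hq : 1 < q) (hq' : q ≠ ∞) (hX : Factors 𝕜 (Ell 𝕜 p) X) (hY : Factors 𝕜 (Ell 𝕜 q) Y) :
    Nonempty ((X →L[𝕜] Y) ≃L[𝕜] (Ell 𝕜 p →L[𝕜] Ell 𝕜 q)) := by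
  obtain ⟨e⟩ := S.nonempty_equiv_sumOps R hpq hq hq' hX hY
  obtain ⟨f⟩ := (Ell.lpApprox 𝕜 p (ne_top_of_le_ne_top hq' hpq)).nonempty_equiv_sumOps
    (Ell.lpApprox 𝕜 q hq') hpq hq hq' .refl .refl
  exact ⟨e.trans f.symm⟩

theorem theorem2p1 (𝕜 : Type*) [RCLike 𝕜] :
    (∀ (p q : ℝ≥0∞) [Fact (1 ≤ p)] [Fact (1 ≤ q)], 1 < p → p ≤ q → q < ∞ →
      ∀ (X Y : Type*)
        [NormedAddCommGroup X] [NormedSpace 𝕜 X] [CompleteSpace X]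
        [TopologicalSpace.SeparableSpace X]
        [NormedAddCommGroup Y] [NormedSpace 𝕜 Y] [CompleteSpace Y]
        [TopologicalSpace.SeparableSpace Y],
        ¬ FiniteDimensional 𝕜 X → ¬ FiniteDimensional 𝕜 Y →
        IsScriptLp 𝕜 p X → IsScriptLp 𝕜 q Y →
          Nonempty ((X →L[𝕜] Y) ≃L[𝕜] (Ell 𝕜 p →L[𝕜] Ell 𝕜 q)) ∧
          Nonempty ((Ell 𝕜 p →L[𝕜] Ell 𝕜 q) ≃L[𝕜] SumOps 𝕜 p q)) ∧
    (∀ (p : ℝ≥0∞) [Fact (1 ≤ p)], 1 < p → p < ∞ →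
      Nonempty ((Ell 𝕜 p →L[𝕜] Ell 𝕜 p) ≃L[𝕜] (LpUnit 𝕜 p →L[𝕜] LpUnit 𝕜 p))) := by
  constructor
  · intro p q _ _ hp hpq hq X Y _ _ _ _ _ _ _ _ hX hY hXp hYq
    have hp' : p ≠ ∞ := ne_top_of_le_ne_top hq.ne hpq
    have hq1 : 1 < q := hp.trans_le hpq
    obtain ⟨S⟩ := hXp.nonempty_lpApprox hp hp'
    obtain ⟨R⟩ := hYq.nonempty_lpApprox hq1 hq.ne
    exact ⟨S.nonempty_operators_equiv R hpq hq1 hq.ne (hXp.factors_ell S hp hp' hX)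
      (hYq.factors_ell R hq1 hq.ne hY), (Ell.lpApprox 𝕜 p hp').nonempty_equiv_sumOps
        (Ell.lpApprox 𝕜 q hq.ne) hpq hq1 hq.ne .refl .refl⟩
  · intro p _ hp hp'
    obtain ⟨e⟩ := (LpUnit.lpApprox 𝕜 hp'.ne).nonempty_operators_equiv (LpUnit.lpApprox 𝕜 hp'.ne)
      le_rfl hp hp'.ne (factors_ell_lpUnit 𝕜 hp'.ne) (factors_ell_lpUnit 𝕜 hp'.ne)
    exact ⟨e.symm⟩
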